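/- Let $\gamma,t\in\mathbb R$ with $|t|<\gamma$, and put $$\zeta=\frac t\gamma\in(-1,1),\qquad \omega=\frac{\pi(1+\zeta)}2\in(0,\pi),\qquad q=e^{-\pi^2/(2\gamma)}\in(0,1).$$ Let $\theta_1,\dots,\theta_4$ be the Jacobi theta functions with nome $q$, $$\theta_1(z)=2\sum_{n\ge0}(-1)^nq^{(n+\frac12)^2}\sin((2n+1)z),\qquad \theta_2(z)=2\sum_{n\ge0}q^{(n+\frac12)^2}\cos((2n+1)z),$$ $$\theta_3(z)=1+2\sum_{n\ge1}q^{n^2}\cos(2nz),\qquad \theta_4(z)=1+2\sum_{n\ge1}(-1)^nq^{n^2}\cos(2nz).$$ Among all Borel probability measures $\nu$ on $\mathbb R$ satisfying the constraint $\nu(a,b)\le\frac{b-a}{2\gamma}$ for all $a<b$, consider the energy $$H(\nu)=\iint_{x\ne y}\log\frac1{|x-y|}\,d\nu(x)\,d\nu(y)+\int(|x|-\zeta x)\,d\nu(x)\in(-\infty,+\infty],$$ where $H(\nu)=+\infty$ if $\int(|x|-\zeta x)\,d\nu(x)=+\infty$. There is a unique minimizer $\nu_0$ of $H$ (the constrained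 equilibrium measure). There are points $\alpha<\alpha'<0<\beta'<\beta$ such that the support of $\nu_0$ is $[\alpha,\beta]$ and $\nu_0$ has a continuous density $\rho$ with $\rho=\frac1{2\gamma}$ on the saturated region $[\alpha',\beta']$ and $0<\rho<\frac1{2\gamma}$ on $(\alpha,\alpha')\cup(\beta',\beta)$. Any such end-points are given by $$\alpha=-\pi\frac{\theta_1'(\frac\omega2)}{\theta_1(\frac\omega2)},\quad \alpha'=-\pi\frac{\theta_4'(\frac\omega2)}{\theta_4(\frac\omega2)},\quad \beta'=-\pi\frac{\theta_3'(\frac\omega2)}{\theta_3(\frac\omega2)},\quad \beta=-\pi\frac{\theta_2'(\frac\omega2)}{\theta_2(\frac\omega2)}.$$ Writing $\theta_j=\theta_j(\frac\omega2)$ in the fractions, their differences are $$\alpha'-\alpha=\pi\theta_4(0)^2\frac{\theta_2\theta_3}{\theta_1\theta_4},\quad \beta'-\alpha'=\pi\theta_2(0)^2\frac{\theta_1\theta_2}{\theta_3\theta_4},\quad \beta-\beta'=\pi\theta_4(0)^2\frac{\theta_1\theta_4}{\theta_2\theta_3},$$ $$\beta-\alpha=\pi\theta_2(0)^2\frac{\theta_3\theta_4}{\theta_1\theta_2},\quad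 \beta-\alpha'=\pi\theta_3(0)^2\frac{\theta_1\theta_3}{\theta_2\theta_4},\quad \beta'-\alpha=\pi\theta_3(0)^2\frac{\theta_2\theta_4}{\theta_1\theta_3},$$ and their centroid is given by Zinn-Justin's formula $$\frac{\alpha+\alpha'+\beta'+\beta}4=-\frac\pi2\,\frac{\theta_2'(\frac{\pi\zeta}2)}{\theta_2(\frac{\pi\zeta}2)}.$$ -/

import Mathlib

open MeasureTheory

noncomputable section

namespace SixVertexAF

/-! The four Jacobi theta functions of a real variable `z`, with elliptic nome `q`. -/

/-- `θ₁(z) = 2 ∑_{n ≥ 0} (-1)ⁿ q^{(n+1/2)²} sin((2n+1)z)`. -/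
def theta1 (q z : ℝ) : ℝ :=
  2 * ∑' n : ℕ, (-1 : ℝ) ^ n * q ^ (((n : ℝ) + 1 / 2) ^ 2) * Real.sin ((2 * (n : ℝ) + 1) * z)

/-- `θ₂(z) = 2 ∑_{n ≥ 0} q^{(n+1/2)²} cos((2n+1)z)`. -/
def theta2 (q z : ℝ) : ℝ :=
  2 * ∑' n : ℕ, q ^ (((n : ℝ) + 1 / 2) ^ 2) * Real.cos ((2 * (n : ℝ) + 1) * z)

/-- `θ₃(z) = 1 + 2 ∑_{n ≥ 1} q^{n²} cos(2nz)` (the sum is indexed by `n + 1`, `n ≥ 0`). -/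
def theta3 (q z : ℝ) : ℝ :=
  1 + 2 * ∑' n : ℕ, q ^ ((n + 1) ^ 2) * Real.cos (2 * ((n : ℝ) + 1) * z)

/-- `θ₄(z) = 1 + 2 ∑_{n ≥ 1} (-1)ⁿ q^{n²} cos(2nz)` (the sum is indexed by `n + 1`, `n ≥ 0`). -/
def theta4 (q z : ℝ) : ℝ :=
  1 + 2 * ∑' n : ℕ, (-1 : ℝ) ^ (n + 1) * q ^ ((n + 1) ^ 2) * Real.cos (2 * ((n : ℝ) + 1) * z)

/-- The potential `V(x) = |x| - ζ x`. -/
def potential (ζ x : ℝ) : ℝ := |x| - ζ * x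

/-- The constraint set: probability measures `ν` on `ℝ` with `ν(a,b) ≤ (b-a)/(2γ)` for all
`a < b`. -/
structure IsAdmissible (γ : ℝ) (ν : Measure ℝ) : Prop where
  isProbabilityMeasure : IsProbabilityMeasure ν
  le_of_lt : ∀ a b : ℝ, a < b → ν (Set.Ioo a b) ≤ ENNReal.ofReal ((b - a) / (2 * γ))

open scoped Classical in
/-- The energy `H(ν) = ∬_{x ≠ y} log (1/|x-y|) dν(x) dν(y) + ∫ (|x| - ζx) dν(x)`, with values in
`(-∞, +∞]`. For admissible `ν` and `|ζ| < 1`: if `∫ V dν < ∞` then `ν` has a finite first moment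
and a bounded density, so both integrals converge absolutely; if `∫ V dν = ∞` then
`H(ν) = +∞`, since the kernel `log (1/|x-y|) + (V(x) + V(y))/2` is bounded below by
`c(|x| + |y|) - C` for some `c > 0`. -/
def energy (ζ : ℝ) (ν : Measure ℝ) : EReal :=
  if Integrable (potential ζ) ν then
    (((∫ p in {p : ℝ × ℝ | p.1 ≠ p.2}, Real.log (1 / |p.1 - p.2|) ∂(ν.prod ν)) +
      ∫ x, potential ζ x ∂ν : ℝ) : EReal)
  else ⊤

/-- `ν` is an equilibrium measure: it is admissible and minimizes the energy among all
admissible measures. -/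
structure IsEquilibriumMeasure (γ ζ : ℝ) (ν : Measure ℝ) : Prop where
  isAdmissible : IsAdmissible γ ν
  energy_le : ∀ ν' : Measure ℝ, IsAdmissible γ ν' → energy ζ ν ≤ energy ζ ν'

/-- `α < α' < 0 < β' < β` are the end-points of `ν`: the support of `ν` is `[α, β]`, and `ν` has
a continuous density `ρ` that equals `1/(2γ)` on the saturated region `[α', β']` and lies
strictly between `0` and `1/(2γ)` on `(α, α') ∪ (β', β)`. -/
structure AreEndpoints (γ : ℝ) (ν : Measure ℝ) (α α' β' β : ℝ) : Prop where
  lt₁ : α < α'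
  lt₂ : α' < 0
  lt₃ : 0 < β'
  lt₄ : β' < β
  support_eq : ν.support = Set.Icc α β
  density : ∃ ρ : ℝ → ℝ, Continuous ρ ∧
    ν = volume.withDensity (fun x => ENNReal.ofReal (ρ x)) ∧
    (∀ x ∈ Set.Icc α' β', ρ x = 1 / (2 * γ)) ∧
    (∀ x ∈ Set.Ioo α α' ∪ Set.Ioo β' β, 0 < ρ x ∧ ρ x < 1 / (2 * γ))

end SixVertexAF

end

/-! The constrained equilibrium problem is solved by an explicit elliptic uniformization. Put `a =
π/(2γ)`, so that `q = e^{-πa}`, and `w = ω/2`. The function `x(u) = -(π/2) ∂_w log (θ₁(w+u)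
θ₁(w-u))` is even and elliptic with periods `π` and `iπa`, with simple poles at `±w`. It is real on
the boundary of the rectangle with corners `0`, `π/2`, `π/2 + iπa/2`, `iπa/2`, which go to `α`, `β`,
`β'`, `α'`. The vertical edges become the two bands, the upper edge the saturated region, and the
lower edge passes through the pole `w` and gives the outside of the support.

On this curve the derivative of the logarithmic potential should be `(2/π)(Re u - w)` and the
density should be `2/π²` times the height of `u`. The candidate is therefore built in layers: for
each height `s` it carries uniform mass on the interval between the two edge points of height `s`.
Its field is the integral over `s` of `log (x - xL s) - log (x - xR s)`, which `log_sub_log_eq`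
rewrites through `log |θ₁/θ₂|` at `u ± is` and `w ± is`. The integral of `log |θ₁/θ₂|` over a
vertical period is affine in the real part (`integral_logRatio`), because its Fourier coefficients
add up to a difference of two second Bernoulli polynomials. This is `potDeriv_eq`; comparison with
the pole at `w` then fixes the total mass (`integral_xR_sub_xL`).

Since `0 ≤ Re u ≤ π/2` on the boundary, the field stays between the two slopes of half the external
potential and attains them on the bands. So the effective potential decreases on the negative axis,
increases on the positive axis, and is constant on each band. The two constants agree because `x`
has mean zero on the upper edge (`integral_xS`), and the same fact gives `α' < 0 < β'`. These
Euler-Lagrange conditions suffice for a unique minimum (`isEquilibriumMeasure_of_effPot`) because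
the logarithmic energy is strictly positive on differences of probability measures: by Frullani's
integral it is a superposition of Gaussian energies, which are squared L² norms of differences of
characteristic functions.

The closed formulas come from theta identities. With `A = thA` and `B = thB`, the map `x` is a
Möbius function of `A(u)/B(u)`. At a corner its denominator is the square `θ_j(w)²`, whence `-π
θ_j'/θ_j`. Differences of values are governed by the Wronskian of `A` and `B`, that is by the
product of the four thetas. The centroid formula is the logarithmic derivative of the duplication
formula for `θ₁`, which rests on Jacobi's triple product. -/

noncomputable section

namespace SixVertexAF

/-! ### Gaussian binomials and the finite triple product. -/

open Finset in
/-- The finite product `(p; p)_m`. -/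
def eulerProd (p : ℝ) (m : ℕ) : ℝ := ∏ k ∈ range m, (1 - p ^ (k + 1))

/-- The Gaussian binomial coefficients. -/
def gaussBinom (p : ℝ) : ℕ → ℕ → ℝ
  | _, 0 => 1
  | 0, _ + 1 => 0
  | m + 1, j + 1 => gaussBinom p m j + p ^ (j + 1) * gaussBinom p m (j + 1)

lemma gaussBinom_eq_zero (p : ℝ) : ∀ m j : ℕ, m < j → gaussBinom p m j = 0
  | _, 0, h => absurd h (Nat.not_lt_zero _)
  | 0, j + 1, _ => by simp [gaussBinom]
  | m + 1, j + 1, h => by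
    rw [gaussBinom, gaussBinom_eq_zero p m j (by omega), gaussBinom_eq_zero p m (j + 1) (by omega)]
    simp

lemma gaussBinom_zero_right (p : ℝ) (m : ℕ) : gaussBinom p m 0 = 1 := by
  cases m <;> simp [gaussBinom]

lemma gaussBinom_self (p : ℝ) (m : ℕ) : gaussBinom p m m = 1 := by
  induction m with
  | zero => simp [gaussBinom]
  | succ m ih => rw [gaussBinom, ih, gaussBinom_eq_zero p m (m + 1) (by omega)]; simp

lemma eulerProd_succ (p : ℝ) (m : ℕ) :
    eulerProd p (m + 1) = eulerProd p m * (1 - p ^ (m + 1)) := Finset.prod_range_succ _ _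

/-- Pascal's rule gives the quotient formula for Gaussian binomials; stated without division it
needs no restriction on `p`. -/
lemma gaussBinom_mul_eulerProd (p : ℝ) (m : ℕ) : ∀ j l : ℕ, j + l = m →
    gaussBinom p m j * (eulerProd p j * eulerProd p l) = eulerProd p m := by
  induction m with
  | zero =>
    intro j l h
    obtain ⟨rfl, rfl⟩ : j = 0 ∧ l = 0 := by omega
    simp [gaussBinom, eulerProd]
  | succ m ih =>
    intro j l h
    rcases j with _ | j
    · obtain rfl : l = m + 1 := by omega
      simp [gaussBinom, eulerProd]
    rcases l with _ | l
    · obtain rfl : j = m := by omega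
      simp [gaussBinom_self, eulerProd]
    · have h1 := ih j (l + 1) (by omega)
      have h2 := ih (j + 1) l (by omega)
      obtain rfl : m = j + l + 1 := by omega
      rw [gaussBinom]
      rw [eulerProd_succ p (j + l + 1)]
      rw [eulerProd_succ] at h1 h2 ⊢
      rw [eulerProd_succ p l]
      have e : p ^ (j + l + 1 + 1) = p ^ (j + 1) * p ^ (l + 1) := by ring
      rw [e]
      -- The splitting used is `1 - p^(j+l+2) = (1 - p^(j+1)) + p^(j+1) (1 - p^(l+1))`.
      linear_combination (1 - p ^ (j + 1)) * h1 + p ^ (j + 1) * (1 - p ^ (l + 1)) * h2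

-- The q-binomial theorem. Splitting off the factor `k = 0` leaves the product of length `m` at `p
-- X`, and comparing coefficients is exactly the recursion for `gaussBinom`.
open Finset in
lemma prod_one_add_pow_mul (p : ℝ) (m : ℕ) : ∀ X : ℂ,
    ∏ k ∈ range m, (1 + (p : ℂ) ^ k * X) =
      ∑ j ∈ range (m + 1), (gaussBinom p m j : ℂ) * (p : ℂ) ^ (j.choose 2) * X ^ j := by
  induction m with
  | zero => intro X; simp [gaussBinom]
  | succ m ih =>
    intro X
    rw [prod_range_succ', pow_zero, one_mul]
    have : ∀ k, (1 + (p : ℂ) ^ (k + 1) * X) = 1 + (p : ℂ) ^ k * (p * X) := fun k => by ring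
    simp_rw [this]
    rw [ih, sum_range_succ' _ (m + 1), mul_add, mul_one]
    have e1 : ∑ j ∈ range (m + 1), (gaussBinom p m j : ℂ) * (p : ℂ) ^ (j.choose 2) * (p * X) ^ j
        = ∑ j ∈ range (m + 1), (gaussBinom p m (j + 1) : ℂ) * (p : ℂ) ^ ((j + 1).choose 2) *
          (p * X) ^ (j + 1) + 1 := by
      have := sum_range_succ' (fun j => (gaussBinom p m j : ℂ) * (p : ℂ) ^ (j.choose 2) *
        (p * X) ^ j) (m + 1)
      rw [sum_range_succ, gaussBinom_eq_zero p m (m + 1) (by omega)] at this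
      simpa [gaussBinom_zero_right] using this
    conv_lhs => arg 1; rw [e1]
    rw [add_right_comm, sum_mul, ← sum_add_distrib]
    congr 1
    · refine sum_congr rfl fun j _ => ?_
      rw [gaussBinom, Nat.choose_succ_succ' j 1, Nat.choose_one_right]
      push_cast
      ring
    · simp [gaussBinom]

open Finset in
lemma prod_inv_pow_mul (q x : ℂ) (N : ℕ) :
    ∏ k ∈ range N, ((q ^ (2 * k + 1))⁻¹ * x) = (q ^ N ^ 2)⁻¹ * x ^ N := by
  induction N with
  | zero => simp
  | succ N ih => rw [prod_range_succ, ih, show (N + 1) ^ 2 = N ^ 2 + (2 * N + 1) by ring, pow_add,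
      mul_inv, pow_succ x]; ring

-- The q-binomial theorem with base `q²`, length `2N` and `X = q^(1-2N) x`: the last `N` factors are
-- those in `x`, while each of the first `N`, read backwards, is `q^(-(2k+1)) x` times a factor in
-- `x⁻¹`.
open Finset in
lemma finite_tripleProduct {q : ℝ} (hq : q ≠ 0) {x : ℂ} (hx : x ≠ 0) (N : ℕ) :
    ∏ k ∈ range N, ((1 + (q : ℂ) ^ (2 * k + 1) * x) * (1 + (q : ℂ) ^ (2 * k + 1) * x⁻¹)) =
      ∑ j ∈ range (2 * N + 1), (gaussBinom (q ^ 2) (2 * N) j : ℂ) *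
        (q : ℂ) ^ (((j : ℤ) - N) ^ 2) * x ^ ((j : ℤ) - N) := by
  have hq' : (q : ℂ) ≠ 0 := by exact_mod_cast hq
  have key := prod_one_add_pow_mul (q ^ 2) (N + N) ((q : ℂ) ^ (1 - 2 * (N : ℤ)) * x)
  rw [prod_range_add, ← prod_range_reflect] at key
  have e1 : ∏ j ∈ range N, (1 + ((q ^ 2 : ℝ) : ℂ) ^ (N - 1 - j) * ((q : ℂ) ^ (1 - 2 * (N : ℤ)) * x))
      = ((q : ℂ) ^ N ^ 2)⁻¹ * x ^ N * ∏ k ∈ range N, (1 + (q : ℂ) ^ (2 * k + 1) * x⁻¹) := by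
    rw [← prod_inv_pow_mul, ← prod_mul_distrib]
    refine prod_congr rfl fun j hj => ?_
    have hj' := mem_range.1 hj
    have : ((q ^ 2 : ℝ) : ℂ) ^ (N - 1 - j) * ((q : ℂ) ^ (1 - 2 * (N : ℤ)) * x)
        = ((q : ℂ) ^ (2 * j + 1))⁻¹ * x := by
      rw [← mul_assoc]
      congr 1
      push_cast
      rw [← pow_mul, ← zpow_natCast, ← zpow_natCast, ← zpow_neg, ← zpow_add₀ hq']
      congr 1
      omega
    rw [this]
    field_simp
    ring
  have e2 : ∏ j ∈ range N, (1 + ((q ^ 2 : ℝ) : ℂ) ^ (N + j) * ((q : ℂ) ^ (1 - 2 * (N : ℤ)) * x))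
      = ∏ k ∈ range N, (1 + (q : ℂ) ^ (2 * k + 1) * x) := by
    refine prod_congr rfl fun j hj => ?_
    rw [← mul_assoc]
    congr 2
    push_cast
    rw [← pow_mul, ← zpow_natCast, ← zpow_natCast, ← zpow_add₀ hq']
    congr 1
    push_cast
    ring
  rw [e1, e2] at key
  rw [prod_mul_distrib]
  have key' : (∏ k ∈ range N, (1 + (q : ℂ) ^ (2 * k + 1) * x)) *
      (∏ k ∈ range N, (1 + (q : ℂ) ^ (2 * k + 1) * x⁻¹)) = ((q : ℂ) ^ N ^ 2) * (x ^ N)⁻¹ *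
      ∑ j ∈ range (N + N + 1), (gaussBinom (q ^ 2) (N + N) j : ℂ) *
        ((q ^ 2 : ℝ) : ℂ) ^ (j.choose 2) * ((q : ℂ) ^ (1 - 2 * (N : ℤ)) * x) ^ j := by
    rw [← key]
    generalize ∏ k ∈ range N, (1 + (q : ℂ) ^ (2 * k + 1) * x) = Y
    generalize ∏ k ∈ range N, (1 + (q : ℂ) ^ (2 * k + 1) * x⁻¹) = Z
    field_simp
  rw [key', mul_sum, two_mul N]
  refine sum_congr rfl fun j _ => ?_
  have e3 : ((q ^ 2 : ℝ) : ℂ) ^ (j.choose 2) * (q : ℂ) ^ j = (q : ℂ) ^ (j ^ 2) := by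
    push_cast
    rw [← pow_mul, ← pow_add]
    congr 1
    have := Nat.triangle_succ j
    have h2 : 2 ∣ j * (j - 1) := by
      rcases j with _ | j
      · simp
      · rw [mul_comm]; exact (Nat.even_mul_succ_self j).two_dvd
    rw [Nat.choose_two_right, Nat.mul_div_cancel' h2]
    rcases j with _ | j
    · simp
    · simp; ring
  have e4 : (q : ℂ) ^ (((j : ℤ) - N) ^ 2) = (q : ℂ) ^ N ^ 2 * (q : ℂ) ^ j ^ 2 *
      ((q : ℂ) ^ (- 2 * (N : ℤ))) ^ j := by
    rw [← zpow_natCast, ← zpow_natCast, ← zpow_natCast, ← zpow_mul, ← zpow_add₀ hq',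
      ← zpow_add₀ hq']
    congr 1
    push_cast
    ring
  have e5 : (q : ℂ) ^ (1 - 2 * (N : ℤ)) = q * (q : ℂ) ^ (- 2 * (N : ℤ)) := by
    rw [← zpow_one_add₀ hq']; congr 1
  rw [e4, ← e3, e5, zpow_sub₀ hx, zpow_natCast, zpow_natCast, mul_pow, mul_pow]
  field_simp

/-! ### Infinite products and Jacobi's triple product. -/

open Filter Topology

/-- The infinite product `(X; p)_∞`. -/
def qPoch (p : ℝ) (X : ℂ) : ℂ := ∏' n : ℕ, (1 - (p : ℂ) ^ n * X)

lemma summable_norm_pow_mul {p : ℝ} (h0 : 0 < p) (h1 : p < 1) (X : ℂ) :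
    Summable fun n : ℕ => ‖-((p : ℂ) ^ n * X)‖ := by
  simp only [norm_neg, norm_mul, norm_pow, Complex.norm_real, Real.norm_eq_abs, abs_of_pos h0]
  exact (summable_geometric_of_lt_one h0.le h1).mul_right _

lemma hasProd_qPoch {p : ℝ} (h0 : 0 < p) (h1 : p < 1) (X : ℂ) :
    HasProd (fun n : ℕ => 1 - (p : ℂ) ^ n * X) (qPoch p X) := by
  have := multipliable_one_add_of_summable (summable_norm_pow_mul h0 h1 X)
  simp only [← sub_eq_add_neg] at this
  exact this.hasProd

lemma qPoch_eq_mul {p : ℝ} (h0 : 0 < p) (h1 : p < 1) (X : ℂ) :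
    qPoch p X = (1 - X) * qPoch p (p * X) := by
  have h := hasProd_qPoch h0 h1 (p * X)
  have e : ∀ n : ℕ, (1 - (p : ℂ) ^ n * (p * X)) = 1 - (p : ℂ) ^ (n + 1) * X := fun n => by ring
  simp_rw [e] at h
  have h2 := HasProd.zero_mul (f := fun n : ℕ => 1 - (p : ℂ) ^ n * X) h
  rw [pow_zero, one_mul] at h2
  exact (hasProd_qPoch h0 h1 X).unique h2

lemma qPoch_ne_zero {p : ℝ} (h0 : 0 < p) (h1 : p < 1) {X : ℂ} (hX : ∀ n : ℕ, (p : ℂ) ^ n * X ≠ 1) :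
    qPoch p X ≠ 0 := by
  have := tprod_one_add_ne_zero_of_summable (f := fun n : ℕ => -((p : ℂ) ^ n * X))
    (fun i => by rw [← sub_eq_add_neg, sub_ne_zero]; exact (hX i).symm)
    (summable_norm_pow_mul h0 h1 X)
  simp only [← sub_eq_add_neg] at this
  exact this

lemma pow_mul_ne_one_of_norm_lt {p : ℝ} (h0 : 0 < p) (h1 : p < 1) {X : ℂ} (hX : ‖X‖ < 1) (n : ℕ) :
    (p : ℂ) ^ n * X ≠ 1 := by
  intro h
  have h' := congrArg norm h
  rw [norm_mul, norm_pow, Complex.norm_real, Real.norm_eq_abs, abs_of_pos h0, norm_one] at h'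
  have := pow_le_one₀ h0.le h1.le (n := n)
  nlinarith [norm_nonneg X, pow_pos h0 n]

lemma qPoch_ne_zero_of_norm_lt {p : ℝ} (h0 : 0 < p) (h1 : p < 1) {X : ℂ} (hX : ‖X‖ < 1) :
    qPoch p X ≠ 0 :=
  qPoch_ne_zero h0 h1 (pow_mul_ne_one_of_norm_lt h0 h1 hX)

lemma conj_qPoch {p : ℝ} (h0 : 0 < p) (h1 : p < 1) (X : ℂ) :
    (starRingEnd ℂ) (qPoch p X) = qPoch p ((starRingEnd ℂ) X) := by
  have := (hasProd_qPoch h0 h1 X).map (starRingEnd ℂ) Complex.continuous_conj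
  refine (this.unique ?_)
  convert hasProd_qPoch h0 h1 ((starRingEnd ℂ) X) using 2 with n
  simp

lemma continuous_qPoch {p : ℝ} (h0 : 0 < p) (h1 : p < 1) : Continuous (qPoch p) := by
  rw [continuous_iff_continuousAt]
  intro X₀
  have hu : Summable fun n : ℕ => p ^ n * (‖X₀‖ + 1) :=
    (summable_geometric_of_lt_one h0.le h1).mul_right _
  have h := hu.hasProdLocallyUniformlyOn_nat_one_add (f := fun (n : ℕ) (X : ℂ) => -((p : ℂ) ^ n * X))
    (K := Metric.ball X₀ 1) Metric.isOpen_ball ?_ ?_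
  · have h2 := h.tendstoLocallyUniformlyOn_finsetRange.continuousOn (Frequently.of_forall fun n => by fun_prop)
    refine ContinuousAt.congr (h2.continuousAt (Metric.ball_mem_nhds X₀ one_pos))
      (Eventually.of_forall fun X => ?_)
    simp only [qPoch, sub_eq_add_neg]
  · refine Eventually.of_forall fun n X hX => ?_
    rw [norm_neg, norm_mul, norm_pow, Complex.norm_real, Real.norm_eq_abs, abs_of_pos h0]
    gcongr
    have := norm_sub_norm_le X X₀
    rw [mem_ball_iff_norm] at hX
    linarith
  · intro n; fun_prop

lemma ofReal_eulerProd (p : ℝ) (m : ℕ) :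
    (eulerProd p m : ℂ) = ∏ n ∈ Finset.range m, (1 - (p : ℂ) ^ n * p) := by
  simp [eulerProd, pow_succ]

/-- The infinite product `(p; p)_∞`. -/
def eulerLim (p : ℝ) : ℝ := (qPoch p p).re

lemma ofReal_eulerLim {p : ℝ} (h0 : 0 < p) (h1 : p < 1) : (eulerLim p : ℂ) = qPoch p p := by
  have := conj_qPoch h0 h1 p
  rw [Complex.conj_ofReal] at this
  exact (Complex.conj_eq_iff_re.1 this)

lemma tendsto_eulerProd {p : ℝ} (h0 : 0 < p) (h1 : p < 1) :
    Tendsto (eulerProd p) atTop (𝓝 (eulerLim p)) := by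
  have h := (hasProd_qPoch h0 h1 p).tendsto_prod_nat
  simp_rw [← ofReal_eulerProd, ← ofReal_eulerLim h0 h1] at h
  exact (Complex.continuous_re.tendsto _).comp h

lemma eulerProd_pos {p : ℝ} (h0 : 0 < p) (h1 : p < 1) (m : ℕ) : 0 < eulerProd p m :=
  Finset.prod_pos fun k _ => sub_pos.2 (pow_lt_one₀ h0.le h1 (by omega))

lemma eulerProd_antitone {p : ℝ} (h0 : 0 < p) (h1 : p < 1) : Antitone (eulerProd p) :=
  antitone_nat_of_succ_le fun m => by
    rw [eulerProd_succ]
    nlinarith [eulerProd_pos h0 h1 m, pow_pos h0 (m + 1)]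

lemma eulerLim_pos {p : ℝ} (h0 : 0 < p) (h1 : p < 1) : 0 < eulerLim p := by
  have h : 0 ≤ eulerLim p :=
    ge_of_tendsto' (tendsto_eulerProd h0 h1) fun m => (eulerProd_pos h0 h1 m).le
  refine lt_of_le_of_ne h fun h' => ?_
  have := ofReal_eulerLim h0 h1
  rw [← h'] at this
  refine qPoch_ne_zero_of_norm_lt h0 h1 (X := p) ?_ this.symm
  rwa [Complex.norm_real, Real.norm_eq_abs, abs_of_pos h0]

lemma eulerLim_le {p : ℝ} (h0 : 0 < p) (h1 : p < 1) (m : ℕ) : eulerLim p ≤ eulerProd p m :=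
  (eulerProd_antitone h0 h1).le_of_tendsto (tendsto_eulerProd h0 h1) m

lemma eulerProd_le_one {p : ℝ} (h0 : 0 < p) (h1 : p < 1) (m : ℕ) : eulerProd p m ≤ 1 := by
  simpa [eulerProd] using eulerProd_antitone h0 h1 (Nat.zero_le m)

lemma gaussBinom_eq_div {p : ℝ} (h0 : 0 < p) (h1 : p < 1) (j l : ℕ) :
    gaussBinom p (j + l) j = eulerProd p (j + l) / (eulerProd p j * eulerProd p l) := by
  rw [eq_div_iff (mul_pos (eulerProd_pos h0 h1 j) (eulerProd_pos h0 h1 l)).ne']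
  exact gaussBinom_mul_eulerProd p _ j l rfl

lemma abs_gaussBinom_le {p : ℝ} (h0 : 0 < p) (h1 : p < 1) (j l : ℕ) :
    |gaussBinom p (j + l) j| ≤ 1 / (eulerLim p) ^ 2 := by
  have hj := eulerProd_pos h0 h1 j
  have hl := eulerProd_pos h0 h1 l
  have hE := eulerLim_pos h0 h1
  rw [gaussBinom_eq_div h0 h1, abs_of_pos (by have := eulerProd_pos h0 h1 (j + l); positivity), sq]
  gcongr
  · exact eulerProd_le_one h0 h1 _
  · exact eulerLim_le h0 h1 _
  · exact eulerLim_le h0 h1 _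

/-- The Laurent coefficients of the finite triple product. -/
def tripleCoeff (q : ℝ) (N : ℕ) (i : ℤ) : ℝ :=
  if i ∈ Finset.Icc (-(N : ℤ)) N then gaussBinom (q ^ 2) (2 * N) (i + N).toNat else 0

lemma finite_tripleProduct_eq_tsum {q : ℝ} (hq : q ≠ 0) {x : ℂ} (hx : x ≠ 0) (N : ℕ) :
    ∏ k ∈ Finset.range N, ((1 + (q : ℂ) ^ (2 * k + 1) * x) * (1 + (q : ℂ) ^ (2 * k + 1) * x⁻¹)) =
      ∑' i : ℤ, (tripleCoeff q N i : ℂ) * ((q : ℂ) ^ (i ^ 2) * x ^ i) := by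
  rw [finite_tripleProduct hq hx, tsum_eq_sum (s := Finset.Icc (-(N : ℤ)) N)]
  · refine Finset.sum_bij' (fun j _ => (j : ℤ) - N) (fun i _ => (i + N).toNat) ?_ ?_ ?_ ?_ ?_
    · intro j hj; simp only [Finset.mem_range, Finset.mem_Icc] at hj ⊢; omega
    · intro i hi; simp only [Finset.mem_range, Finset.mem_Icc] at hi ⊢; omega
    · intro j hj; simp
    · intro i hi; simp only [Finset.mem_Icc] at hi; omega
    · intro j hj
      have : (j : ℤ) - N ∈ Finset.Icc (-(N : ℤ)) N := by
        simp only [Finset.mem_range, Finset.mem_Icc] at hj ⊢; omega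
      rw [tripleCoeff, if_pos this]
      simp [mul_assoc]
  · intro i hi
    rw [tripleCoeff, if_neg hi]
    simp

lemma tripleCoeff_of_le (q : ℝ) {N : ℕ} {i : ℤ} (hi : i.natAbs ≤ N) :
    tripleCoeff q N i = gaussBinom (q ^ 2) ((i + N).toNat + (N - i).toNat) (i + N).toNat := by
  have : i ∈ Finset.Icc (-(N : ℤ)) N := by simp only [Finset.mem_Icc]; omega
  rw [tripleCoeff, if_pos this]
  congr 1
  omega

lemma abs_tripleCoeff_le {q : ℝ} (h0 : 0 < q ^ 2) (h1 : q ^ 2 < 1) (N : ℕ) (i : ℤ) :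
    |tripleCoeff q N i| ≤ 1 / (eulerLim (q ^ 2)) ^ 2 := by
  by_cases hi : i.natAbs ≤ N
  · rw [tripleCoeff_of_le q hi]
    exact abs_gaussBinom_le h0 h1 _ _
  · rw [tripleCoeff, if_neg (by simp only [Finset.mem_Icc]; omega), abs_zero]
    positivity

lemma tendsto_tripleCoeff {q : ℝ} (h0 : 0 < q ^ 2) (h1 : q ^ 2 < 1) (i : ℤ) :
    Tendsto (fun N => tripleCoeff q N i) atTop (𝓝 (1 / eulerLim (q ^ 2))) := by
  have hE := eulerLim_pos h0 h1
  have a1 : Tendsto (fun N : ℕ => (i + N).toNat) atTop atTop :=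
    tendsto_atTop.2 fun b => (eventually_ge_atTop (b + i.natAbs)).mono fun N hN => by omega
  have a2 : Tendsto (fun N : ℕ => ((N : ℤ) - i).toNat) atTop atTop :=
    tendsto_atTop.2 fun b => (eventually_ge_atTop (b + i.natAbs)).mono fun N hN => by omega
  have t := tendsto_eulerProd h0 h1
  have key := (t.comp (a1.atTop_add_atTop a2)).div ((t.comp a1).mul (t.comp a2))
    (mul_pos hE hE).ne'
  have e : eulerLim (q ^ 2) / (eulerLim (q ^ 2) * eulerLim (q ^ 2)) = 1 / eulerLim (q ^ 2) := by
    field_simp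
  rw [e] at key
  refine key.congr' ((eventually_ge_atTop i.natAbs).mono fun N hN => ?_)
  exact ((tripleCoeff_of_le q hN).trans (gaussBinom_eq_div h0 h1 _ _)).symm

/-- **Jacobi's triple product**. -/
theorem tripleProduct {q : ℝ} (h0 : 0 < q) (h1 : q < 1) {x : ℂ} (hx : x ≠ 0)
    (hs : Summable fun i : ℤ => (q : ℂ) ^ (i ^ 2) * x ^ i) :
    ∑' i : ℤ, (q : ℂ) ^ (i ^ 2) * x ^ i =
      eulerLim (q ^ 2) * (qPoch (q ^ 2) (-q * x) * qPoch (q ^ 2) (-q * x⁻¹)) := by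
  have p0 : 0 < q ^ 2 := by positivity
  have p1 : q ^ 2 < 1 := pow_lt_one₀ h0.le h1 two_ne_zero
  have hE := eulerLim_pos p0 p1
  -- The finite identity passes to the limit by dominated convergence: for each index the
  -- coefficient tends to `1/(q²;q²)_∞` and is bounded, uniformly in `N`, by the square of that
  -- number.
  have t1 : Tendsto (fun N : ℕ => ∑' i : ℤ, (tripleCoeff q N i : ℂ) * ((q : ℂ) ^ (i ^ 2) * x ^ i))
      atTop (𝓝 (∑' i : ℤ, ((1 / eulerLim (q ^ 2) : ℝ) : ℂ) * ((q : ℂ) ^ (i ^ 2) * x ^ i))) := by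
    refine tendsto_tsum_of_dominated_convergence
      (bound := fun i => 1 / (eulerLim (q ^ 2)) ^ 2 * ‖(q : ℂ) ^ (i ^ 2) * x ^ i‖)
      (hs.norm.mul_left _) (fun i => ?_) (Eventually.of_forall fun N i => ?_)
    · exact ((Complex.continuous_ofReal.tendsto _).comp (tendsto_tripleCoeff p0 p1 i)).mul_const _
    · rw [norm_mul, Complex.norm_real]
      gcongr
      exact abs_tripleCoeff_le p0 p1 N i
  have t2 : Tendsto (fun N : ℕ => ∏ k ∈ Finset.range N,
      ((1 + (q : ℂ) ^ (2 * k + 1) * x) * (1 + (q : ℂ) ^ (2 * k + 1) * x⁻¹)))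
      atTop (𝓝 (qPoch (q ^ 2) (-q * x) * qPoch (q ^ 2) (-q * x⁻¹))) := by
    have := ((hasProd_qPoch p0 p1 (-q * x)).tendsto_prod_nat).mul
      ((hasProd_qPoch p0 p1 (-q * x⁻¹)).tendsto_prod_nat)
    refine this.congr fun N => ?_
    rw [← Finset.prod_mul_distrib]
    refine Finset.prod_congr rfl fun k _ => ?_
    push_cast
    ring
  simp_rw [finite_tripleProduct_eq_tsum h0.ne' hx] at t2
  have := tendsto_nhds_unique t1 t2
  rw [tsum_mul_left] at this
  rw [← this]
  push_cast
  have hE' : (eulerLim (q ^ 2) : ℂ) ≠ 0 := by exact_mod_cast hE.ne'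
  field_simp

/-! ### Complex theta functions and their quasi-periodicity. -/

open Filter Topology Complex

/-- The third Jacobi theta function of a complex variable, with nome `exp (-π a)`. -/
def th3 (a : ℝ) (u : ℂ) : ℂ := jacobiTheta₂ (u / Real.pi) (a * I)

/-- The fourth Jacobi theta function of a complex variable, with nome `exp (-π a)`. -/
def th4 (a : ℝ) (u : ℂ) : ℂ := th3 a (u + Real.pi / 2)

/-- The second Jacobi theta function of a complex variable, with nome `exp (-π a)`. -/
def th2 (a : ℝ) (u : ℂ) : ℂ :=
  cexp (-(Real.pi * a / 4) + I * u) * th3 a (u + Real.pi * a / 2 * I)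

/-- The first Jacobi theta function of a complex variable, with nome `exp (-π a)`. -/
def th1 (a : ℝ) (u : ℂ) : ℂ := th2 a (u - Real.pi / 2)

lemma pi_ne_zero' : (Real.pi : ℂ) ≠ 0 := by exact_mod_cast Real.pi_ne_zero

lemma hasSum_th3 {a : ℝ} (ha : 0 < a) (u : ℂ) :
    HasSum (fun n : ℤ => cexp (2 * I * n * u - Real.pi * a * n ^ 2)) (th3 a u) := by
  have h := hasSum_jacobiTheta₂_term (u / Real.pi) (τ := a * I) (by simpa using ha)
  refine h.congr_fun fun n => ?_
  rw [jacobiTheta₂_term]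
  congr 1
  field_simp [pi_ne_zero']
  ring_nf
  simp only [I_sq]
  ring

lemma hasSum_th2 {a : ℝ} (ha : 0 < a) (u : ℂ) :
    HasSum (fun n : ℤ => cexp (I * (2 * n + 1) * u - Real.pi * a * (n + 1 / 2) ^ 2))
      (th2 a u) := by
  have h := (hasSum_th3 ha (u + Real.pi * a / 2 * I)).mul_left
    (cexp (-(Real.pi * a / 4) + I * u))
  refine h.congr_fun fun n => ?_
  rw [← Complex.exp_add]
  congr 1
  ring_nf
  simp only [I_sq]
  ring

lemma th3_neg (a : ℝ) (u : ℂ) : th3 a (-u) = th3 a u := by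
  rw [th3, neg_div, jacobiTheta₂_neg_left, th3]

lemma th3_add_pi (a : ℝ) (u : ℂ) : th3 a (u + Real.pi) = th3 a u := by
  rw [th3, add_div, div_self pi_ne_zero', jacobiTheta₂_add_left, th3]

lemma th3_add_tau (a : ℝ) (u : ℂ) :
    th3 a (u + Real.pi * a * I) = cexp (Real.pi * a - 2 * I * u) * th3 a u := by
  rw [th3, add_div, show (Real.pi * a * I / Real.pi : ℂ) = a * I by field_simp [pi_ne_zero'],
    jacobiTheta₂_add_left', th3]
  congr 2
  field_simp [pi_ne_zero']
  ring_nf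
  simp only [I_sq]
  ring

lemma conj_th3 (a : ℝ) (u : ℂ) : (starRingEnd ℂ) (th3 a u) = th3 a ((starRingEnd ℂ) u) := by
  rw [th3, jacobiTheta₂_conj, th3]
  simp

lemma differentiable_th3 {a : ℝ} (ha : 0 < a) : Differentiable ℂ (th3 a) := fun u =>
  DifferentiableAt.comp (g := fun z => jacobiTheta₂ z (a * I)) (f := fun u : ℂ => u / Real.pi) u
    (differentiableAt_jacobiTheta₂_fst (u / Real.pi) (τ := a * I) (by simpa using ha))
    (by fun_prop)

lemma differentiable_th2 {a : ℝ} (ha : 0 < a) : Differentiable ℂ (th2 a) := by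
  have := differentiable_th3 ha
  unfold th2
  fun_prop

lemma differentiable_th1 {a : ℝ} (ha : 0 < a) : Differentiable ℂ (th1 a) := by
  have := differentiable_th2 ha
  unfold th1
  fun_prop

lemma differentiable_th4 {a : ℝ} (ha : 0 < a) : Differentiable ℂ (th4 a) := by
  have := differentiable_th3 ha
  unfold th4
  fun_prop

lemma th2_neg (a : ℝ) (u : ℂ) : th2 a (-u) = th2 a u := by
  have h := th3_add_tau a (-(u + Real.pi * a / 2 * I))
  rw [th3_neg, show -(u + Real.pi * a / 2 * I) + Real.pi * a * I = -u + Real.pi * a / 2 * I by ring]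
    at h
  rw [th2, h, th2, ← mul_assoc, ← Complex.exp_add]
  congr 2
  ring_nf
  simp only [I_sq]
  ring

lemma conj_th2 (a : ℝ) (u : ℂ) : (starRingEnd ℂ) (th2 a u) = th2 a ((starRingEnd ℂ) u) := by
  rw [← th2_neg a ((starRingEnd ℂ) u), th2, th2, map_mul, conj_th3, ← th3_neg, ← Complex.exp_conj]
  simp only [map_add, map_neg, map_mul, map_div₀, conj_ofReal, map_ofNat, conj_I]
  congr 2 <;> ring

lemma th2_add_pi (a : ℝ) (u : ℂ) : th2 a (u + Real.pi) = -th2 a u := by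
  rw [th2, show (u + Real.pi + Real.pi * a / 2 * I : ℂ) = u + Real.pi * a / 2 * I + Real.pi by ring,
    th3_add_pi, th2, show (-(Real.pi * a / 4) + I * (u + Real.pi) : ℂ) =
      -(Real.pi * a / 4) + I * u + Real.pi * I by ring, Complex.exp_add, Complex.exp_pi_mul_I]
  ring

lemma th2_add_tau (a : ℝ) (u : ℂ) :
    th2 a (u + Real.pi * a * I) = cexp (Real.pi * a - 2 * I * u) * th2 a u := by
  rw [th2, show (u + Real.pi * a * I + Real.pi * a / 2 * I : ℂ) =
    (u + Real.pi * a / 2 * I) + Real.pi * a * I by ring, th3_add_tau, th2, ← mul_assoc, ← mul_assoc,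
    ← Complex.exp_add, ← Complex.exp_add]
  congr 2
  ring

lemma th1_add_pi_div_two (a : ℝ) (u : ℂ) : th1 a (u + Real.pi / 2) = th2 a u := by
  rw [th1]; congr 1; ring

/-! ### Second-order theta functions and the addition theorems. -/

/-- The even second-order theta function `θ₃(2u, q²)`. -/
def thA (a : ℝ) (u : ℂ) : ℂ := th3 (2 * a) (2 * u)

/-- The odd second-order theta function `θ₂(2u, q²)`. -/
def thB (a : ℝ) (u : ℂ) : ℂ := th2 (2 * a) (2 * u)

/-- The lattice `ℤ²` is the disjoint union of the pairs with even sum and those with odd sum, each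
parametrized by rotated coordinates. -/
lemma HasSum.of_even_of_odd {f : ℤ × ℤ → ℂ} {s t : ℂ}
    (hs : HasSum (fun z : ℤ × ℤ => f (z.1 + z.2, z.1 - z.2)) s)
    (ht : HasSum (fun z : ℤ × ℤ => f (z.1 + z.2 + 1, z.1 - z.2)) t) : HasSum f (s + t) := by
  let gA : ℤ × ℤ → ℤ × ℤ := fun z => (z.1 + z.2, z.1 - z.2)
  let gB : ℤ × ℤ → ℤ × ℤ := fun z => (z.1 + z.2 + 1, z.1 - z.2)
  have iA : Function.Injective gA := by
    rintro ⟨a, b⟩ ⟨c, d⟩ h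
    simp only [gA, Prod.mk.injEq] at h ⊢
    omega
  have iB : Function.Injective gB := by
    rintro ⟨a, b⟩ ⟨c, d⟩ h
    simp only [gB, Prod.mk.injEq] at h ⊢
    omega
  have hc : IsCompl (Set.range gA) (Set.range gB) := by
    rw [isCompl_iff, Set.disjoint_left, codisjoint_iff]
    refine ⟨?_, Set.eq_univ_iff_forall.2 ?_⟩
    · rintro _ ⟨⟨a, b⟩, rfl⟩ ⟨⟨c, d⟩, h⟩
      simp only [gA, gB, Prod.mk.injEq] at h
      omega
    · rintro ⟨m, n⟩
      rcases Int.even_or_odd (m + n) with h | h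
      · left
        refine ⟨((m + n) / 2, (m - n) / 2), ?_⟩
        simp only [gA, Prod.mk.injEq]
        obtain ⟨k, hk⟩ := h
        omega
      · right
        refine ⟨((m + n) / 2, (m - n) / 2), ?_⟩
        simp only [gB, Prod.mk.injEq]
        obtain ⟨k, hk⟩ := h
        omega
  exact HasSum.add_isCompl hc (iA.hasSum_range_iff.2 hs) (iB.hasSum_range_iff.2 ht)

lemma HasSum.mul_prod {f g : ℤ → ℂ} {s t : ℂ} (hf : HasSum f s) (hg : HasSum g t) :
    HasSum (fun z : ℤ × ℤ => f z.1 * g z.2) (s * t) :=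
  hf.mul hg (summable_mul_of_summable_norm hf.summable.norm hg.summable.norm)

/-- In the double series put `(m, n) = (j+k, j-k)` or `(j+k+1, j-k)`. The form `m² + n²` becomes
`2(j² + k²)` or `2((j+1/2)² + (k+1/2)²)`, so the variables separate into series of nome `q²`. -/
lemma th3_mul_th3 {a : ℝ} (ha : 0 < a) (x y : ℂ) :
    th3 a (x + y) * th3 a (x - y) = thA a x * thA a y + thB a x * thB a y := by
  have h2a : 0 < 2 * a := by positivity
  have hp := HasSum.mul_prod (hasSum_th3 ha (x + y)) (hasSum_th3 ha (x - y))
  have hA := HasSum.mul_prod (hasSum_th3 h2a (2 * x)) (hasSum_th3 h2a (2 * y))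
  have hB := HasSum.mul_prod (hasSum_th2 h2a (2 * x)) (hasSum_th2 h2a (2 * y))
  refine hp.unique (HasSum.of_even_of_odd ?_ ?_)
  · refine hA.congr_fun fun z => ?_
    rw [← Complex.exp_add, ← Complex.exp_add]
    congr 1
    push_cast
    ring
  · refine hB.congr_fun fun z => ?_
    rw [← Complex.exp_add, ← Complex.exp_add]
    congr 1
    push_cast
    ring

lemma thA_neg (a : ℝ) (u : ℂ) : thA a (-u) = thA a u := by
  rw [thA, mul_neg, th3_neg, thA]

lemma thB_neg (a : ℝ) (u : ℂ) : thB a (-u) = thB a u := by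
  rw [thB, mul_neg, th2_neg, thB]

lemma thA_add_pi_div_two (a : ℝ) (u : ℂ) : thA a (u + Real.pi / 2) = thA a u := by
  rw [thA, show (2 * (u + Real.pi / 2) : ℂ) = 2 * u + Real.pi by ring, th3_add_pi, thA]

lemma thB_add_pi_div_two (a : ℝ) (u : ℂ) : thB a (u + Real.pi / 2) = -thB a u := by
  rw [thB, show (2 * (u + Real.pi / 2) : ℂ) = 2 * u + Real.pi by ring, th2_add_pi, thB]

lemma thA_add_tau (a : ℝ) (u : ℂ) :
    thA a (u + Real.pi * a / 2 * I) = cexp (Real.pi * a / 2 - 2 * I * u) * thB a u := by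
  rw [thB, th2, ← mul_assoc, ← Complex.exp_add, thA]
  push_cast
  rw [show (Real.pi * a / 2 - 2 * I * u + (-(Real.pi * (2 * a) / 4) + I * (2 * u)) : ℂ) = 0 by ring]
  rw [Complex.exp_zero, one_mul]
  congr 1
  ring

lemma thB_add_tau (a : ℝ) (u : ℂ) :
    thB a (u + Real.pi * a / 2 * I) = cexp (Real.pi * a / 2 - 2 * I * u) * thA a u := by
  have h := th3_add_tau (2 * a) (2 * u)
  rw [thB, th2, thA]
  rw [show (2 * (u + Real.pi * a / 2 * I) + Real.pi * (2 * a : ℝ) / 2 * I : ℂ) =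
    2 * u + Real.pi * (2 * a : ℝ) * I by push_cast; ring, h, ← mul_assoc, ← Complex.exp_add]
  congr 2
  push_cast
  ring_nf
  simp only [I_sq]
  ring

lemma conj_thA (a : ℝ) (u : ℂ) : (starRingEnd ℂ) (thA a u) = thA a ((starRingEnd ℂ) u) := by
  rw [thA, conj_th3, thA, map_mul, map_ofNat]

lemma conj_thB (a : ℝ) (u : ℂ) : (starRingEnd ℂ) (thB a u) = thB a ((starRingEnd ℂ) u) := by
  rw [thB, conj_th2, thB, map_mul, map_ofNat]

lemma differentiable_thA {a : ℝ} (ha : 0 < a) : Differentiable ℂ (thA a) := by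
  have := differentiable_th3 (a := 2 * a) (by positivity)
  unfold thA
  fun_prop

lemma differentiable_thB {a : ℝ} (ha : 0 < a) : Differentiable ℂ (thB a) := by
  have := differentiable_th2 (a := 2 * a) (by positivity)
  unfold thB
  fun_prop

/-- This addition theorem and the two after it follow from the one for `th3` by half-period shifts:
`π/2` changes the sign of `thB`, and `iπa/2` exchanges `thA` and `thB` up to a common exponential.
-/
lemma th4_mul_th4 {a : ℝ} (ha : 0 < a) (x y : ℂ) :
    th4 a (x + y) * th4 a (x - y) = thA a x * thA a y - thB a x * thB a y := by
  have h := th3_mul_th3 ha (x + Real.pi / 2) y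
  rw [thA_add_pi_div_two, thB_add_pi_div_two] at h
  rw [th4, th4, show x + y + Real.pi / 2 = x + Real.pi / 2 + y by ring,
    show x - y + Real.pi / 2 = x + Real.pi / 2 - y by ring, h]
  ring

lemma th2_mul_th2 {a : ℝ} (ha : 0 < a) (x y : ℂ) :
    th2 a (x + y) * th2 a (x - y) = thB a x * thA a y + thA a x * thB a y := by
  have h := th3_mul_th3 ha (x + Real.pi * a / 2 * I) y
  rw [thA_add_tau, thB_add_tau] at h
  rw [th2, th2, show x + y + Real.pi * a / 2 * I = x + Real.pi * a / 2 * I + y by ring,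
    show x - y + Real.pi * a / 2 * I = x + Real.pi * a / 2 * I - y by ring, mul_mul_mul_comm, h,
    ← Complex.exp_add]
  rw [show (-(Real.pi * a / 4) + I * (x + y) + (-(Real.pi * a / 4) + I * (x - y)) : ℂ) =
    -(Real.pi * a / 2 - 2 * I * x) by ring, Complex.exp_neg]
  field_simp [Complex.exp_ne_zero]

lemma th1_mul_th1 {a : ℝ} (ha : 0 < a) (x y : ℂ) :
    th1 a (x + y) * th1 a (x - y) = thA a x * thB a y - thB a x * thA a y := by
  have h := th2_mul_th2 ha (x - Real.pi / 2) y
  have hA := thA_add_pi_div_two a (x - Real.pi / 2)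
  have hB := thB_add_pi_div_two a (x - Real.pi / 2)
  rw [sub_add_cancel] at hA hB
  rw [← hA, show thB a (x - Real.pi / 2) = -thB a x by rw [hB, neg_neg]] at h
  rw [th1, th1, show x + y - Real.pi / 2 = x - Real.pi / 2 + y by ring,
    show x - y - Real.pi / 2 = x - Real.pi / 2 - y by ring, h]
  ring

/-! ### Product expansions, zeros and signs, and the duplication formula. -/

/-- The nome `exp (-π a)`. -/
def nome (a : ℝ) : ℝ := Real.exp (-(Real.pi * a))

lemma nome_pos (a : ℝ) : 0 < nome a := Real.exp_pos _

lemma nome_lt_one {a : ℝ} (ha : 0 < a) : nome a < 1 := by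
  rw [nome, Real.exp_lt_one_iff]
  have := Real.pi_pos
  nlinarith [mul_pos this ha]

lemma nome_sq_pos (a : ℝ) : 0 < nome a ^ 2 := pow_pos (nome_pos a) 2

lemma nome_sq_lt_one {a : ℝ} (ha : 0 < a) : nome a ^ 2 < 1 :=
  pow_lt_one₀ (nome_pos a).le (nome_lt_one ha) two_ne_zero

lemma ofReal_nome (a : ℝ) : (nome a : ℂ) = cexp (-(Real.pi * a)) := by
  rw [nome]; push_cast; rfl

/-- The factor `(X y; q²)_∞ (X / y; q²)_∞` with `y = exp (2iu)`. -/
def thProd (a : ℝ) (X u : ℂ) : ℂ :=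
  qPoch (nome a ^ 2) (X * cexp (2 * I * u)) * qPoch (nome a ^ 2) (X * (cexp (2 * I * u))⁻¹)

lemma th3_eq_prod {a : ℝ} (ha : 0 < a) (u : ℂ) :
    th3 a u = eulerLim (nome a ^ 2) * thProd a (-nome a) u := by
  have h := hasSum_th3 ha u
  have e : ∀ n : ℤ, cexp (2 * I * n * u - Real.pi * a * n ^ 2) =
      (nome a : ℂ) ^ (n ^ 2) * cexp (2 * I * u) ^ n := fun n => by
    rw [ofReal_nome, ← Complex.exp_int_mul, ← Complex.exp_int_mul, ← Complex.exp_add]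
    congr 1
    push_cast
    ring
  simp_rw [e] at h
  rw [← h.tsum_eq, tripleProduct (nome_pos a) (nome_lt_one ha) (Complex.exp_ne_zero _) h.summable,
    thProd]

lemma th4_eq_prod {a : ℝ} (ha : 0 < a) (u : ℂ) :
    th4 a u = eulerLim (nome a ^ 2) * thProd a (nome a) u := by
  rw [th4, th3_eq_prod ha, thProd, thProd,
    show 2 * I * (u + Real.pi / 2) = 2 * I * u + Real.pi * I by ring, Complex.exp_add,
    Complex.exp_pi_mul_I]
  congr 3
  · ring
  · rw [mul_neg_one, inv_neg]; ring

lemma th2_eq_prod {a : ℝ} (ha : 0 < a) (u : ℂ) :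
    th2 a u = 2 * cexp (-(Real.pi * a / 4)) * cos u *
      (eulerLim (nome a ^ 2) * thProd a (-nome a ^ 2) u) := by
  have hq : (nome a : ℂ) ≠ 0 := by exact_mod_cast (nome_pos a).ne'
  rw [th2, th3_eq_prod ha, thProd,
    show 2 * I * (u + Real.pi * a / 2 * I) = -(Real.pi * a) + 2 * I * u by
      linear_combination (Real.pi * a) * I_sq,
    Complex.exp_add _ (2 * I * u), ← ofReal_nome]
  have e1 : -(nome a : ℂ) * ((nome a : ℂ) * cexp (2 * I * u))⁻¹ = -(cexp (2 * I * u))⁻¹ := by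
    have := Complex.exp_ne_zero (2 * I * u)
    field_simp
  have e2 : -(nome a : ℂ) * ((nome a : ℂ) * cexp (2 * I * u)) =
      -(nome a : ℂ) ^ 2 * cexp (2 * I * u) := by ring
  rw [e1, e2, qPoch_eq_mul (nome_sq_pos a) (nome_sq_lt_one ha) (-(cexp (2 * I * u))⁻¹), thProd]
  have e3 : 2 * cos u = cexp (I * u) * (1 + (cexp (2 * I * u))⁻¹) := by
    rw [← Complex.exp_neg, mul_add, mul_one, ← Complex.exp_add, Complex.cos]
    ring_nf
  have e4 : ((nome a ^ 2 : ℝ) : ℂ) * -(cexp (2 * I * u))⁻¹ =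
      -(nome a : ℂ) ^ 2 * (cexp (2 * I * u))⁻¹ := by push_cast; ring
  rw [e4, Complex.exp_add, sub_neg_eq_add,
    show ∀ A B C : ℂ, 2 * A * B * C = A * (2 * B) * C from fun A B C => by ring, e3]
  ring

lemma th1_eq_prod {a : ℝ} (ha : 0 < a) (u : ℂ) :
    th1 a u = 2 * cexp (-(Real.pi * a / 4)) * sin u *
      (eulerLim (nome a ^ 2) * thProd a (nome a ^ 2) u) := by
  rw [th1, th2_eq_prod ha, Complex.cos_sub_pi_div_two]
  congr 2
  rw [thProd, thProd, show 2 * I * (u - Real.pi / 2) = 2 * I * u - Real.pi * I by ring,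
    Complex.exp_sub, Complex.exp_pi_mul_I]
  congr 2
  · ring
  · rw [div_neg, div_one, inv_neg]; ring

lemma eulerLim_nome_ne_zero {a : ℝ} (ha : 0 < a) : (eulerLim (nome a ^ 2) : ℂ) ≠ 0 := by
  exact_mod_cast (eulerLim_pos (nome_sq_pos a) (nome_sq_lt_one ha)).ne'

lemma norm_exp_two_I_mul (u : ℂ) : ‖cexp (2 * I * u)‖ = Real.exp (-(2 * u.im)) := by
  rw [Complex.norm_exp]
  congr 1
  simp

lemma thProd_ne_zero {a : ℝ} (ha : 0 < a) {X u : ℂ} (h1 : ‖X‖ < Real.exp (2 * u.im))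
    (h2 : ‖X‖ < Real.exp (-(2 * u.im))) : thProd a X u ≠ 0 := by
  refine mul_ne_zero (qPoch_ne_zero_of_norm_lt (nome_sq_pos a) (nome_sq_lt_one ha) ?_)
    (qPoch_ne_zero_of_norm_lt (nome_sq_pos a) (nome_sq_lt_one ha) ?_)
  · rw [norm_mul, norm_exp_two_I_mul, Real.exp_neg, ← div_eq_mul_inv, div_lt_one (Real.exp_pos _)]
    exact h1
  · rw [norm_mul, norm_inv, norm_exp_two_I_mul, ← div_eq_mul_inv, div_lt_one (Real.exp_pos _)]
    exact h2

lemma norm_nome (a : ℝ) : ‖(nome a : ℂ)‖ = Real.exp (-(Real.pi * a)) := by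
  rw [Complex.norm_real, Real.norm_eq_abs, abs_of_pos (nome_pos a), nome]

lemma norm_nome_sq (a : ℝ) : ‖(nome a : ℂ) ^ 2‖ = Real.exp (-(2 * (Real.pi * a))) := by
  rw [norm_pow, norm_nome, ← Real.exp_nat_mul]
  congr 1
  push_cast
  ring

lemma th1_ne_zero {a : ℝ} (ha : 0 < a) {u : ℂ} (hu : |u.im| < Real.pi * a) (hs : sin u ≠ 0) :
    th1 a u ≠ 0 := by
  obtain ⟨h1, h2⟩ := abs_lt.1 hu
  rw [th1_eq_prod ha]
  refine mul_ne_zero (mul_ne_zero (mul_ne_zero two_ne_zero (Complex.exp_ne_zero _)) hs)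
    (mul_ne_zero (eulerLim_nome_ne_zero ha) (thProd_ne_zero ha ?_ ?_)) <;>
  · rw [norm_nome_sq, Real.exp_lt_exp]; linarith

lemma conj_exp_two_I_mul (x : ℝ) : (cexp (2 * I * x))⁻¹ = (starRingEnd ℂ) (cexp (2 * I * x)) := by
  rw [← Complex.exp_neg, ← Complex.exp_conj]
  congr 1
  simp only [map_mul, map_ofNat, conj_I, conj_ofReal]
  ring

/-- For real `x` the two infinite products are complex conjugates, so their product is a squared
modulus, and it does not vanish. -/
lemma exists_thProd_eq {a : ℝ} (ha : 0 < a) {X : ℝ} (hX : |X| < 1) (x : ℝ) :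
    ∃ c : ℝ, 0 < c ∧ (eulerLim (nome a ^ 2) : ℂ) * thProd a X x = c := by
  have hE := eulerLim_pos (nome_sq_pos a) (nome_sq_lt_one ha)
  have e : (starRingEnd ℂ) (qPoch (nome a ^ 2) (X * cexp (2 * I * x))) =
      qPoch (nome a ^ 2) (X * (cexp (2 * I * x))⁻¹) := by
    rw [conj_qPoch (nome_sq_pos a) (nome_sq_lt_one ha), map_mul, conj_ofReal, conj_exp_two_I_mul]
  refine ⟨eulerLim (nome a ^ 2) * normSq (qPoch (nome a ^ 2) (X * cexp (2 * I * x))), ?_, ?_⟩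
  · refine mul_pos hE (normSq_pos.2 ?_)
    refine qPoch_ne_zero_of_norm_lt (nome_sq_pos a) (nome_sq_lt_one ha) ?_
    rw [norm_mul, norm_exp_two_I_mul, Complex.norm_real]
    simpa using hX
  · rw [thProd, ← e, Complex.mul_conj]
    push_cast
    rfl

lemma exists_th1_eq {a : ℝ} (ha : 0 < a) (x : ℝ) :
    ∃ c : ℝ, 0 < c ∧ th1 a x = (c * Real.sin x : ℝ) := by
  obtain ⟨c, hc, h⟩ := exists_thProd_eq ha (X := nome a ^ 2)
    (by rw [abs_of_pos (nome_sq_pos a)]; exact nome_sq_lt_one ha) x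
  refine ⟨2 * Real.exp (-(Real.pi * a / 4)) * c, by positivity, ?_⟩
  push_cast at h ⊢
  rw [th1_eq_prod ha, h]
  ring

lemma exists_th2_eq {a : ℝ} (ha : 0 < a) (x : ℝ) :
    ∃ c : ℝ, 0 < c ∧ th2 a x = (c * Real.cos x : ℝ) := by
  obtain ⟨c, hc, h⟩ := exists_thProd_eq ha (X := -nome a ^ 2)
    (by rw [abs_neg, abs_of_pos (nome_sq_pos a)]; exact nome_sq_lt_one ha) x
  refine ⟨2 * Real.exp (-(Real.pi * a / 4)) * c, by positivity, ?_⟩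
  push_cast at h ⊢
  rw [th2_eq_prod ha, h]
  ring

lemma exists_th3_eq {a : ℝ} (ha : 0 < a) (x : ℝ) : ∃ c : ℝ, 0 < c ∧ th3 a x = c := by
  obtain ⟨c, hc, h⟩ := exists_thProd_eq ha (X := -nome a)
    (by rw [abs_neg, abs_of_pos (nome_pos a)]; exact nome_lt_one ha) x
  refine ⟨c, hc, ?_⟩
  rw [th3_eq_prod ha, ← h]
  push_cast
  rfl

lemma exists_th4_eq {a : ℝ} (ha : 0 < a) (x : ℝ) : ∃ c : ℝ, 0 < c ∧ th4 a x = c := by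
  obtain ⟨c, hc, h⟩ := exists_th3_eq ha (x + Real.pi / 2)
  refine ⟨c, hc, ?_⟩
  rw [th4, ← h]
  push_cast
  rfl

lemma qPoch_mul_qPoch_neg {p : ℝ} (h0 : 0 < p) (h1 : p < 1) (X : ℂ) :
    qPoch p X * qPoch p (-X) = qPoch (p ^ 2) (X ^ 2) := by
  have h := (hasProd_qPoch h0 h1 X).mul (hasProd_qPoch h0 h1 (-X))
  refine h.unique ?_
  have h2 := hasProd_qPoch (pow_pos h0 2) (pow_lt_one₀ h0.le h1 two_ne_zero) (X ^ 2)
  convert h2 using 2 with n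
  push_cast
  ring

lemma qPoch_eq_even_mul_odd {p : ℝ} (h0 : 0 < p) (h1 : p < 1) (X : ℂ) :
    qPoch p X = qPoch (p ^ 2) X * qPoch (p ^ 2) (p * X) := by
  refine (hasProd_qPoch h0 h1 X).unique (HasProd.even_mul_odd ?_ ?_)
  · convert hasProd_qPoch (pow_pos h0 2) (pow_lt_one₀ h0.le h1 two_ne_zero) X using 3 with n
    push_cast
    ring
  · convert hasProd_qPoch (pow_pos h0 2) (pow_lt_one₀ h0.le h1 two_ne_zero) (p * X) using 3 with n
    push_cast
    ring

/-- Separating even and odd factors gives `(q²y²; q²) = (q²y²; q⁴) (q⁴y²; q⁴)`, and each half is a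
product of differences of squares: `(qy; q²)(-qy; q²)` and `(q²y; q²)(-q²y; q²)`. -/
lemma thProd_duplication {a : ℝ} (ha : 0 < a) (u : ℂ) :
    thProd a (nome a ^ 2) (2 * u) = thProd a (nome a ^ 2) u * thProd a (-nome a ^ 2) u *
      thProd a (-nome a) u * thProd a (nome a) u := by
  have key : ∀ y : ℂ, qPoch (nome a ^ 2) ((nome a : ℂ) ^ 2 * y ^ 2) =
      qPoch (nome a ^ 2) ((nome a : ℂ) ^ 2 * y) * qPoch (nome a ^ 2) (-(nome a : ℂ) ^ 2 * y) *
      qPoch (nome a ^ 2) (-(nome a : ℂ) * y) * qPoch (nome a ^ 2) ((nome a : ℂ) * y) := fun y => by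
    have h1 := qPoch_mul_qPoch_neg (nome_sq_pos a) (nome_sq_lt_one ha) ((nome a : ℂ) ^ 2 * y)
    have h2 := qPoch_mul_qPoch_neg (nome_sq_pos a) (nome_sq_lt_one ha) ((nome a : ℂ) * y)
    rw [← neg_mul] at h1 h2
    rw [h1, mul_assoc, mul_comm (qPoch _ (-(nome a : ℂ) * y)), h2,
      qPoch_eq_even_mul_odd (nome_sq_pos a) (nome_sq_lt_one ha), mul_comm]
    congr 2
    · push_cast; ring
    · ring
  have k1 := key (cexp (2 * I * u))
  have k2 := key (cexp (2 * I * u))⁻¹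
  rw [thProd, thProd, thProd, thProd, thProd]
  rw [show 2 * I * (2 * u) = 2 * I * u + 2 * I * u by ring, Complex.exp_add, ← sq, ← inv_pow, k1, k2]
  ring

/-- The derivative is the limit of the product formula divided by `u`; its value is the constant
missing in the duplication formula. -/
lemma deriv_th1_zero {a : ℝ} (ha : 0 < a) :
    deriv (th1 a) 0 = 2 * cexp (-(Real.pi * a / 4)) * (eulerLim (nome a ^ 2)) ^ 3 := by
  have hd := (differentiable_th1 ha 0).hasDerivAt
  have hs := Complex.hasDerivAt_sin 0
  have hc : Continuous (thProd a (nome a ^ 2)) := by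
    have := continuous_qPoch (nome_sq_pos a) (nome_sq_lt_one ha)
    unfold thProd
    simp_rw [← Complex.exp_neg]
    fun_prop
  rw [hasDerivAt_iff_tendsto_slope] at hd hs
  have t2 : Tendsto (thProd a (nome a ^ 2)) (𝓝[≠] 0) (𝓝 (thProd a (nome a ^ 2) 0)) :=
    (hc.tendsto 0).mono_left nhdsWithin_le_nhds
  have t := ((hs.mul t2).const_mul (2 * cexp (-(Real.pi * a / 4)) * eulerLim (nome a ^ 2)))
  refine tendsto_nhds_unique hd ?_
  have e : thProd a (nome a ^ 2) 0 = (eulerLim (nome a ^ 2)) ^ 2 := by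
    rw [ofReal_eulerLim (nome_sq_pos a) (nome_sq_lt_one ha), thProd]
    simp [sq]
  rw [e, Complex.cos_zero, one_mul] at t
  convert t using 2
  · simp only [slope, vsub_eq_sub, sub_zero, Complex.sin_zero, smul_eq_mul]
    rw [th1_eq_prod ha, th1_eq_prod ha, Complex.sin_zero]
    ring
  · ring

/-- The duplication formula for `θ₁`. -/
lemma th1_two_mul {a : ℝ} (ha : 0 < a) (u : ℂ) :
    th1 a (2 * u) * deriv (th1 a) 0 = 2 * th1 a u * th2 a u * th3 a u * th4 a u := by
  rw [deriv_th1_zero ha, th1_eq_prod ha, thProd_duplication ha, th1_eq_prod ha u, th2_eq_prod ha,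
    th3_eq_prod ha, th4_eq_prod ha, Complex.sin_two_mul]
  ring

/-! ### Identification with the real theta functions and transfer of derivatives. -/

lemma ofReal_theta3 {a : ℝ} (ha : 0 < a) (x : ℝ) : (theta3 (nome a) x : ℂ) = th3 a x := by
  have h := (hasSum_th3 ha x).nat_add_neg
  have h2 := (hasSum_nat_add_iff' 1).2 h
  have e : ∀ n : ℕ, cexp (2 * I * ((n + 1 : ℕ) : ℤ) * x - Real.pi * a * ((n + 1 : ℕ) : ℤ) ^ 2) +
      cexp (2 * I * (-((n + 1 : ℕ) : ℤ) : ℤ) * x - Real.pi * a * (-((n + 1 : ℕ) : ℤ) : ℤ) ^ 2) =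
      2 * ((nome a ^ ((n + 1) ^ 2) * Real.cos (2 * ((n : ℝ) + 1) * x) : ℝ) : ℂ) := fun n => by
    push_cast
    rw [ofReal_nome, ← Complex.exp_nat_mul, Complex.cos,
      show ∀ A B C : ℂ, 2 * (A * ((B + C) / 2)) = A * B + A * C from fun A B C => by ring,
      ← Complex.exp_add, ← Complex.exp_add]
    push_cast
    congr 2 <;> ring
  simp_rw [e] at h2
  have h3 := h2.tsum_eq
  rw [tsum_mul_left, ← Complex.ofReal_tsum] at h3
  rw [theta3, ofReal_add, ofReal_mul, ofReal_ofNat, h3]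
  simp

lemma ofReal_theta4 {a : ℝ} (ha : 0 < a) (x : ℝ) : (theta4 (nome a) x : ℂ) = th4 a x := by
  have h := ofReal_theta3 ha (x + Real.pi / 2)
  rw [th4, show (x + Real.pi / 2 : ℂ) = ((x + Real.pi / 2 : ℝ) : ℂ) by push_cast; rfl, ← h,
    theta4, theta3]
  congr 4
  funext n
  rw [show 2 * ((n : ℝ) + 1) * (x + Real.pi / 2) = 2 * ((n : ℝ) + 1) * x + (n + 1 : ℕ) * Real.pi by
    push_cast; ring, Real.cos_add_nat_mul_pi]
  ring

lemma ofReal_theta2 {a : ℝ} (ha : 0 < a) (x : ℝ) : (theta2 (nome a) x : ℂ) = th2 a x := by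
  have h := (hasSum_th2 ha x).nat_add_neg_add_one
  have e : ∀ n : ℕ, cexp (I * (2 * (n : ℤ) + 1) * x - Real.pi * a * ((n : ℤ) + 1 / 2) ^ 2) +
      cexp (I * (2 * (-((n : ℤ) + 1) : ℤ) + 1) * x -
        Real.pi * a * ((-((n : ℤ) + 1) : ℤ) + 1 / 2) ^ 2) =
      2 * ((nome a ^ (((n : ℝ) + 1 / 2) ^ 2) * Real.cos ((2 * (n : ℝ) + 1) * x) : ℝ) : ℂ) :=
    fun n => by
    rw [nome, ← Real.exp_mul]
    push_cast
    rw [Complex.cos,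
      show ∀ A B C : ℂ, 2 * (A * ((B + C) / 2)) = A * B + A * C from fun A B C => by ring,
      ← Complex.exp_add, ← Complex.exp_add]
    congr 2 <;> ring
  simp_rw [e] at h
  have h3 := h.tsum_eq
  rw [tsum_mul_left, ← Complex.ofReal_tsum] at h3
  rw [theta2, ofReal_mul, ofReal_ofNat, h3]

lemma theta1_add_pi_div_two (q x : ℝ) : theta1 q (x + Real.pi / 2) = theta2 q x := by
  rw [theta1, theta2]
  congr 2
  funext n
  rw [show (2 * (n : ℝ) + 1) * (x + Real.pi / 2) =
    ((2 * (n : ℝ) + 1) * x + n * Real.pi) + Real.pi / 2 by ring, Real.sin_add_pi_div_two,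
    Real.cos_add_nat_mul_pi]
  have : ((-1 : ℝ) ^ n) * (-1) ^ n = 1 := by rw [← mul_pow]; simp
  linear_combination q ^ (((n : ℝ) + 1 / 2) ^ 2) * Real.cos ((2 * (n : ℝ) + 1) * x) * this

lemma ofReal_theta1 {a : ℝ} (ha : 0 < a) (x : ℝ) : (theta1 (nome a) x : ℂ) = th1 a x := by
  have h := theta1_add_pi_div_two (nome a) (x - Real.pi / 2)
  rw [sub_add_cancel] at h
  rw [h, ofReal_theta2 ha, th1]
  push_cast
  rfl

lemma hasDerivAt_of_ofReal_eq {f : ℝ → ℝ} {g : ℂ → ℂ} (hg : Differentiable ℂ g)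
    (h : ∀ x : ℝ, (f x : ℂ) = g x) (x : ℝ) :
    HasDerivAt f (deriv f x) x ∧ ((deriv f x : ℝ) : ℂ) = deriv g x := by
  have h1 : HasDerivAt (fun y : ℝ => (f y : ℂ)) (deriv g x) x := by
    simp_rw [h]
    exact (hg x).hasDerivAt.comp_ofReal
  have h2 : HasDerivAt f (deriv g x).re x := by
    have := (hg x).hasDerivAt.real_of_complex
    simp_rw [← h, ofReal_re] at this
    exact this
  rw [h2.deriv]
  exact ⟨h2, h2.ofReal_comp.unique h1⟩

lemma deriv_sq_of_mul {f g₁ g₂ : ℂ → ℂ} (hf : Differentiable ℂ f) (h1 : Differentiable ℂ g₁)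
    (h2 : Differentiable ℂ g₂) {c₁ c₂ : ℂ} (h : ∀ x, f x ^ 2 = g₁ x * c₁ + g₂ x * c₂) (x : ℂ) :
    2 * f x * deriv f x = deriv g₁ x * c₁ + deriv g₂ x * c₂ := by
  have e1 := (hf x).hasDerivAt.pow 2
  have e2 := ((h1 x).hasDerivAt.mul_const c₁).add ((h2 x).hasDerivAt.mul_const c₂)
  have e3 : (f ^ 2) = (fun x => g₁ x * c₁) + fun x => g₂ x * c₂ := by
    funext x; exact h x
  rw [e3] at e1
  have := e1.unique e2
  simpa using this

/-! ### The uniformizing map, its Wronskian and its symmetries. -/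

section map

variable (a w : ℝ)

/-- Denominator of the uniformizing map. -/
def mapDen (b c : ℂ) : ℂ := thA a w * c - thB a w * b

/-- Numerator of the uniformizing map. -/
def mapNum (b c : ℂ) : ℂ := deriv (thA a) w * c - deriv (thB a) w * b

/-- The uniformizing map in homogeneous coordinates. -/
def mapHom (b c : ℂ) : ℂ := -(Real.pi / 2) * (mapNum a w b c / mapDen a w b c)

/-- The uniformizing map: it sends the rectangle with corners `0`, `π/2`, `π/2 + iπa/2`, `iπa/2`
onto a half-plane. -/
def confMap (u : ℂ) : ℂ := mapHom a w (thA a u) (thB a u)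

/-- The (negative) Wronskian of the second order theta functions. -/
def mapWronsk : ℂ := 2 * th1 a w * th2 a w * th3 a w * th4 a w

end map

lemma mapHom_mul (a w : ℝ) {k : ℂ} (hk : k ≠ 0) (b c : ℂ) :
    mapHom a w (k * b) (k * c) = mapHom a w b c := by
  rw [mapHom, mapHom, mapNum, mapDen, mapNum, mapDen,
    show deriv (thA a) w * (k * c) - deriv (thB a) w * (k * b) =
      k * (deriv (thA a) w * c - deriv (thB a) w * b) by ring,
    show thA a w * (k * c) - thB a w * (k * b) = k * (thA a w * c - thB a w * b) by ring,
    mul_div_mul_left _ _ hk]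

lemma mapHom_neg (a w : ℝ) (b c : ℂ) : mapHom a w (-b) (-c) = mapHom a w b c := by
  simpa using mapHom_mul a w (neg_ne_zero.2 one_ne_zero) b c

/-- Differentiating `θ₁(w+y) θ₁(w-y) = A(w)B(y) - B(w)A(y)` in `y` at `y = w` leaves only `-θ₁(2w)
θ₁'(0)`, which the duplication formula turns into the product of the four thetas. -/
lemma wronskian_eq {a : ℝ} (ha : 0 < a) (w : ℝ) :
    thA a w * deriv (thB a) w - thB a w * deriv (thA a) w = -mapWronsk a w := by
  have e1 : HasDerivAt (fun y : ℂ => th1 a (w + y) * th1 a (w - y))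
      (deriv (th1 a) (w + w) * th1 a (w - w) + th1 a (w + w) * (-deriv (th1 a) (w - w))) w := by
    refine HasDerivAt.mul ?_ ?_
    · have := (differentiable_th1 ha (w + w)).hasDerivAt
      exact this.comp_const_add (w : ℂ) (w : ℂ)
    · have := (differentiable_th1 ha (w - w)).hasDerivAt
      exact this.comp_const_sub (w : ℂ) (w : ℂ)
  simp_rw [th1_mul_th1 ha] at e1
  have e2 := (((differentiable_thB ha w).hasDerivAt.const_mul (thA a w)).sub
    ((differentiable_thA ha w).hasDerivAt.const_mul (thB a w)))
  have e3 := e2.unique e1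
  have h0 : th1 a 0 = 0 := by rw [th1_eq_prod ha]; simp
  rw [e3, sub_self, h0, ← two_mul, mapWronsk, ← th1_two_mul ha]
  ring

/-- The map is a Möbius transformation of the ratio `b : c` whose determinant is the Wronskian. The
differences of the end-points, the injectivity on the edges and the logarithmic identity for the
field all come from this formula. -/
lemma mapHom_sub {a : ℝ} (ha : 0 < a) (w : ℝ) {b c b' c' : ℂ} (h : mapDen a w b c ≠ 0)
    (h' : mapDen a w b' c' ≠ 0) : mapHom a w b c - mapHom a w b' c' =
      -(Real.pi / 2) * mapWronsk a w * (b * c' - c * b') /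
        (mapDen a w b c * mapDen a w b' c') := by
  have := wronskian_eq ha w
  rw [← neg_eq_iff_eq_neg] at this
  rw [mapHom, mapHom, ← this]
  field_simp
  rw [mapNum, mapNum, mapDen, mapDen]
  ring

/-- Since `mapNum` is the `w`-derivative of `mapDen`, this shows that `confMap` is `-(π/2)` times
the `w`-derivative of `log (θ₁(w+u) θ₁(w-u))`, with poles at `±w`. -/
lemma mapDen_confMap {a : ℝ} (ha : 0 < a) (w : ℝ) (u : ℂ) :
    mapDen a w (thA a u) (thB a u) = th1 a (w + u) * th1 a (w - u) := by
  rw [th1_mul_th1 ha, mapDen]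

lemma confMap_neg (a w : ℝ) (u : ℂ) : confMap a w (-u) = confMap a w u := by
  rw [confMap, thA_neg, thB_neg, confMap]

lemma confMap_add_pi (a w : ℝ) (u : ℂ) : confMap a w (u + Real.pi) = confMap a w u := by
  rw [show u + Real.pi = u + Real.pi / 2 + Real.pi / 2 by ring, confMap, thA_add_pi_div_two,
    thB_add_pi_div_two, thA_add_pi_div_two, thB_add_pi_div_two, neg_neg, confMap]

/-- The shift by `iπa/2` exchanges `thA` and `thB`; the exponential factor is invisible in
homogeneous coordinates. -/
lemma confMap_add_tau (a w : ℝ) (u : ℂ) :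
    confMap a w (u + Real.pi * a / 2 * I) = mapHom a w (thB a u) (thA a u) := by
  rw [confMap, thA_add_tau, thB_add_tau, mapHom_mul _ _ (Complex.exp_ne_zero _)]

lemma confMap_add_two_tau (a w : ℝ) (u : ℂ) :
    confMap a w (u + Real.pi * a * I) = confMap a w u := by
  rw [show u + Real.pi * a * I = u + Real.pi * a / 2 * I + Real.pi * a / 2 * I by ring,
    confMap_add_tau, thA_add_tau, thB_add_tau, mapHom_mul _ _ (Complex.exp_ne_zero _), confMap]

lemma conj_deriv_of_conj {f : ℂ → ℂ} (hf : ∀ u, (starRingEnd ℂ) (f u) = f ((starRingEnd ℂ) u))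
    (w : ℝ) : (starRingEnd ℂ) (deriv f w) = deriv f w := by
  have h : (starRingEnd ℂ) ∘ f ∘ (starRingEnd ℂ) = f := by
    funext u
    simp [hf]
  have := congrFun (deriv_conj_conj (f := f)) w
  rw [h] at this
  simp only [Function.comp, conj_ofReal] at this
  exact this.symm

lemma conj_confMap (a w : ℝ) (u : ℂ) :
    (starRingEnd ℂ) (confMap a w u) = confMap a w ((starRingEnd ℂ) u) := by
  have hA := conj_deriv_of_conj (conj_thA a) w
  have hB := conj_deriv_of_conj (conj_thB a) w
  simp only [confMap, mapHom, mapNum, mapDen, map_mul, map_neg, map_div₀, map_sub, hA, hB,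
    conj_thA, conj_thB, conj_ofReal, map_ofNat]

lemma confMap_real_of_conj {a w : ℝ} {u : ℂ} (h : confMap a w ((starRingEnd ℂ) u) = confMap a w u) :
    ((confMap a w u).re : ℂ) = confMap a w u := by
  rw [← conj_confMap] at h
  exact Complex.conj_eq_iff_re.1 h

lemma th1_sq {a : ℝ} (ha : 0 < a) (x : ℂ) :
    th1 a x ^ 2 = thA a x * thB a 0 + thB a x * (-thA a 0) := by
  have := th1_mul_th1 ha x 0
  rw [add_zero, sub_zero] at this
  rw [sq, this]; ring

lemma th2_sq {a : ℝ} (ha : 0 < a) (x : ℂ) :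
    th2 a x ^ 2 = thA a x * thB a 0 + thB a x * thA a 0 := by
  have := th2_mul_th2 ha x 0
  rw [add_zero, sub_zero] at this
  rw [sq, this]; ring

lemma th3_sq {a : ℝ} (ha : 0 < a) (x : ℂ) :
    th3 a x ^ 2 = thA a x * thA a 0 + thB a x * thB a 0 := by
  have := th3_mul_th3 ha x 0
  rw [add_zero, sub_zero] at this
  rw [sq, this]

lemma th4_sq {a : ℝ} (ha : 0 < a) (x : ℂ) :
    th4 a x ^ 2 = thA a x * thA a 0 + thB a x * (-thB a 0) := by
  have := th4_mul_th4 ha x 0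
  rw [add_zero, sub_zero] at this
  rw [sq, this]; ring

lemma sin_ne_zero_of_im {u : ℂ} (h : u.im ≠ 0) : sin u ≠ 0 := by
  rw [Ne, Complex.sin_eq_zero_iff]
  rintro ⟨k, rfl⟩
  simp at h

lemma sin_ne_zero_of_re {u : ℂ} (h0 : 0 < u.re) (h1 : u.re < Real.pi) : sin u ≠ 0 := by
  rw [Ne, Complex.sin_eq_zero_iff]
  rintro ⟨k, rfl⟩
  simp at h0 h1
  have hp := Real.pi_pos
  have k0 : (0 : ℝ) < k := by nlinarith
  have k1 : (k : ℝ) < 1 := by nlinarith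
  norm_cast at k0 k1
  omega

lemma th1_ne_zero_of_re {a : ℝ} (ha : 0 < a) {u : ℂ} (hu : |u.im| < Real.pi * a)
    (h0 : 0 < u.re) (h1 : u.re < Real.pi) : th1 a u ≠ 0 :=
  th1_ne_zero ha hu (sin_ne_zero_of_re h0 h1)

lemma th2_ne_zero_of_re {a : ℝ} (ha : 0 < a) {u : ℂ} (hu : |u.im| < Real.pi * a)
    (h0 : -(Real.pi / 2) < u.re) (h1 : u.re < Real.pi / 2) : th2 a u ≠ 0 := by
  rw [← th1_add_pi_div_two]
  refine th1_ne_zero_of_re ha (by simpa using hu) ?_ ?_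
  all_goals
    simp
    linarith

lemma theta1_pos {a : ℝ} (ha : 0 < a) {x : ℝ} (h0 : 0 < x) (h1 : x < Real.pi) :
    0 < theta1 (nome a) x := by
  obtain ⟨c, hc, h⟩ := exists_th1_eq ha x
  rw [← ofReal_theta1 ha, ofReal_inj] at h
  rw [h]
  exact mul_pos hc (Real.sin_pos_of_pos_of_lt_pi h0 h1)

lemma theta2_pos {a : ℝ} (ha : 0 < a) {x : ℝ} (h0 : -(Real.pi / 2) < x) (h1 : x < Real.pi / 2) :
    0 < theta2 (nome a) x := by
  obtain ⟨c, hc, h⟩ := exists_th2_eq ha x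
  rw [← ofReal_theta2 ha, ofReal_inj] at h
  rw [h]
  exact mul_pos hc (Real.cos_pos_of_mem_Ioo ⟨h0, h1⟩)

lemma theta3_pos {a : ℝ} (ha : 0 < a) (x : ℝ) : 0 < theta3 (nome a) x := by
  obtain ⟨c, hc, h⟩ := exists_th3_eq ha x
  rw [← ofReal_theta3 ha, ofReal_inj] at h
  rwa [h]

lemma theta4_pos {a : ℝ} (ha : 0 < a) (x : ℝ) : 0 < theta4 (nome a) x := by
  obtain ⟨c, hc, h⟩ := exists_th4_eq ha x
  rw [← ofReal_theta4 ha, ofReal_inj] at h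
  rwa [h]

/-! ### The four corner values, their differences and their centroid. -/

section endpoints

variable (a w : ℝ)

/-- The left end-point of the support. -/
def endα : ℝ := -Real.pi * (deriv (theta1 (nome a)) w / theta1 (nome a) w)

/-- The left end-point of the saturated region. -/
def endα' : ℝ := -Real.pi * (deriv (theta4 (nome a)) w / theta4 (nome a) w)

/-- The right end-point of the saturated region. -/
def endβ' : ℝ := -Real.pi * (deriv (theta3 (nome a)) w / theta3 (nome a) w)

/-- The right end-point of the support. -/
def endβ : ℝ := -Real.pi * (deriv (theta2 (nome a)) w / theta2 (nome a) w)

end endpoints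

lemma ofReal_deriv_theta1 {a : ℝ} (ha : 0 < a) (x : ℝ) :
    ((deriv (theta1 (nome a)) x : ℝ) : ℂ) = deriv (th1 a) x :=
  (hasDerivAt_of_ofReal_eq (differentiable_th1 ha) (ofReal_theta1 ha) x).2

lemma ofReal_deriv_theta2 {a : ℝ} (ha : 0 < a) (x : ℝ) :
    ((deriv (theta2 (nome a)) x : ℝ) : ℂ) = deriv (th2 a) x :=
  (hasDerivAt_of_ofReal_eq (differentiable_th2 ha) (ofReal_theta2 ha) x).2

lemma ofReal_deriv_theta3 {a : ℝ} (ha : 0 < a) (x : ℝ) :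
    ((deriv (theta3 (nome a)) x : ℝ) : ℂ) = deriv (th3 a) x :=
  (hasDerivAt_of_ofReal_eq (differentiable_th3 ha) (ofReal_theta3 ha) x).2

lemma ofReal_deriv_theta4 {a : ℝ} (ha : 0 < a) (x : ℝ) :
    ((deriv (theta4 (nome a)) x : ℝ) : ℂ) = deriv (th4 a) x :=
  (hasDerivAt_of_ofReal_eq (differentiable_th4 ha) (ofReal_theta4 ha) x).2

/-- At a corner the denominator is the square of a theta function of `w`, and the numerator is then
the derivative of that square; this produces the logarithmic derivatives in the end-point formulas.
-/
lemma mapHom_eq_of_sq {a w : ℝ} {b c t d k : ℂ} (hk : k ≠ 0) (ht : t ≠ 0)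
    (hD : mapDen a w b c = k * t ^ 2) (hN : mapNum a w b c = k * (2 * t * d)) :
    mapHom a w b c = -Real.pi * (d / t) := by
  rw [mapHom, hD, hN]
  field_simp

lemma mapDen_α {a w : ℝ} (ha : 0 < a) : mapDen a w (thA a 0) (thB a 0) = th1 a w ^ 2 := by
  rw [th1_sq ha, mapDen]; ring

lemma mapDen_α' {a w : ℝ} (ha : 0 < a) : mapDen a w (thB a 0) (thA a 0) = th4 a w ^ 2 := by
  rw [th4_sq ha, mapDen]; ring

lemma mapDen_β' {a w : ℝ} (ha : 0 < a) : mapDen a w (-thB a 0) (thA a 0) = th3 a w ^ 2 := by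
  rw [th3_sq ha, mapDen]; ring

lemma mapDen_β {a w : ℝ} (ha : 0 < a) : mapDen a w (-thA a 0) (thB a 0) = th2 a w ^ 2 := by
  rw [th2_sq ha, mapDen]; ring

lemma th_ne_zero {a w : ℝ} (ha : 0 < a) (hw0 : 0 < w) (hw1 : w < Real.pi / 2) : th1 a w ≠ 0 ∧ th2 a w ≠ 0 ∧ th3 a w ≠ 0 ∧ th4 a w ≠ 0 := by
  refine ⟨?_, ?_, ?_, ?_⟩
  · rw [← ofReal_theta1 ha]; exact_mod_cast (theta1_pos ha hw0 (by linarith)).ne'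
  · rw [← ofReal_theta2 ha]; exact_mod_cast (theta2_pos ha (by linarith) hw1).ne'
  · rw [← ofReal_theta3 ha]; exact_mod_cast (theta3_pos ha w).ne'
  · rw [← ofReal_theta4 ha]; exact_mod_cast (theta4_pos ha w).ne'

lemma mapHom_α {a w : ℝ} (ha : 0 < a) (hw0 : 0 < w) (hw1 : w < Real.pi / 2) : mapHom a w (thA a 0) (thB a 0) = endα a w := by
  have hN : mapNum a w (thA a 0) (thB a 0) = 1 * (2 * th1 a w * deriv (th1 a) w) := by
    rw [deriv_sq_of_mul (differentiable_th1 ha) (differentiable_thA ha) (differentiable_thB ha)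
      (th1_sq ha), mapNum]
    ring
  rw [mapHom_eq_of_sq one_ne_zero (th_ne_zero ha hw0 hw1).1 (by rw [mapDen_α ha, one_mul]) hN, endα]
  push_cast
  rw [ofReal_theta1 ha, ofReal_deriv_theta1 ha]

lemma mapHom_α' {a w : ℝ} (ha : 0 < a) (hw0 : 0 < w) (hw1 : w < Real.pi / 2) : mapHom a w (thB a 0) (thA a 0) = endα' a w := by
  have hN : mapNum a w (thB a 0) (thA a 0) = 1 * (2 * th4 a w * deriv (th4 a) w) := by
    rw [deriv_sq_of_mul (differentiable_th4 ha) (differentiable_thA ha) (differentiable_thB ha)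
      (th4_sq ha), mapNum]
    ring
  rw [mapHom_eq_of_sq one_ne_zero (th_ne_zero ha hw0 hw1).2.2.2 (by rw [mapDen_α' ha, one_mul]) hN,
    endα']
  push_cast
  rw [ofReal_theta4 ha, ofReal_deriv_theta4 ha]

lemma mapHom_β' {a w : ℝ} (ha : 0 < a) (hw0 : 0 < w) (hw1 : w < Real.pi / 2) : mapHom a w (-thB a 0) (thA a 0) = endβ' a w := by
  have hN : mapNum a w (-thB a 0) (thA a 0) = 1 * (2 * th3 a w * deriv (th3 a) w) := by
    rw [deriv_sq_of_mul (differentiable_th3 ha) (differentiable_thA ha) (differentiable_thB ha)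
      (th3_sq ha), mapNum]
    ring
  rw [mapHom_eq_of_sq one_ne_zero (th_ne_zero ha hw0 hw1).2.2.1 (by rw [mapDen_β' ha, one_mul]) hN,
    endβ']
  push_cast
  rw [ofReal_theta3 ha, ofReal_deriv_theta3 ha]

lemma mapHom_β {a w : ℝ} (ha : 0 < a) (hw0 : 0 < w) (hw1 : w < Real.pi / 2) : mapHom a w (-thA a 0) (thB a 0) = endβ a w := by
  have hN : mapNum a w (-thA a 0) (thB a 0) = 1 * (2 * th2 a w * deriv (th2 a) w) := by
    rw [deriv_sq_of_mul (differentiable_th2 ha) (differentiable_thA ha) (differentiable_thB ha)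
      (th2_sq ha), mapNum]
    ring
  rw [mapHom_eq_of_sq one_ne_zero (th_ne_zero ha hw0 hw1).2.1 (by rw [mapDen_β ha, one_mul]) hN,
    endβ]
  push_cast
  rw [ofReal_theta2 ha, ofReal_deriv_theta2 ha]

lemma th2_zero_sq {a : ℝ} (ha : 0 < a) : th2 a 0 ^ 2 = 2 * thA a 0 * thB a 0 := by
  rw [th2_sq ha]; ring

lemma th3_zero_sq {a : ℝ} (ha : 0 < a) : th3 a 0 ^ 2 = thA a 0 ^ 2 + thB a 0 ^ 2 := by
  rw [th3_sq ha]; ring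

lemma th4_zero_sq {a : ℝ} (ha : 0 < a) : th4 a 0 ^ 2 = thA a 0 ^ 2 - thB a 0 ^ 2 := by
  rw [th4_sq ha]; ring

/-- The differences of the end-points. -/
lemma endpoint_differences {a w : ℝ} (ha : 0 < a) (hw0 : 0 < w) (hw1 : w < Real.pi / 2) :
    endα' a w - endα a w = Real.pi * theta4 (nome a) 0 ^ 2 *
      (theta2 (nome a) w * theta3 (nome a) w / (theta1 (nome a) w * theta4 (nome a) w)) ∧
    endβ' a w - endα' a w = Real.pi * theta2 (nome a) 0 ^ 2 *
      (theta1 (nome a) w * theta2 (nome a) w / (theta3 (nome a) w * theta4 (nome a) w)) ∧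
    endβ a w - endβ' a w = Real.pi * theta4 (nome a) 0 ^ 2 *
      (theta1 (nome a) w * theta4 (nome a) w / (theta2 (nome a) w * theta3 (nome a) w)) ∧
    endβ a w - endα a w = Real.pi * theta2 (nome a) 0 ^ 2 *
      (theta3 (nome a) w * theta4 (nome a) w / (theta1 (nome a) w * theta2 (nome a) w)) ∧
    endβ a w - endα' a w = Real.pi * theta3 (nome a) 0 ^ 2 *
      (theta1 (nome a) w * theta3 (nome a) w / (theta2 (nome a) w * theta4 (nome a) w)) ∧
    endβ' a w - endα a w = Real.pi * theta3 (nome a) 0 ^ 2 *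
      (theta2 (nome a) w * theta4 (nome a) w / (theta1 (nome a) w * theta3 (nome a) w)) := by
  obtain ⟨h1, h2, h3, h4⟩ := th_ne_zero ha hw0 hw1
  have d1 := mapDen_α (w := w) ha
  have d4 := mapDen_α' (w := w) ha
  have d3 := mapDen_β' (w := w) ha
  have d2 := mapDen_β (w := w) ha
  have n1 : mapDen a w (thA a 0) (thB a 0) ≠ 0 := by rw [d1]; positivity
  have n4 : mapDen a w (thB a 0) (thA a 0) ≠ 0 := by rw [d4]; positivity
  have n3 : mapDen a w (-thB a 0) (thA a 0) ≠ 0 := by rw [d3]; positivity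
  have n2 : mapDen a w (-thA a 0) (thB a 0) ≠ 0 := by rw [d2]; positivity
  simp only [← ofReal_inj (w := _ * _), ofReal_mul, ofReal_sub, ofReal_div, ofReal_pow,
    ofReal_theta1 ha, ofReal_theta2 ha, ofReal_theta3 ha, ofReal_theta4 ha, ofReal_zero,
    ← mapHom_α ha hw0 hw1, ← mapHom_α' ha hw0 hw1, ← mapHom_β' ha hw0 hw1, ← mapHom_β ha hw0 hw1,
    th2_zero_sq ha, th3_zero_sq ha, th4_zero_sq ha]
  -- Up to sign, the cross determinants `b c' - c b'` of the corner coordinates are `A² - B²`, `2AB`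
  -- and `A² + B²` at `0`, that is `θ₄(0)²`, `θ₂(0)²` and `θ₃(0)²`.
  rw [mapHom_sub ha w n4 n1, mapHom_sub ha w n3 n4, mapHom_sub ha w n2 n3, mapHom_sub ha w n2 n1,
    mapHom_sub ha w n2 n4, mapHom_sub ha w n3 n1, d1, d2, d3, d4, mapWronsk]
  refine ⟨?_, ?_, ?_, ?_, ?_, ?_⟩ <;>
  · field_simp
    ring

lemma endpoint_order {a w : ℝ} (ha : 0 < a) (hw0 : 0 < w) (hw1 : w < Real.pi / 2) : endα a w < endα' a w ∧ endα' a w < endβ' a w ∧ endβ' a w < endβ a w := by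
  obtain ⟨h1, h2, h3, -⟩ := endpoint_differences ha hw0 hw1
  have p1 := theta1_pos ha hw0 (by linarith)
  have p2 := theta2_pos ha (by linarith) hw1
  have p3 := theta3_pos ha w
  have p4 := theta4_pos ha w
  have p40 := theta4_pos ha 0
  have hp := Real.pi_pos
  have p20 := theta2_pos ha (x := 0) (by linarith) (by linarith)
  refine ⟨sub_pos.1 ?_, sub_pos.1 ?_, sub_pos.1 ?_⟩
  · rw [h1]; positivity
  · rw [h2]; positivity
  · rw [h3]; positivity

/-- Zinn-Justin's formula for the centroid. -/
lemma endpoint_centroid {a w : ℝ} (ha : 0 < a) (hw0 : 0 < w) (hw1 : w < Real.pi / 2) : (endα a w + endα' a w + endβ' a w + endβ a w) / 4 =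
    -(Real.pi / 2) * (deriv (theta2 (nome a)) (2 * w - Real.pi / 2) /
      theta2 (nome a) (2 * w - Real.pi / 2)) := by
  obtain ⟨h1, h2, h3, h4⟩ := th_ne_zero ha hw0 hw1
  have hd := th1_two_mul ha w
  have hW : 2 * th1 a w * th2 a w * th3 a w * th4 a w ≠ 0 :=
    mul_ne_zero (mul_ne_zero (mul_ne_zero (mul_ne_zero two_ne_zero h1) h2) h3) h4
  have h2w : th1 a (2 * w) ≠ 0 := by
    intro h
    rw [h, zero_mul] at hd
    exact hW hd.symm
  -- Both sides of the duplication formula are differentiated at `w`. Dividing by the formula itself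
  -- gives twice the logarithmic derivative of `θ₁` at `2w` as the sum of the four at `w`, and
  -- `θ₁(2w) = θ₂(2w - π/2)`.
  have e1 : HasDerivAt (fun u : ℂ => th1 a (2 * u) * deriv (th1 a) 0)
      (2 * deriv (th1 a) (2 * w) * deriv (th1 a) 0) w := by
    have := (differentiable_th1 ha (2 * w)).hasDerivAt.comp (w : ℂ)
      ((hasDerivAt_id (w : ℂ)).const_mul 2)
    have h := this.mul_const (deriv (th1 a) 0)
    exact h.congr_deriv (by ring)
  have e2 : HasDerivAt (fun u : ℂ => 2 * th1 a u * th2 a u * th3 a u * th4 a u)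
      (((2 * deriv (th1 a) w * th2 a w + 2 * th1 a w * deriv (th2 a) w) * th3 a w +
        2 * th1 a w * th2 a w * deriv (th3 a) w) * th4 a w +
        2 * th1 a w * th2 a w * th3 a w * deriv (th4 a) w) w :=
    ((((differentiable_th1 ha w).hasDerivAt.const_mul 2).mul
      (differentiable_th2 ha w).hasDerivAt).mul (differentiable_th3 ha w).hasDerivAt).mul
      (differentiable_th4 ha w).hasDerivAt
  simp_rw [th1_two_mul ha] at e1
  have e3 := e1.unique e2
  have e4 : deriv (th2 a) ((2 * w - Real.pi / 2 : ℝ) : ℂ) = deriv (th1 a) (2 * w) := by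
    have : th1 a = fun u => th2 a (u - Real.pi / 2) := rfl
    rw [this, deriv_comp_sub_const]
    push_cast
    rfl
  have e5 : th2 a ((2 * w - Real.pi / 2 : ℝ) : ℂ) = th1 a (2 * w) := by
    rw [th1]; push_cast; rfl
  rw [← ofReal_inj]
  simp only [endα, endα', endβ', endβ, ofReal_mul, ofReal_add, ofReal_neg, ofReal_div,
    ofReal_ofNat, ofReal_theta1 ha, ofReal_theta2 ha, ofReal_theta3 ha, ofReal_theta4 ha,
    ofReal_deriv_theta1 ha, ofReal_deriv_theta2 ha, ofReal_deriv_theta3 ha, ofReal_deriv_theta4 ha]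
  rw [e4, e5]
  have hd0 : deriv (th1 a) 0 ≠ 0 := by
    intro h
    rw [h, mul_zero] at hd
    exact hW hd.symm
  have e6 : deriv (th1 a) (2 * w) / th1 a (2 * w) = (deriv (th1 a) w / th1 a w +
      deriv (th4 a) w / th4 a w + deriv (th3 a) w / th3 a w + deriv (th2 a) w / th2 a w) / 2 := by
    have : deriv (th1 a) (2 * w) / th1 a (2 * w) =
      (2 * deriv (th1 a) (2 * w) * deriv (th1 a) 0) / (2 * (th1 a (2 * w) * deriv (th1 a) 0)) := by
      field_simp
    rw [this, e3, hd]
    field_simp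
    ring
  rw [e6]
  ring

/-! ### Real values and monotonicity on the edges of the rectangle. -/

section edges

variable (a w : ℝ)

/-- The uniformizing map on the left edge of the rectangle. -/
def xL (s : ℝ) : ℝ := (confMap a w (s * I)).re

/-- The uniformizing map on the right edge of the rectangle. -/
def xR (s : ℝ) : ℝ := (confMap a w (Real.pi / 2 + s * I)).re

/-- The uniformizing map on the upper edge of the rectangle. -/
def xS (r : ℝ) : ℝ := (confMap a w (r + Real.pi * a / 2 * I)).re

/-- Conjugation sends a point of this edge to its negative, under which the map is invariant. The
other two edges work alike, with an additional translation by `π` on the right edge and with the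
translation by `iπa` alone on the upper edge. -/
lemma ofReal_xL (s : ℝ) : (xL a w s : ℂ) = confMap a w (s * I) := by
  refine confMap_real_of_conj ?_
  rw [← confMap_neg]
  congr 1
  simp

lemma ofReal_xR (s : ℝ) : (xR a w s : ℂ) = confMap a w (Real.pi / 2 + s * I) := by
  refine confMap_real_of_conj ?_
  rw [← confMap_neg, ← confMap_add_pi]
  congr 1
  simp only [map_add, map_mul, map_div₀, conj_ofReal, conj_I, map_ofNat]
  ring

lemma ofReal_xS (r : ℝ) : (xS a w r : ℂ) = confMap a w (r + Real.pi * a / 2 * I) := by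
  refine confMap_real_of_conj ?_
  rw [← confMap_add_two_tau]
  congr 1
  simp only [map_add, map_mul, map_div₀, conj_ofReal, conj_I, map_ofNat]
  ring

lemma ofReal_re_confMap (r : ℝ) : ((confMap a w r).re : ℂ) = confMap a w r :=
  confMap_real_of_conj (by rw [conj_ofReal])

end edges

/-- The denominator of the uniformizing map as a function of the uniformizing variable. -/
def confDen (a w : ℝ) (u : ℂ) : ℂ := th1 a (w + u) * th1 a (w - u)

lemma mapDen_eq_confDen {a : ℝ} (ha : 0 < a) (w : ℝ) (u : ℂ) :
    mapDen a w (thA a u) (thB a u) = confDen a w u := mapDen_confMap ha w u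

/-- The factor `θ₁(u+v) θ₁(u-v)` shows that two points with the same value agree up to sign and
periods. -/
lemma confMap_sub {a : ℝ} (ha : 0 < a) (w : ℝ) {u v : ℂ} (hu : confDen a w u ≠ 0)
    (hv : confDen a w v ≠ 0) : confMap a w u - confMap a w v =
      -(Real.pi / 2) * mapWronsk a w * (th1 a (u + v) * th1 a (u - v)) /
        (confDen a w u * confDen a w v) := by
  rw [confMap, confMap, mapHom_sub ha w (by rwa [mapDen_eq_confDen ha])
    (by rwa [mapDen_eq_confDen ha]), mapDen_eq_confDen ha, mapDen_eq_confDen ha, th1_mul_th1 ha]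

lemma mapWronsk_ne_zero {a w : ℝ} (ha : 0 < a) (hw0 : 0 < w) (hw1 : w < Real.pi / 2) :
    mapWronsk a w ≠ 0 := by
  obtain ⟨h1, h2, h3, h4⟩ := th_ne_zero ha hw0 hw1
  exact mul_ne_zero (mul_ne_zero (mul_ne_zero (mul_ne_zero two_ne_zero h1) h2) h3) h4

lemma th1_mul_eq_zero_of_confMap_eq {a w : ℝ} (ha : 0 < a) (hw0 : 0 < w) (hw1 : w < Real.pi / 2)
    {u v : ℂ} (hu : confDen a w u ≠ 0) (hv : confDen a w v ≠ 0)
    (h : confMap a w u = confMap a w v) : th1 a (u + v) * th1 a (u - v) = 0 := by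
  have := confMap_sub ha w hu hv
  rw [h, sub_self, eq_comm, div_eq_zero_iff] at this
  have hp := pi_ne_zero'
  have hW := mapWronsk_ne_zero ha hw0 hw1
  simpa [hu, hv, hp, hW] using this

lemma confDen_left {a w : ℝ} (ha : 0 < a) (hw0 : 0 < w) (hw1 : w < Real.pi / 2) {s : ℝ}
    (hs : |s| < Real.pi * a) : confDen a w (s * I) ≠ 0 := by
  refine mul_ne_zero (th1_ne_zero_of_re ha ?_ ?_ ?_) (th1_ne_zero_of_re ha ?_ ?_ ?_) <;> simp
  all_goals first | assumption | linarith

lemma confDen_right_eq (a w : ℝ) (s : ℝ) :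
    confDen a w (Real.pi / 2 + s * I) = -(th2 a (w + s * I) * th2 a (w - s * I)) := by
  have e2 := th2_add_pi a (w - s * I - Real.pi)
  rw [sub_add_cancel] at e2
  rw [confDen, show (w : ℂ) + (Real.pi / 2 + s * I) = (w + s * I) + Real.pi / 2 by ring,
    th1_add_pi_div_two, th1, e2,
    show (w : ℂ) - (Real.pi / 2 + s * I) - Real.pi / 2 = w - s * I - Real.pi by ring]
  ring

lemma confDen_right {a w : ℝ} (ha : 0 < a) (hw0 : 0 < w) (hw1 : w < Real.pi / 2) {s : ℝ}
    (hs : |s| < Real.pi * a) : confDen a w (Real.pi / 2 + s * I) ≠ 0 := by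
  rw [confDen_right_eq]
  refine neg_ne_zero.2 (mul_ne_zero (th2_ne_zero_of_re ha ?_ ?_ ?_) (th2_ne_zero_of_re ha ?_ ?_ ?_))
    <;> simp
  all_goals first | assumption | linarith

lemma confDen_upper {a : ℝ} (ha : 0 < a) (w r : ℝ) :
    confDen a w (r + Real.pi * a / 2 * I) ≠ 0 := by
  have hp := mul_pos Real.pi_pos ha
  have e : (Real.pi * a / 2 * I : ℂ) = ((Real.pi * a / 2 : ℝ) : ℂ) * I := by push_cast; rfl
  rw [e]
  refine mul_ne_zero (th1_ne_zero ha ?_ (sin_ne_zero_of_im ?_))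
    (th1_ne_zero ha ?_ (sin_ne_zero_of_im ?_)) <;>
    simp only [add_im, sub_im, mul_im, ofReal_re, ofReal_im, I_im, I_re, mul_one, mul_zero, add_zero,
      zero_add, zero_sub, abs_neg, neg_ne_zero]
  · rw [abs_of_pos (by positivity)]; linarith
  · positivity
  · rw [abs_of_pos (by positivity)]; linarith
  · positivity

lemma differentiableAt_confMap {a : ℝ} (ha : 0 < a) {w : ℝ} {u : ℂ} (hu : confDen a w u ≠ 0) :
    DifferentiableAt ℂ (confMap a w) u := by
  have hA := differentiable_thA ha
  have hB := differentiable_thB ha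
  rw [← mapDen_eq_confDen ha] at hu
  unfold confMap mapHom mapNum mapDen
  unfold mapDen at hu
  fun_prop (disch := assumption)

lemma abs_lt_of_mem_Icc {a s : ℝ} (ha : 0 < a) (hs : s ∈ Set.Icc 0 (Real.pi * a / 2)) :
    |s| < Real.pi * a := by
  have := mul_pos Real.pi_pos ha
  rw [abs_of_nonneg hs.1]
  linarith [hs.2]

lemma continuousOn_xL {a w : ℝ} (ha : 0 < a) (hw0 : 0 < w) (hw1 : w < Real.pi / 2) :
    ContinuousOn (xL a w) (Set.Icc 0 (Real.pi * a / 2)) := by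
  intro s hs
  refine ContinuousAt.continuousWithinAt ?_
  have := (differentiableAt_confMap ha (confDen_left ha hw0 hw1 (abs_lt_of_mem_Icc ha hs))).continuousAt
  exact Complex.continuous_re.continuousAt.comp
    (ContinuousAt.comp (f := fun s : ℝ => (s : ℂ) * I) this (by fun_prop))

lemma continuousOn_xR {a w : ℝ} (ha : 0 < a) (hw0 : 0 < w) (hw1 : w < Real.pi / 2) :
    ContinuousOn (xR a w) (Set.Icc 0 (Real.pi * a / 2)) := by
  intro s hs
  refine ContinuousAt.continuousWithinAt ?_
  have := (differentiableAt_confMap ha (confDen_right ha hw0 hw1 (abs_lt_of_mem_Icc ha hs))).continuousAt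
  exact Complex.continuous_re.continuousAt.comp
    (ContinuousAt.comp (f := fun s : ℝ => (Real.pi / 2 : ℂ) + s * I) this (by fun_prop))

/-- For distinct heights in `[0, πa/2]` the sum and the difference are nonzero and smaller than `πa`
in modulus, a range in which `θ₁` has no zero on the imaginary axis except `0`. -/
lemma injOn_xL {a w : ℝ} (ha : 0 < a) (hw0 : 0 < w) (hw1 : w < Real.pi / 2) :
    Set.InjOn (xL a w) (Set.Icc 0 (Real.pi * a / 2)) := by
  intro s hs t ht h
  by_contra hne
  rw [← ofReal_inj, ofReal_xL, ofReal_xL] at h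
  have := th1_mul_eq_zero_of_confMap_eq ha hw0 hw1 (confDen_left ha hw0 hw1 (abs_lt_of_mem_Icc ha hs))
    (confDen_left ha hw0 hw1 (abs_lt_of_mem_Icc ha ht)) h
  rw [Set.mem_Icc] at hs ht
  have hst : 0 < s + t ∧ s + t < Real.pi * a := by
    rcases lt_or_gt_of_ne hne with h | h <;> constructor <;> linarith
  refine mul_ne_zero (th1_ne_zero ha ?_ (sin_ne_zero_of_im ?_))
    (th1_ne_zero ha ?_ (sin_ne_zero_of_im ?_)) this <;> simp
  · rw [abs_of_pos hst.1]; exact hst.2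
  · exact hst.1.ne'
  · rw [abs_lt]; constructor <;> linarith
  · exact sub_ne_zero.2 hne

lemma injOn_xR {a w : ℝ} (ha : 0 < a) (hw0 : 0 < w) (hw1 : w < Real.pi / 2) :
    Set.InjOn (xR a w) (Set.Icc 0 (Real.pi * a / 2)) := by
  intro s hs t ht h
  by_contra hne
  rw [← ofReal_inj, ofReal_xR, ofReal_xR] at h
  have := th1_mul_eq_zero_of_confMap_eq ha hw0 hw1 (confDen_right ha hw0 hw1 (abs_lt_of_mem_Icc ha hs))
    (confDen_right ha hw0 hw1 (abs_lt_of_mem_Icc ha ht)) h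
  rw [Set.mem_Icc] at hs ht
  have hst : 0 < s + t ∧ s + t < Real.pi * a := by
    rcases lt_or_gt_of_ne hne with h | h <;> constructor <;> linarith
  have e : (Real.pi / 2 : ℂ) = ((Real.pi / 2 : ℝ) : ℂ) := by push_cast; rfl
  rw [e] at this
  refine mul_ne_zero (th1_ne_zero ha ?_ (sin_ne_zero_of_im ?_))
    (th1_ne_zero ha ?_ (sin_ne_zero_of_im ?_)) this <;>
    simp only [add_im, sub_im, mul_im, ofReal_re, ofReal_im, I_im, I_re, mul_one, mul_zero, add_zero,
      zero_add]
  · rw [abs_of_pos hst.1]; exact hst.2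
  · exact hst.1.ne'
  · rw [abs_lt]; constructor <;> linarith
  · exact sub_ne_zero.2 hne

lemma xL_zero {a w : ℝ} (ha : 0 < a) (hw0 : 0 < w) (hw1 : w < Real.pi / 2) :
    xL a w 0 = endα a w := by
  rw [← ofReal_inj, ofReal_xL, ofReal_zero, zero_mul, confMap, mapHom_α ha hw0 hw1]

lemma xL_top {a w : ℝ} (ha : 0 < a) (hw0 : 0 < w) (hw1 : w < Real.pi / 2) :
    xL a w (Real.pi * a / 2) = endα' a w := by
  rw [← ofReal_inj, ofReal_xL, ← mapHom_α' ha hw0 hw1, ← confMap_add_tau]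
  push_cast
  rw [zero_add]

lemma xR_zero {a w : ℝ} (ha : 0 < a) (hw0 : 0 < w) (hw1 : w < Real.pi / 2) :
    xR a w 0 = endβ a w := by
  rw [← ofReal_inj, ofReal_xR, ofReal_zero, zero_mul, add_zero, confMap, ← mapHom_β ha hw0 hw1,
    ← zero_add (Real.pi / 2 : ℂ), thA_add_pi_div_two, thB_add_pi_div_two, ← mapHom_neg, neg_neg]

lemma xR_top {a w : ℝ} (ha : 0 < a) (hw0 : 0 < w) (hw1 : w < Real.pi / 2) :
    xR a w (Real.pi * a / 2) = endβ' a w := by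
  rw [← ofReal_inj, ofReal_xR, ← mapHom_β' ha hw0 hw1]
  push_cast
  rw [confMap_add_tau, ← zero_add (Real.pi / 2 : ℂ), thA_add_pi_div_two, thB_add_pi_div_two]

/-- A continuous injective function on an interval is strictly monotone, and the known order of the
corner values decides the direction; no sign of a derivative is needed. -/
lemma strictMonoOn_xL {a w : ℝ} (ha : 0 < a) (hw0 : 0 < w) (hw1 : w < Real.pi / 2) :
    StrictMonoOn (xL a w) (Set.Icc 0 (Real.pi * a / 2)) := by
  have := mul_pos Real.pi_pos ha
  refine ContinuousOn.strictMonoOn_of_injOn_Icc (by linarith) ?_ (continuousOn_xL ha hw0 hw1)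
    (injOn_xL ha hw0 hw1)
  rw [xL_zero ha hw0 hw1, xL_top ha hw0 hw1]
  exact (endpoint_order ha hw0 hw1).1.le

lemma strictAntiOn_xR {a w : ℝ} (ha : 0 < a) (hw0 : 0 < w) (hw1 : w < Real.pi / 2) :
    StrictAntiOn (xR a w) (Set.Icc 0 (Real.pi * a / 2)) := by
  have := mul_pos Real.pi_pos ha
  refine ContinuousOn.strictAntiOn_of_injOn_Icc (by linarith) ?_ (continuousOn_xR ha hw0 hw1)
    (injOn_xR ha hw0 hw1)
  rw [xR_zero ha hw0 hw1, xR_top ha hw0 hw1]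
  exact (endpoint_order ha hw0 hw1).2.2.le

/-- On the upper edge the addition theorem for `θ₄` makes the denominator `θ₄(r+w) θ₄(r-w)`, so the
map has an explicit primitive in `r`. -/
lemma xS_eq {a : ℝ} (ha : 0 < a) (w r : ℝ) :
    xS a w r = -(Real.pi / 2) * (deriv (theta4 (nome a)) (r + w) / theta4 (nome a) (r + w) -
      deriv (theta4 (nome a)) (r - w) / theta4 (nome a) (r - w)) := by
  have e1 : HasDerivAt (fun y : ℂ => th4 a (r + y) * th4 a (r - y))
      (deriv (th4 a) (r + w) * th4 a (r - w) + th4 a (r + w) * (-deriv (th4 a) (r - w))) w := by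
    refine HasDerivAt.mul ?_ ?_
    · exact (differentiable_th4 ha (r + w)).hasDerivAt.comp_const_add (r : ℂ) (w : ℂ)
    · exact (differentiable_th4 ha (r - w)).hasDerivAt.comp_const_sub (r : ℂ) (w : ℂ)
  simp_rw [th4_mul_th4 ha] at e1
  have e2 := (((differentiable_thA ha w).hasDerivAt.const_mul (thA a r)).sub
    ((differentiable_thB ha w).hasDerivAt.const_mul (thB a r)))
  have e3 := e2.unique e1
  have hN : mapNum a w (thB a r) (thA a r) =
      deriv (th4 a) (r + w) * th4 a (r - w) - th4 a (r + w) * deriv (th4 a) (r - w) := by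
    rw [mapNum]; linear_combination e3
  have hD : mapDen a w (thB a r) (thA a r) = th4 a (r + w) * th4 a (r - w) := by
    rw [th4_mul_th4 ha, mapDen]; ring
  have h1 := ofReal_theta4 ha (r + w)
  have h2 := ofReal_theta4 ha (r - w)
  have h3 := ofReal_deriv_theta4 ha (r + w)
  have h4 := ofReal_deriv_theta4 ha (r - w)
  have n1 : (theta4 (nome a) (r + w) : ℂ) ≠ 0 := by exact_mod_cast (theta4_pos ha (r + w)).ne'
  have n2 : (theta4 (nome a) (r - w) : ℂ) ≠ 0 := by exact_mod_cast (theta4_pos ha (r - w)).ne'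
  push_cast at h1 h2 h3 h4
  rw [← ofReal_inj, ofReal_xS, confMap_add_tau, mapHom, hN, hD, ← h1, ← h2, ← h3, ← h4]
  push_cast
  field_simp

lemma continuous_xS {a : ℝ} (ha : 0 < a) (w : ℝ) : Continuous (xS a w) := by
  rw [continuous_iff_continuousAt]
  intro r
  have := (differentiableAt_confMap ha (confDen_upper ha w r)).continuousAt
  exact Complex.continuous_re.continuousAt.comp
    (ContinuousAt.comp (f := fun r : ℝ => (r : ℂ) + Real.pi * a / 2 * I) this (by fun_prop))

lemma theta4_neg (q x : ℝ) : theta4 q (-x) = theta4 q x := by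
  simp [theta4]

lemma theta4_add_pi (q x : ℝ) : theta4 q (x + Real.pi) = theta4 q x := by
  rw [theta4, theta4]
  congr 3
  funext n
  rw [show 2 * ((n : ℝ) + 1) * (x + Real.pi) = 2 * ((n : ℝ) + 1) * x + (n + 1 : ℕ) * (2 * Real.pi) by
    push_cast; ring, Real.cos_add_nat_mul_two_pi]

/-- The primitive `log θ₄(r+w) - log θ₄(r-w)` vanishes at both ends, since `θ₄` is even and has
period `π`. This identity locates the kink `x = 0` of the potential relative to the saturated
region. -/
lemma integral_xS {a : ℝ} (ha : 0 < a) (w : ℝ) : ∫ r in (0 : ℝ)..(Real.pi / 2), xS a w r = 0 := by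
  have hd : ∀ r ∈ Set.uIcc 0 (Real.pi / 2), HasDerivAt (fun r => -(Real.pi / 2) *
      (Real.log (theta4 (nome a) (r + w)) - Real.log (theta4 (nome a) (r - w)))) (xS a w r) r := by
    intro r _
    have ht := fun x => (hasDerivAt_of_ofReal_eq (differentiable_th4 ha) (ofReal_theta4 ha) x).1
    rw [xS_eq ha]
    exact ((((ht (r + w)).comp_add_const r w).log (theta4_pos ha _).ne').sub
      (((ht (r - w)).comp_sub_const r w).log (theta4_pos ha _).ne')).const_mul _
  rw [intervalIntegral.integral_eq_sub_of_hasDerivAt hd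
    ((continuous_xS ha w).intervalIntegrable _ _), zero_add, zero_sub, theta4_neg, ← theta4_neg,
    ← theta4_add_pi, show -(Real.pi / 2 + w) + Real.pi = Real.pi / 2 - w by ring]
  ring

lemma xS_zero {a w : ℝ} (ha : 0 < a) (hw0 : 0 < w) (hw1 : w < Real.pi / 2) :
    xS a w 0 = endα' a w := by
  rw [← ofReal_inj, ofReal_xS, ← mapHom_α' ha hw0 hw1, ← confMap_add_tau, ofReal_zero]

lemma xS_pi_div_two {a w : ℝ} (ha : 0 < a) (hw0 : 0 < w) (hw1 : w < Real.pi / 2) :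
    xS a w (Real.pi / 2) = endβ' a w := by
  rw [← ofReal_inj, ofReal_xS, ← mapHom_β' ha hw0 hw1]
  push_cast
  rw [confMap_add_tau, ← zero_add (Real.pi / 2 : ℂ), thA_add_pi_div_two, thB_add_pi_div_two]

lemma injOn_xS {a w : ℝ} (ha : 0 < a) (hw0 : 0 < w) (hw1 : w < Real.pi / 2) :
    Set.InjOn (xS a w) (Set.Icc 0 (Real.pi / 2)) := by
  have hden : ∀ r : ℝ, mapDen a w (thB a r) (thA a r) ≠ 0 := fun r => by
    have hD : mapDen a w (thB a r) (thA a r) = th4 a (r + w) * th4 a (r - w) := by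
      rw [th4_mul_th4 ha, mapDen]; ring
    have h1 := ofReal_theta4 ha (r + w)
    have h2 := ofReal_theta4 ha (r - w)
    push_cast at h1 h2
    rw [hD, ← h1, ← h2]
    exact_mod_cast (mul_pos (theta4_pos ha _) (theta4_pos ha _)).ne'
  intro s hs t ht h
  wlog hst : s < t generalizing s t
  · rcases lt_trichotomy s t with h' | h' | h'
    · exact absurd h' hst
    · exact h'
    · exact (this ht hs h.symm h').symm
  exfalso
  rw [← ofReal_inj, ofReal_xS, ofReal_xS, confMap_add_tau, confMap_add_tau, ← sub_eq_zero,
    mapHom_sub ha w (hden s) (hden t), div_eq_zero_iff] at h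
  have hp := pi_ne_zero'
  have hW := mapWronsk_ne_zero ha hw0 hw1
  have e : thB a s * thA a t - thA a s * thB a t = th1 a (t + s) * th1 a (t - s) := by
    rw [th1_mul_th1 ha]; ring
  rw [e] at h
  rw [Set.mem_Icc] at hs ht
  have p1 : th1 a (t + s) ≠ 0 := by
    have := ofReal_theta1 ha (t + s)
    push_cast at this
    rw [← this]
    exact_mod_cast (theta1_pos ha (by linarith) (by linarith)).ne'
  have p2 : th1 a (t - s) ≠ 0 := by
    have := ofReal_theta1 ha (t - s)
    push_cast at this
    rw [← this]
    exact_mod_cast (theta1_pos ha (by linarith) (by linarith)).ne'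
  simp [hden, hp, hW, p1, p2] at h

lemma strictMonoOn_xS {a w : ℝ} (ha : 0 < a) (hw0 : 0 < w) (hw1 : w < Real.pi / 2) :
    StrictMonoOn (xS a w) (Set.Icc 0 (Real.pi / 2)) := by
  refine ContinuousOn.strictMonoOn_of_injOn_Icc (by positivity) ?_ (continuous_xS ha w).continuousOn
    (injOn_xS ha hw0 hw1)
  rw [xS_zero ha hw0 hw1, xS_pi_div_two ha hw0 hw1]
  exact (endpoint_order ha hw0 hw1).2.1.le

/-! ### Fourier expansion of the logarithm of |θ₁/θ₂|. -/

/-- The coefficients of `log (1 + X) - log (1 - X)`. -/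
def oddCoeff (n : ℕ) : ℝ := (1 - (-1) ^ n) / n

lemma oddCoeff_zero : oddCoeff 0 = 0 := by simp [oddCoeff]

lemma abs_oddCoeff_le (n : ℕ) : |oddCoeff n| ≤ 2 / n := by
  rw [oddCoeff, abs_div, Nat.abs_cast]
  gcongr
  rcases neg_one_pow_eq_or ℝ n with h | h <;> rw [h] <;> norm_num

lemma hasSum_log_norm_sub {X : ℂ} (hX : ‖X‖ < 1) :
    HasSum (fun n : ℕ => oddCoeff n * (X ^ n).re)
      (-(Real.log ‖1 - X‖ - Real.log ‖1 + X‖)) := by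
  have h1 := Complex.hasSum_taylorSeries_neg_log hX
  have h2 := Complex.hasSum_taylorSeries_neg_log (z := -X) (by rwa [norm_neg])
  have h3 := Complex.hasSum_re (h1.sub h2)
  rw [sub_neg_eq_add, sub_neg_eq_add, add_re, neg_re, Complex.log_re, Complex.log_re] at h3
  convert h3 using 1
  · funext n
    rw [oddCoeff, neg_pow X, ← sub_div, ← one_sub_mul, mul_div_right_comm]
    have : ((1 - (-1) ^ n) / n : ℂ) = (((1 - (-1) ^ n) / n : ℝ) : ℂ) := by push_cast; rfl
    rw [this, re_ofReal_mul]
  · ring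

/-- The logarithm of the modulus of `(X; p)_∞ / (-X; p)_∞`. -/
def qLog (p : ℝ) (X : ℂ) : ℝ := Real.log ‖qPoch p X‖ - Real.log ‖qPoch p (-X)‖

/-- The power series of `qLog`, up to sign. -/
def qLogSeries (p : ℝ) (X : ℂ) : ℝ := ∑' n : ℕ, oddCoeff n / (1 - p ^ n) * (X ^ n).re

lemma norm_qLogSeries_term_le {p : ℝ} (h0 : 0 < p) (h1 : p < 1) (X : ℂ) (n : ℕ) :
    ‖oddCoeff n / (1 - p ^ n) * (X ^ n).re‖ ≤ 2 / (1 - p) * ‖X‖ ^ n := by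
  have hp : 0 < 1 - p := by linarith
  rcases n with _ | n
  · simp [oddCoeff_zero]; positivity
  have hpn : p ^ (n + 1) ≤ p := by
    simpa using pow_le_pow_of_le_one h0.le h1.le (show 1 ≤ n + 1 by omega)
  rw [norm_mul]
  have e1 : ‖oddCoeff (n + 1) / (1 - p ^ (n + 1))‖ ≤ 2 / (1 - p) := by
    rw [norm_div, Real.norm_eq_abs, Real.norm_eq_abs, abs_of_pos (by linarith : 0 < 1 - p ^ (n + 1))]
    have := abs_oddCoeff_le (n + 1)
    have h2 : (2 : ℝ) / ((n + 1 : ℕ) : ℝ) ≤ 2 := by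
      apply div_le_self (by norm_num)
      push_cast
      linarith [(Nat.cast_nonneg n : (0 : ℝ) ≤ n)]
    gcongr
    exact this.trans h2
  have e2 : ‖(X ^ (n + 1)).re‖ ≤ ‖X‖ ^ (n + 1) := by
    rw [← norm_pow]; exact Complex.abs_re_le_norm _
  gcongr

lemma hasSum_qLogSeries {p : ℝ} (h0 : 0 < p) (h1 : p < 1) {X : ℂ} (hX : ‖X‖ < 1) :
    HasSum (fun n : ℕ => oddCoeff n / (1 - p ^ n) * (X ^ n).re) (qLogSeries p X) :=
  (((summable_geometric_of_lt_one (norm_nonneg X) hX).mul_left (2 / (1 - p))).of_norm_bounded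
    (norm_qLogSeries_term_le h0 h1 X)).hasSum

lemma norm_ofReal_mul_lt_one {p : ℝ} (h0 : 0 < p) (h1 : p < 1) {X : ℂ} (hX : ‖X‖ < 1) :
    ‖(p : ℂ) * X‖ < 1 := by
  rw [norm_mul, Complex.norm_real, Real.norm_eq_abs, abs_of_pos h0]
  nlinarith [norm_nonneg X]

/-- The sum of the two sides is invariant under `X ↦ p X`, because both change by the logarithm of
the first factors of the products. Iteration moves `X` to `0`, where both vanish, so no double
series has to be rearranged. -/
lemma qLog_eq_neg_series {p : ℝ} (h0 : 0 < p) (h1 : p < 1) {X : ℂ} (hX : ‖X‖ < 1) :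
    qLog p X = -qLogSeries p X := by
  have step : ∀ Y : ℂ, ‖Y‖ < 1 → qLog p Y + qLogSeries p Y =
      qLog p (p * Y) + qLogSeries p (p * Y) := by
    intro Y hY
    have hpY := norm_ofReal_mul_lt_one h0 h1 hY
    have hS := (hasSum_qLogSeries h0 h1 hY).sub (hasSum_qLogSeries h0 h1 hpY)
    have e : ∀ n : ℕ, oddCoeff n / (1 - p ^ n) * (Y ^ n).re -
        oddCoeff n / (1 - p ^ n) * (((p : ℂ) * Y) ^ n).re = oddCoeff n * (Y ^ n).re := fun n => by
      rcases n with _ | n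
      · simp [oddCoeff_zero]
      have hpn : p ^ (n + 1) < 1 := pow_lt_one₀ h0.le h1 (by omega)
      have hne : 1 - p ^ (n + 1) ≠ 0 := by linarith
      rw [mul_pow, ← ofReal_pow, re_ofReal_mul]
      field_simp
    simp_rw [e] at hS
    have h3 := hS.unique (hasSum_log_norm_sub hY)
    have n1 := qPoch_ne_zero_of_norm_lt h0 h1 hY
    have n2 := qPoch_ne_zero_of_norm_lt h0 h1 (X := -Y) (by rwa [norm_neg])
    have q1 := qPoch_eq_mul h0 h1 Y
    have q2 := qPoch_eq_mul h0 h1 (-Y)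
    rw [q1] at n1
    rw [q2] at n2
    have l1 : Real.log ‖qPoch p Y‖ = Real.log ‖1 - Y‖ + Real.log ‖qPoch p (p * Y)‖ := by
      rw [q1, norm_mul, Real.log_mul (norm_ne_zero_iff.2 (left_ne_zero_of_mul n1))
        (norm_ne_zero_iff.2 (right_ne_zero_of_mul n1))]
    have l2 : Real.log ‖qPoch p (-Y)‖ = Real.log ‖1 + Y‖ + Real.log ‖qPoch p (-(p * Y))‖ := by
      rw [q2, norm_mul, Real.log_mul (norm_ne_zero_iff.2 (left_ne_zero_of_mul n2))
        (norm_ne_zero_iff.2 (right_ne_zero_of_mul n2)), sub_neg_eq_add, mul_neg]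
    rw [qLog, qLog, l1, l2]
    linarith
  have hn : ∀ n : ℕ, ‖(p : ℂ) ^ n * X‖ < 1 := by
    intro n
    rw [norm_mul, norm_pow, Complex.norm_real, Real.norm_eq_abs, abs_of_pos h0]
    have := pow_le_one₀ h0.le h1.le (n := n)
    nlinarith [norm_nonneg X, pow_pos h0 n]
  have iter : ∀ n : ℕ, qLog p X + qLogSeries p X =
      qLog p ((p : ℂ) ^ n * X) + qLogSeries p ((p : ℂ) ^ n * X) := by
    intro n
    induction n with
    | zero => simp
    | succ n ih =>
      rw [ih, step _ (hn n), ← mul_assoc, ← pow_succ']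
  have hlim : Tendsto (fun n : ℕ => (p : ℂ) ^ n * X) atTop (𝓝 0) := by
    have : ‖(p : ℂ)‖ < 1 := by rwa [Complex.norm_real, Real.norm_eq_abs, abs_of_pos h0]
    simpa using (tendsto_pow_atTop_nhds_zero_of_norm_lt_one this).mul_const X
  have t1 : Tendsto (fun n : ℕ => qLog p ((p : ℂ) ^ n * X)) atTop (𝓝 0) := by
    have hc := continuous_qPoch h0 h1
    have n0 : qPoch p 0 ≠ 0 := qPoch_ne_zero_of_norm_lt h0 h1 (by simp)
    have c1 : ContinuousAt (qLog p) 0 := by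
      unfold qLog
      refine ContinuousAt.sub (ContinuousAt.log (by fun_prop) ?_)
        (ContinuousAt.log (by fun_prop) ?_)
      · simpa using n0
      · simpa using n0
    have := c1.tendsto.comp hlim
    rwa [show qLog p 0 = 0 by simp [qLog]] at this
  have t2 : Tendsto (fun n : ℕ => qLogSeries p ((p : ℂ) ^ n * X)) atTop (𝓝 0) := by
    have : (0 : ℝ) = ∑' n : ℕ, (0 : ℝ) := by simp
    rw [this]
    refine tendsto_tsum_of_dominated_convergence (bound := fun n => 2 / (1 - p) * ‖X‖ ^ n)
      ((summable_geometric_of_lt_one (norm_nonneg X) hX).mul_left _) (fun k => ?_)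
      (Eventually.of_forall fun n k => ?_)
    · rcases k with _ | k
      · simp [oddCoeff_zero]
      · have := ((Complex.continuous_re.tendsto _).comp (hlim.pow (k + 1))).const_mul
          (oddCoeff (k + 1) / (1 - p ^ (k + 1)))
        simpa using this
    · refine (norm_qLogSeries_term_le h0 h1 _ k).trans ?_
      have hp : 0 < 1 - p := by linarith
      gcongr
      rw [norm_mul, norm_pow, Complex.norm_real, Real.norm_eq_abs, abs_of_pos h0]
      exact mul_le_of_le_one_left (norm_nonneg X) (pow_le_one₀ h0.le h1.le)
  have := tendsto_nhds_unique (tendsto_const_nhds (x := qLog p X + qLogSeries p X))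
    ((t1.add t2).congr fun n => (iter n).symm)
  linarith

/-- `log |θ₁ / θ₂|`. -/
def logRatio (a : ℝ) (u : ℂ) : ℝ := Real.log (‖th1 a u‖ / ‖th2 a u‖)

/-- In the strip both `y = e^{2iu}` and `q²/y` lie in the unit disc. The sine or cosine supplies the
missing first factor of the product in `y`, and the remaining prefactors of `θ₁` and `θ₂` have equal
modulus. -/
lemma logRatio_eq {a : ℝ} (ha : 0 < a) {u : ℂ} (h0 : 0 < u.im) (h1 : u.im < Real.pi * a) :
    logRatio a u = qLog (nome a ^ 2) (cexp (2 * I * u)) +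
      qLog (nome a ^ 2) ((nome a : ℂ) ^ 2 * (cexp (2 * I * u))⁻¹) := by
  have p0 := nome_sq_pos a
  have p1 := nome_sq_lt_one ha
  set y := cexp (2 * I * u) with hy
  have ny : ‖y‖ < 1 := by
    rw [hy, norm_exp_two_I_mul, Real.exp_lt_one_iff]; linarith
  have ny' : ‖(nome a : ℂ) ^ 2 * y⁻¹‖ < 1 := by
    rw [norm_mul, norm_inv, hy, norm_exp_two_I_mul, norm_nome_sq, ← Real.exp_neg, ← Real.exp_add,
      Real.exp_lt_one_iff]
    linarith
  have key : ∀ k : ℂ, k = 2 * cexp (-(Real.pi * a / 4)) * cexp (-(I * u)) / 2 *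
      eulerLim (nome a ^ 2) → k ≠ 0 := by
    rintro k rfl
    exact mul_ne_zero (div_ne_zero (mul_ne_zero (mul_ne_zero two_ne_zero (Complex.exp_ne_zero _))
      (Complex.exp_ne_zero _)) two_ne_zero) (eulerLim_nome_ne_zero ha)
  obtain ⟨k, hk⟩ : ∃ k : ℂ, k = 2 * cexp (-(Real.pi * a / 4)) * cexp (-(I * u)) / 2 *
      eulerLim (nome a ^ 2) := ⟨_, rfl⟩
  have hk0 := key k hk
  have yu : cexp (-(I * u)) * y = cexp (I * u) := by
    rw [hy, ← Complex.exp_add]; congr 1; ring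
  have e1 : th1 a u = (I * k) * (qPoch (nome a ^ 2) y *
      qPoch (nome a ^ 2) ((nome a : ℂ) ^ 2 * y⁻¹)) := by
    rw [th1_eq_prod ha, thProd, qPoch_eq_mul p0 p1 y, hk, Complex.sin, ← hy,
      show -u * I = -(I * u) by ring, show u * I = I * u by ring, ← yu]
    push_cast
    ring
  have e2 : th2 a u = k * (qPoch (nome a ^ 2) (-y) *
      qPoch (nome a ^ 2) (-((nome a : ℂ) ^ 2 * y⁻¹))) := by
    rw [th2_eq_prod ha, thProd, qPoch_eq_mul p0 p1 (-y), hk, Complex.cos, ← hy,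
      show -u * I = -(I * u) by ring, show u * I = I * u by ring, ← yu]
    push_cast
    ring_nf
  have n1 := norm_ne_zero_iff.2 (qPoch_ne_zero_of_norm_lt p0 p1 ny)
  have n2 := norm_ne_zero_iff.2 (qPoch_ne_zero_of_norm_lt p0 p1 ny')
  have n3 := norm_ne_zero_iff.2 (qPoch_ne_zero_of_norm_lt p0 p1 (X := -y) (by rwa [norm_neg]))
  have n4 := norm_ne_zero_iff.2 (qPoch_ne_zero_of_norm_lt p0 p1
    (X := -((nome a : ℂ) ^ 2 * y⁻¹)) (by rwa [norm_neg]))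
  rw [logRatio, e1, e2, qLog, qLog]
  simp only [norm_mul, norm_I, one_mul]
  rw [Real.log_div (mul_ne_zero (norm_ne_zero_iff.2 hk0) (mul_ne_zero n1 n2))
    (mul_ne_zero (norm_ne_zero_iff.2 hk0) (mul_ne_zero n3 n4)), Real.log_mul (norm_ne_zero_iff.2 hk0) (mul_ne_zero n1 n2),
    Real.log_mul (norm_ne_zero_iff.2 hk0) (mul_ne_zero n3 n4), Real.log_mul n1 n2,
    Real.log_mul n3 n4]
  ring

/-- The terms of the Fourier expansion of `logRatio` along a vertical line. -/
def logTerm (a r : ℝ) (n : ℕ) (s : ℝ) : ℝ :=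
  -(oddCoeff n / (1 - (nome a ^ 2) ^ n) * Real.cos (2 * n * r)) *
    (Real.exp (-(2 * n * s)) + Real.exp (-(2 * n * (Real.pi * a - s))))

lemma exp_pow_re (x y : ℝ) (n : ℕ) :
    (cexp (x + y * I) ^ n).re = Real.exp (n * x) * Real.cos (n * y) := by
  rw [← Complex.exp_nat_mul, Complex.exp_re]
  simp

lemma hasSum_logTerm {a : ℝ} (ha : 0 < a) (r : ℝ) {s : ℝ} (h0 : 0 < s) (h1 : s < Real.pi * a) :
    HasSum (fun n => logTerm a r n s) (logRatio a (r + s * I)) := by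
  have p0 := nome_sq_pos a
  have p1 := nome_sq_lt_one ha
  have i1 : ((r : ℂ) + s * I).im = s := by simp
  have e1 : cexp (2 * I * (r + s * I)) = cexp ((-(2 * s) : ℝ) + (2 * r : ℝ) * I) := by
    congr 1; push_cast; linear_combination (2 * s : ℂ) * I_sq
  have e2 : (nome a : ℂ) ^ 2 * (cexp (2 * I * (r + s * I)))⁻¹ =
      cexp ((-(2 * (Real.pi * a - s)) : ℝ) + (-(2 * r) : ℝ) * I) := by
    rw [ofReal_nome, ← Complex.exp_neg, ← Complex.exp_nat_mul, ← Complex.exp_add]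
    congr 1; push_cast; linear_combination (-2 * s : ℂ) * I_sq
  rw [logRatio_eq ha (by rwa [i1]) (by rwa [i1]), e2, e1, qLog_eq_neg_series p0 p1,
    qLog_eq_neg_series p0 p1]
  · have h := (hasSum_qLogSeries p0 p1 (X := cexp ((-(2 * s) : ℝ) + (2 * r : ℝ) * I)) ?_).neg.add
      (hasSum_qLogSeries p0 p1
        (X := cexp ((-(2 * (Real.pi * a - s)) : ℝ) + (-(2 * r) : ℝ) * I)) ?_).neg
    · refine h.congr_fun fun n => ?_
      rw [exp_pow_re, exp_pow_re, logTerm,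
        show (n : ℝ) * -(2 * r) = -(n * (2 * r)) by ring, Real.cos_neg,
        show 2 * (n : ℝ) * r = n * (2 * r) by ring,
        show -(2 * (n : ℝ) * s) = n * -(2 * s) by ring,
        show -(2 * (n : ℝ) * (Real.pi * a - s)) = n * -(2 * (Real.pi * a - s)) by ring]
      ring
    · rw [Complex.norm_exp]; simpa using h0
    · rw [Complex.norm_exp]; simpa using h1
  · rw [Complex.norm_exp]; simpa using h1
  · rw [Complex.norm_exp]; simpa using h0

lemma nome_sq_pow (a : ℝ) (n : ℕ) : (nome a ^ 2) ^ n = Real.exp (-(2 * n * (Real.pi * a))) := by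
  rw [nome, ← Real.exp_nat_mul, ← Real.exp_nat_mul]
  congr 1
  push_cast
  ring

lemma integral_exp_add_exp (T : ℝ) {k : ℝ} (hk : k ≠ 0) :
    ∫ s in (0 : ℝ)..T, (Real.exp (-(2 * k * s)) + Real.exp (-(2 * k * (T - s)))) =
      (1 - Real.exp (-(2 * k * T))) / k := by
  have hd : ∀ s ∈ Set.uIcc 0 T, HasDerivAt (fun s => (-Real.exp (-(2 * k * s)) +
      Real.exp (-(2 * k * (T - s)))) / (2 * k))
      (Real.exp (-(2 * k * s)) + Real.exp (-(2 * k * (T - s)))) s := by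
    intro s _
    have d1 : HasDerivAt (fun s : ℝ => -(2 * k * s)) (-(2 * k * 1)) s :=
      ((hasDerivAt_id s).const_mul (2 * k)).neg
    have d2 : HasDerivAt (fun s : ℝ => -(2 * k * (T - s))) (-(2 * k * (-1))) s :=
      (((hasDerivAt_id s).const_sub T).const_mul (2 * k)).neg
    refine ((d1.exp.neg.add d2.exp).div_const (2 * k)).congr_deriv ?_
    field_simp
  rw [intervalIntegral.integral_eq_sub_of_hasDerivAt hd (by
    apply Continuous.intervalIntegrable; fun_prop)]
  simp
  field_simp
  ring

/-- Integration over the full period produces the factor `1 - q^(2n)`, which cancels the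
denominator; the result no longer depends on `a`. -/
lemma integral_logTerm {a : ℝ} (ha : 0 < a) (r : ℝ) (n : ℕ) :
    ∫ s in (0 : ℝ)..(Real.pi * a), logTerm a r n s = -(oddCoeff n / n * Real.cos (2 * n * r)) := by
  rcases n with _ | n
  · simp [logTerm, oddCoeff_zero]
  have hn : ((n + 1 : ℕ) : ℝ) ≠ 0 := by positivity
  have hpn : (nome a ^ 2) ^ (n + 1) < 1 :=
    pow_lt_one₀ (nome_sq_pos a).le (nome_sq_lt_one ha) (by omega)
  have hne : 1 - (nome a ^ 2) ^ (n + 1) ≠ 0 := by linarith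
  unfold logTerm
  rw [intervalIntegral.integral_const_mul, integral_exp_add_exp _ hn, ← nome_sq_pow]
  field_simp

/-- Summable L¹ norms justify termwise integration up to the ends of the period, although for `r =
0` the function has a logarithmic singularity there. -/
lemma integral_norm_logTerm_le {a : ℝ} (ha : 0 < a) (r : ℝ) (n : ℕ) :
    ∫ s in (0 : ℝ)..(Real.pi * a), ‖logTerm a r n s‖ ≤ 2 * (1 / (n : ℝ) ^ 2) := by
  rcases n with _ | n
  · simp [logTerm, oddCoeff_zero]
  have hn : (0 : ℝ) < ((n + 1 : ℕ) : ℝ) := by positivity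
  have hpn : (nome a ^ 2) ^ (n + 1) < 1 :=
    pow_lt_one₀ (nome_sq_pos a).le (nome_sq_lt_one ha) (by omega)
  have hne : 0 < 1 - (nome a ^ 2) ^ (n + 1) := by linarith
  have e : ∀ s, ‖logTerm a r (n + 1) s‖ = |oddCoeff (n + 1)| / (1 - (nome a ^ 2) ^ (n + 1)) *
      |Real.cos (2 * ((n + 1 : ℕ) : ℝ) * r)| * (Real.exp (-(2 * ((n + 1 : ℕ) : ℝ) * s)) +
        Real.exp (-(2 * ((n + 1 : ℕ) : ℝ) * (Real.pi * a - s)))) := fun s => by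
    rw [logTerm, norm_mul, norm_neg, norm_mul, norm_div, Real.norm_eq_abs, Real.norm_eq_abs,
      Real.norm_eq_abs, Real.norm_eq_abs, abs_of_pos hne, abs_of_pos (a := _ + _) (by positivity)]
  simp_rw [e]
  rw [intervalIntegral.integral_const_mul, integral_exp_add_exp _ hn.ne', ← nome_sq_pow]
  have h1 := abs_oddCoeff_le (n + 1)
  have h2 := Real.abs_cos_le_one (2 * ((n + 1 : ℕ) : ℝ) * r)
  calc _ = |oddCoeff (n + 1)| * |Real.cos (2 * ((n + 1 : ℕ) : ℝ) * r)| / ((n + 1 : ℕ) : ℝ) := by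
        field_simp
    _ ≤ (2 / ((n + 1 : ℕ) : ℝ)) * 1 / ((n + 1 : ℕ) : ℝ) := by gcongr
    _ = _ := by field_simp

lemma integrable_of_hasSum {α : Type*} [MeasurableSpace α] {μ : Measure α} {F : ℕ → α → ℝ}
    {f : α → ℝ} (hF : ∀ n, Integrable (F n) μ) (hs : Summable fun n => ∫ x, ‖F n x‖ ∂μ)
    (h : ∀ᵐ x ∂μ, HasSum (fun n => F n x) (f x)) : Integrable f μ := by
  have hm : AEStronglyMeasurable f μ := by
    refine aestronglyMeasurable_of_tendsto_ae atTop
      (f := fun n x => ∑ k ∈ Finset.range n, F k x) (fun n => ?_) ?_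
    · exact Finset.aestronglyMeasurable_fun_sum _ fun k _ => (hF k).1
    · filter_upwards [h] with x hx using hx.tendsto_sum_nat
  refine ⟨hm, ?_⟩
  have h1 : ∫⁻ x, ‖f x‖ₑ ∂μ ≤ ∫⁻ x, ∑' n, ‖F n x‖ₑ ∂μ := by
    refine lintegral_mono_ae ?_
    filter_upwards [h] with x hx
    rw [← hx.tsum_eq]
    exact enorm_tsum_le_tsum_enorm
  refine lt_of_le_of_lt h1 ?_
  rw [lintegral_tsum fun n => (hF n).1.enorm]
  have e : ∀ n, ∫⁻ x, ‖F n x‖ₑ ∂μ = ENNReal.ofReal (∫ x, ‖F n x‖ ∂μ) := fun n => by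
    rw [ofReal_integral_norm_eq_lintegral_enorm (hF n)]
  simp_rw [e]
  exact hs.tsum_ofReal_lt_top

lemma summable_integral_norm_logTerm {a : ℝ} (ha : 0 < a) (r : ℝ) :
    Summable fun n : ℕ => ∫ s in (0 : ℝ)..(Real.pi * a), ‖logTerm a r n s‖ := by
  have hT : 0 ≤ Real.pi * a := (mul_pos Real.pi_pos ha).le
  refine Summable.of_nonneg_of_le (fun n => ?_) (integral_norm_logTerm_le ha r)
    ((Real.summable_one_div_nat_pow.2 one_lt_two).mul_left 2)
  exact intervalIntegral.integral_nonneg hT fun s _ => norm_nonneg _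

lemma continuous_logTerm (a r : ℝ) (n : ℕ) : Continuous (logTerm a r n) := by
  unfold logTerm
  fun_prop

lemma intervalIntegrable_logRatio_and_hasSum {a : ℝ} (ha : 0 < a) (r : ℝ) :
    IntervalIntegrable (fun s : ℝ => logRatio a (r + s * I)) volume 0 (Real.pi * a) ∧
    HasSum (fun n : ℕ => -(oddCoeff n / n * Real.cos (2 * n * r)))
      (∫ s in (0 : ℝ)..(Real.pi * a), logRatio a (r + s * I)) := by
  have hT : 0 ≤ Real.pi * a := (mul_pos Real.pi_pos ha).le
  have hF : ∀ n, Integrable (logTerm a r n) (volume.restrict (Set.Ioo 0 (Real.pi * a))) := fun n =>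
    ((continuous_logTerm a r n).intervalIntegrable 0 (Real.pi * a)).1.mono_set Set.Ioo_subset_Ioc_self
  have hs := summable_integral_norm_logTerm ha r
  simp_rw [intervalIntegral.integral_of_le hT, integral_Ioc_eq_integral_Ioo] at hs
  have hae : ∀ᵐ s ∂(volume.restrict (Set.Ioo 0 (Real.pi * a))),
      HasSum (fun n => logTerm a r n s) (logRatio a (r + s * I)) := by
    filter_upwards [ae_restrict_mem measurableSet_Ioo] with s hs
    exact hasSum_logTerm ha r hs.1 hs.2
  constructor
  · rw [intervalIntegrable_iff_integrableOn_Ioo_of_le hT]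
    exact integrable_of_hasSum hF hs hae
  · have h := hasSum_integral_of_summable_integral_norm hF hs
    rw [intervalIntegral.integral_of_le hT, integral_Ioc_eq_integral_Ioo,
      ← integral_congr_ae (hae.mono fun s hs => hs.tsum_eq)]
    refine h.congr_fun fun n => ?_
    rw [← integral_logTerm ha r n, intervalIntegral.integral_of_le hT, integral_Ioc_eq_integral_Ioo]

lemma eval_bernoulli_two (x : ℝ) :
    (Polynomial.map (algebraMap ℚ ℝ) (Polynomial.bernoulli 2)).eval x = x ^ 2 - x + 1 / 6 := by
  have : Polynomial.bernoulli 2 = Polynomial.X ^ 2 - Polynomial.X + Polynomial.C (1 / 6 : ℚ) := by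
    rw [Polynomial.bernoulli, Finset.sum_range_succ, Finset.sum_range_succ, Finset.sum_range_one]
    have b1 : bernoulli 1 = -1 / 2 := by rw [bernoulli_one]
    have b2 : bernoulli 2 = 1 / 6 := by
      rw [bernoulli_eq_bernoulli'_of_ne_one (by norm_num), bernoulli'_two]
    rw [b1, b2, bernoulli_zero]
    simp only [← Polynomial.C_mul_X_pow_eq_monomial]
    norm_num
    ring
  rw [this]
  simp

lemma hasSum_cos_div_sq {x : ℝ} (hx : x ∈ Set.Icc (0 : ℝ) 1) :
    HasSum (fun n : ℕ => 1 / (n : ℝ) ^ 2 * Real.cos (2 * Real.pi * n * x))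
      (Real.pi ^ 2 * (x ^ 2 - x + 1 / 6)) := by
  have h := hasSum_one_div_nat_pow_mul_cos one_ne_zero hx
  rw [mul_one, eval_bernoulli_two] at h
  convert h using 1
  rw [show (Nat.factorial 2 : ℝ) = 2 by norm_num [Nat.factorial]]
  ring

/-- The integral of `log |θ₁ / θ₂|` over a vertical period. -/
lemma integral_logRatio {a : ℝ} (ha : 0 < a) {r : ℝ} (h0 : 0 ≤ r) (h1 : r ≤ Real.pi / 2) :
    ∫ s in (0 : ℝ)..(Real.pi * a), logRatio a (r + s * I) = Real.pi * (r - Real.pi / 4) := by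
  have hp := Real.pi_pos
  have hx1 : r / Real.pi ∈ Set.Icc (0 : ℝ) 1 := by
    refine ⟨by positivity, ?_⟩
    rw [div_le_one hp]; linarith
  have hx2 : r / Real.pi + 1 / 2 ∈ Set.Icc (0 : ℝ) 1 := by
    refine ⟨by positivity, ?_⟩
    have : r / Real.pi ≤ 1 / 2 := by rw [div_le_iff₀ hp]; linarith
    linarith
  have h := ((hasSum_cos_div_sq hx1).sub (hasSum_cos_div_sq hx2)).neg
  have h2 := (intervalIntegrable_logRatio_and_hasSum ha r).2
  -- The coefficient is `(1 - (-1)ⁿ)/n²`; absorbing the sign into a shift by half a period leaves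
  -- the Fourier series of the second Bernoulli polynomial at `r/π` and at `r/π + 1/2`. The
  -- quadratic terms cancel in the difference.
  have e : ∀ n : ℕ, -(oddCoeff n / n * Real.cos (2 * n * r)) =
      -(1 / (n : ℝ) ^ 2 * Real.cos (2 * Real.pi * n * (r / Real.pi)) -
      1 / (n : ℝ) ^ 2 * Real.cos (2 * Real.pi * n * (r / Real.pi + 1 / 2))) := fun n => by
    have e1 : 2 * Real.pi * n * (r / Real.pi) = 2 * n * r := by field_simp
    have e2 : 2 * Real.pi * n * (r / Real.pi + 1 / 2) = 2 * n * r + n * Real.pi := by field_simp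
    rw [e1, e2, Real.cos_add_nat_mul_pi, oddCoeff, div_div, ← sq]
    ring
  simp_rw [e] at h2
  rw [h2.unique h]
  field_simp
  ring

lemma logRatio_periodic (a : ℝ) (r : ℝ) :
    Function.Periodic (fun s : ℝ => logRatio a (r + s * I)) (Real.pi * a) := by
  intro s
  have e : (r : ℂ) + ((s + Real.pi * a : ℝ) : ℂ) * I = (r + s * I) + Real.pi * a * I := by
    push_cast; ring
  have t1 := th2_add_tau a (r + s * I - Real.pi / 2)
  have e1 : th1 a (r + s * I + Real.pi * a * I) =
      -(cexp (Real.pi * a - 2 * I * (r + s * I)) * th1 a (r + s * I)) := by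
    rw [th1, show (r : ℂ) + s * I + Real.pi * a * I - Real.pi / 2 =
      r + s * I - Real.pi / 2 + Real.pi * a * I by ring, t1, ← th1,
      show (Real.pi * a - 2 * I * (r + s * I - Real.pi / 2) : ℂ) =
        Real.pi * a - 2 * I * (r + s * I) + Real.pi * I by ring, Complex.exp_add,
      Complex.exp_pi_mul_I]
    ring
  have hc : ‖cexp (Real.pi * a - 2 * I * (r + s * I))‖ ≠ 0 :=
    norm_ne_zero_iff.2 (Complex.exp_ne_zero _)
  simp only [logRatio]
  rw [e, e1, th2_add_tau, norm_neg, norm_mul, norm_mul, mul_div_mul_left _ _ hc]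

lemma intervalIntegrable_logRatio {a : ℝ} (ha : 0 < a) (r b c : ℝ) :
    IntervalIntegrable (fun s : ℝ => logRatio a (r + s * I)) volume b c :=
  (logRatio_periodic a r).intervalIntegrable₀ (mul_pos Real.pi_pos ha).ne'
    (intervalIntegrable_logRatio_and_hasSum ha r).1 b c

/-- As `s` runs over half a period, `u + is` and `u - is` together sweep one full vertical period
centred at `u`, so only the real part of `u` matters. -/
lemma integral_logRatio_symm {a : ℝ} (ha : 0 < a) (u : ℂ) (h0 : 0 ≤ u.re) (h1 : u.re ≤ Real.pi / 2) :
    IntervalIntegrable (fun s : ℝ => logRatio a (u + s * I) + logRatio a (u - s * I)) volume 0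
      (Real.pi * a / 2) ∧
    ∫ s in (0 : ℝ)..(Real.pi * a / 2), (logRatio a (u + s * I) + logRatio a (u - s * I)) =
      Real.pi * (u.re - Real.pi / 4) := by
  have hI := intervalIntegrable_logRatio ha u.re
  have eu : ∀ s : ℝ, u + s * I = u.re + ((u.im + s : ℝ) : ℂ) * I := fun s => by
    conv_lhs => rw [← re_add_im u]
    push_cast; ring
  have eu' : ∀ s : ℝ, u - s * I = u.re + ((u.im - s : ℝ) : ℂ) * I := fun s => by
    conv_lhs => rw [← re_add_im u]
    push_cast; ring
  simp_rw [eu, eu']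
  have i1 : IntervalIntegrable (fun s : ℝ => logRatio a (u.re + ((u.im + s : ℝ) : ℂ) * I)) volume 0
      (Real.pi * a / 2) := by
    simpa using (hI (u.im + 0) (u.im + Real.pi * a / 2)).comp_add_left u.im
  have i2 : IntervalIntegrable (fun s : ℝ => logRatio a (u.re + ((u.im - s : ℝ) : ℂ) * I)) volume 0
      (Real.pi * a / 2) := by
    simpa using (hI (u.im - 0) (u.im - Real.pi * a / 2)).comp_sub_left u.im
  refine ⟨i1.add i2, ?_⟩
  rw [intervalIntegral.integral_add i1 i2,
    intervalIntegral.integral_comp_add_left (fun s : ℝ => logRatio a (u.re + (s : ℂ) * I)),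
    intervalIntegral.integral_comp_sub_left (fun s : ℝ => logRatio a (u.re + (s : ℂ) * I)),
    add_comm, add_zero, sub_zero, intervalIntegral.integral_add_adjacent_intervals (hI _ _) (hI _ _)]
  have := (logRatio_periodic a u.re).intervalIntegral_add_eq (u.im - Real.pi * a / 2) 0
  rw [show u.im - Real.pi * a / 2 + Real.pi * a = u.im + Real.pi * a / 2 by ring, zero_add,
    integral_logRatio ha h0 h1] at this
  exact this

/-! ### The field of the layered measure. -/

/-- The derivative of the logarithmic potential of the equilibrium measure, up to a constant. -/
def potDeriv (a w x : ℝ) : ℝ :=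
  ∫ s in (0 : ℝ)..(Real.pi * a / 2), (Real.log (x - xL a w s) - Real.log (x - xR a w s))

lemma ae_ne_of_injOn {f : ℝ → ℝ} {b : ℝ} (hf : Set.InjOn f (Set.Icc 0 b)) (x : ℝ) :
    ∀ᵐ s ∂(volume : Measure ℝ), s ∈ Set.Icc 0 b → f s ≠ x := by
  have : Set.Subsingleton {s | ¬(s ∈ Set.Icc 0 b → f s ≠ x)} := by
    intro s hs t ht
    simp only [Set.mem_ofPred_eq, Classical.not_imp, not_not] at hs ht
    exact hf hs.1 ht.1 (hs.2.trans ht.2.symm)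
  exact this.measure_zero _

/-- Apply `confMap_sub` with `v` on the left edge and on the right edge at the same height. In the
quotient the Wronskian and the denominator at `u` cancel, and the shift by `π/2` turns `θ₁` into
`θ₂`. -/
lemma log_sub_log_eq {a w : ℝ} (ha : 0 < a) (hw0 : 0 < w) (hw1 : w < Real.pi / 2) {x : ℝ} {u : ℂ}
    (hD : confDen a w u ≠ 0) (hu : confMap a w u = x) {s : ℝ}
    (hs : s ∈ Set.Icc 0 (Real.pi * a / 2)) (hL : xL a w s ≠ x) (hR : xR a w s ≠ x) :
    Real.log (x - xL a w s) - Real.log (x - xR a w s) =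
      (logRatio a (u + s * I) + logRatio a (u - s * I)) -
      (logRatio a (w + s * I) + logRatio a (w - s * I)) := by
  have hs' := abs_lt_of_mem_Icc ha hs
  have dL := confDen_left ha hw0 hw1 hs'
  have dR := confDen_right ha hw0 hw1 hs'
  have eL := confMap_sub ha w hD dL
  have eR := confMap_sub ha w hD dR
  have e2 : th1 a (u - (Real.pi / 2 + s * I)) = -th2 a (u - s * I) := by
    have := th2_add_pi a (u - s * I - Real.pi)
    rw [sub_add_cancel] at this
    rw [this, neg_neg, th1]
    congr 1
    ring
  rw [show u + (Real.pi / 2 + s * I) = u + s * I + Real.pi / 2 by ring, th1_add_pi_div_two, e2,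
    confDen_right_eq, hu, ← ofReal_xR, ← ofReal_sub] at eR
  rw [hu, ← ofReal_xL, ← ofReal_sub, show confDen a w (s * I) = th1 a (w + s * I) * th1 a (w - s * I) from rfl] at eL
  rw [confDen_right_eq] at dR
  have nL : ((x - xL a w s : ℝ) : ℂ) ≠ 0 := by exact_mod_cast sub_ne_zero.2 hL.symm
  have nR : ((x - xR a w s : ℝ) : ℂ) ≠ 0 := by exact_mod_cast sub_ne_zero.2 hR.symm
  have nL' := nL
  have nR' := nR
  rw [eL] at nL'
  rw [eR] at nR'
  have hc := left_ne_zero_of_mul (div_ne_zero_iff.1 nL').1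
  have hc' := right_ne_zero_of_mul hc
  have hu1 := right_ne_zero_of_mul (div_ne_zero_iff.1 nL').1
  have hu2 := right_ne_zero_of_mul (div_ne_zero_iff.1 nR').1
  have hw1' : th1 a (w + s * I) * th1 a (w - s * I) ≠ 0 := dL
  have hw2' := neg_ne_zero.1 dR
  have u1 := left_ne_zero_of_mul hu1
  have u2 := right_ne_zero_of_mul hu1
  have u3 := left_ne_zero_of_mul hu2
  have u4 := neg_ne_zero.1 (right_ne_zero_of_mul hu2)
  have w1 := left_ne_zero_of_mul hw1'
  have w2 := right_ne_zero_of_mul hw1'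
  have w3 := left_ne_zero_of_mul hw2'
  have w4 := right_ne_zero_of_mul hw2'
  have rat : ((x - xL a w s : ℝ) : ℂ) / ((x - xR a w s : ℝ) : ℂ) =
      (th1 a (u + s * I) / th2 a (u + s * I)) * (th1 a (u - s * I) / th2 a (u - s * I)) /
      ((th1 a (w + s * I) / th2 a (w + s * I)) * (th1 a (w - s * I) / th2 a (w - s * I))) := by
    rw [eL, eR]
    field_simp
  have rat2 := congrArg norm rat
  rw [norm_div, norm_div, norm_mul, norm_mul, norm_div, norm_div, norm_div, norm_div,
    Complex.norm_real, Complex.norm_real, Real.norm_eq_abs, Real.norm_eq_abs] at rat2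
  have rat3 := congrArg Real.log rat2
  have n := fun {z : ℂ} (hz : z ≠ 0) => norm_ne_zero_iff.2 hz
  rw [Real.log_div (abs_ne_zero.2 (by exact_mod_cast nL)) (abs_ne_zero.2 (by exact_mod_cast nR)),
    Real.log_abs, Real.log_abs, Real.log_div
      (mul_ne_zero (div_ne_zero (n u1) (n u3)) (div_ne_zero (n u2) (n u4)))
      (mul_ne_zero (div_ne_zero (n w1) (n w3)) (div_ne_zero (n w2) (n w4))),
    Real.log_mul (div_ne_zero (n u1) (n u3)) (div_ne_zero (n u2) (n u4)),
    Real.log_mul (div_ne_zero (n w1) (n w3)) (div_ne_zero (n w2) (n w4))] at rat3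
  rw [rat3]
  rfl

/-- Integrating the previous identity over `s`, the two terms are affine in `Re u` and in `w` with
the same constant. The heights where a logarithm is singular form a null set. -/
lemma potDeriv_eq {a w : ℝ} (ha : 0 < a) (hw0 : 0 < w) (hw1 : w < Real.pi / 2) {x : ℝ} {u : ℂ}
    (hD : confDen a w u ≠ 0) (hu : confMap a w u = x) (h0 : 0 ≤ u.re) (h1 : u.re ≤ Real.pi / 2) :
    potDeriv a w x = Real.pi * (u.re - w) := by
  have hh : 0 ≤ Real.pi * a / 2 := by have := mul_pos Real.pi_pos ha; linarith
  obtain ⟨i1, e1⟩ := integral_logRatio_symm ha u h0 h1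
  obtain ⟨i2, e2⟩ := integral_logRatio_symm ha (w : ℂ) (by simpa using hw0.le) (by simpa using hw1.le)
  have : potDeriv a w x = ∫ s in (0 : ℝ)..(Real.pi * a / 2),
      ((logRatio a (u + s * I) + logRatio a (u - s * I)) -
      (logRatio a (w + s * I) + logRatio a (w - s * I))) := by
    refine intervalIntegral.integral_congr_ae ?_
    filter_upwards [ae_ne_of_injOn (injOn_xL ha hw0 hw1) x, ae_ne_of_injOn (injOn_xR ha hw0 hw1) x]
      with s hL hR hs
    rw [Set.uIoc_of_le hh] at hs
    have hs' := Set.Ioc_subset_Icc_self hs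
    exact log_sub_log_eq ha hw0 hw1 hD hu hs' (hL hs') (hR hs')
  rw [this, intervalIntegral.integral_sub i1 i2, e1, e2, ofReal_re]
  ring

/-- The map increases strictly along the upper edge from `α'` to `β'` and has mean zero there, so it
must start below zero; for the same reason it ends above zero. -/
lemma endα'_neg {a w : ℝ} (ha : 0 < a) (hw0 : 0 < w) (hw1 : w < Real.pi / 2) : endα' a w < 0 := by
  by_contra h
  push Not at h
  have hp := Real.pi_pos
  have := intervalIntegral.intervalIntegral_pos_of_pos_on (f := xS a w) (a := 0) (b := Real.pi / 2)
    ((continuous_xS ha w).intervalIntegrable _ _) (fun r hr => ?_) (by linarith)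
  · rw [integral_xS ha] at this; exact lt_irrefl _ this
  · refine h.trans_lt ?_
    rw [← xS_zero ha hw0 hw1]
    exact strictMonoOn_xS ha hw0 hw1 ⟨le_rfl, by linarith⟩ ⟨hr.1.le, hr.2.le⟩ hr.1

lemma endβ'_pos {a w : ℝ} (ha : 0 < a) (hw0 : 0 < w) (hw1 : w < Real.pi / 2) : 0 < endβ' a w := by
  by_contra h
  push Not at h
  have hp := Real.pi_pos
  have := intervalIntegral.intervalIntegral_pos_of_pos_on (f := fun r => -xS a w r) (a := 0)
    (b := Real.pi / 2) ((continuous_xS ha w).neg.intervalIntegrable _ _) (fun r hr => ?_)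
    (by linarith)
  · rw [intervalIntegral.integral_neg, integral_xS ha, neg_zero] at this; exact lt_irrefl _ this
  · refine neg_pos.2 (lt_of_lt_of_le ?_ h)
    rw [← xS_pi_div_two ha hw0 hw1]
    exact strictMonoOn_xS ha hw0 hw1 ⟨hr.1.le, hr.2.le⟩ ⟨by linarith, le_rfl⟩ hr.2

/-! ### The lower edge, its pole, and the points outside the support. -/

/-- The numerator of the uniformizing map as a function of the uniformizing variable. -/
def confNum (a w : ℝ) (u : ℂ) : ℂ := mapNum a w (thA a u) (thB a u)

lemma confMap_eq_div {a : ℝ} (ha : 0 < a) (w : ℝ) (u : ℂ) :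
    confMap a w u = -(Real.pi / 2) * (confNum a w u / confDen a w u) := by
  rw [confMap, mapHom, mapDen_eq_confDen ha, confNum]

lemma confDen_ofReal {a : ℝ} (ha : 0 < a) (w r : ℝ) :
    confDen a w r = ((theta1 (nome a) (w + r) * theta1 (nome a) (w - r) : ℝ) : ℂ) := by
  rw [confDen, ofReal_mul, ofReal_theta1 ha, ofReal_theta1 ha]
  push_cast
  rfl

lemma ofReal_re_confNum (a w r : ℝ) : ((confNum a w r).re : ℂ) = confNum a w r := by
  refine Complex.conj_eq_iff_re.1 ?_
  have hA := conj_deriv_of_conj (conj_thA a) w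
  have hB := conj_deriv_of_conj (conj_thB a) w
  simp only [confNum, mapNum, map_mul, map_sub, hA, hB, conj_thA, conj_thB, conj_ofReal]

lemma confNum_self {a : ℝ} (ha : 0 < a) (w : ℝ) : confNum a w w = mapWronsk a w := by
  have := wronskian_eq ha w
  rw [confNum, mapNum]
  linear_combination -this

lemma mapWronsk_re_pos {a w : ℝ} (ha : 0 < a) (hw0 : 0 < w) (hw1 : w < Real.pi / 2) :
    0 < (mapWronsk a w).re := by
  rw [mapWronsk, ← ofReal_theta1 ha, ← ofReal_theta2 ha, ← ofReal_theta3 ha, ← ofReal_theta4 ha]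
  norm_cast
  have p1 := theta1_pos ha hw0 (by linarith)
  have p2 := theta2_pos ha (by linarith) hw1
  have p3 := theta3_pos ha w
  have p4 := theta4_pos ha w
  positivity

lemma continuous_confNum_re {a : ℝ} (ha : 0 < a) (w : ℝ) :
    Continuous fun r : ℝ => (confNum a w r).re := by
  have hA := (differentiable_thA ha).continuous
  have hB := (differentiable_thB ha).continuous
  have : Continuous fun r : ℝ => confNum a w r := by unfold confNum mapNum; fun_prop
  exact Complex.continuous_re.comp this

lemma continuous_theta1 {a : ℝ} (ha : 0 < a) : Continuous (theta1 (nome a)) :=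
  continuous_iff_continuousAt.2 fun x =>
    (hasDerivAt_of_ofReal_eq (differentiable_th1 ha) (ofReal_theta1 ha) x).1.continuousAt

lemma theta1_neg (q x : ℝ) : theta1 q (-x) = -theta1 q x := by
  simp [theta1, tsum_neg]

/-- The real equation `confMap = x` with denominators cleared. -/
def clearedEq (a w x r : ℝ) : ℝ :=
  x * (theta1 (nome a) (w + r) * theta1 (nome a) (w - r)) + Real.pi / 2 * (confNum a w r).re

lemma continuous_clearedEq {a : ℝ} (ha : 0 < a) (w x : ℝ) : Continuous (clearedEq a w x) := by
  have h1 := continuous_theta1 ha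
  have h2 := continuous_confNum_re ha w
  unfold clearedEq
  fun_prop

lemma confMap_eq_of_clearedEq {a : ℝ} (ha : 0 < a) {w x r : ℝ} (hD : confDen a w r ≠ 0)
    (h : clearedEq a w x r = 0) : confMap a w r = x := by
  rw [confMap_eq_div ha, ← ofReal_re_confNum]
  rw [clearedEq, ← ofReal_inj] at h
  rw [confDen_ofReal ha] at hD ⊢
  generalize theta1 (nome a) (w + r) * theta1 (nome a) (w - r) = d at *
  push_cast at h
  field_simp
  linear_combination -2 * h

lemma clearedEq_eq {a : ℝ} (ha : 0 < a) {w x y r : ℝ} (hD : confDen a w r ≠ 0)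
    (h : confMap a w r = y) :
    clearedEq a w x r = (x - y) * (theta1 (nome a) (w + r) * theta1 (nome a) (w - r)) := by
  rw [confMap_eq_div ha, ← ofReal_re_confNum] at h
  rw [clearedEq, ← ofReal_inj]
  rw [confDen_ofReal ha] at hD h
  generalize theta1 (nome a) (w + r) * theta1 (nome a) (w - r) = d at *
  push_cast
  rw [← h]
  field_simp
  ring

lemma clearedEq_self {a w : ℝ} (ha : 0 < a) (hw0 : 0 < w) (hw1 : w < Real.pi / 2) (x : ℝ) :
    0 < clearedEq a w x w := by
  have h0 : theta1 (nome a) 0 = 0 := by simp [theta1]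
  rw [clearedEq, sub_self, h0, confNum_self ha]
  have := mapWronsk_re_pos ha hw0 hw1
  have := Real.pi_pos
  simp
  positivity

lemma confMap_zero_eq {a w : ℝ} (ha : 0 < a) (hw0 : 0 < w) (hw1 : w < Real.pi / 2) :
    confMap a w (0 : ℝ) = endα a w := by
  rw [ofReal_zero, ← xL_zero ha hw0 hw1, ofReal_xL, ofReal_zero, zero_mul]

lemma confMap_pi_div_two_eq {a w : ℝ} (ha : 0 < a) (hw0 : 0 < w) (hw1 : w < Real.pi / 2) :
    confMap a w (Real.pi / 2 : ℝ) = endβ a w := by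
  rw [← xR_zero ha hw0 hw1, ofReal_xR, ofReal_zero, zero_mul, add_zero]
  push_cast
  rfl

/-- Clearing denominators removes the pole: the cleared equation is positive at `w`, where it equals
`π/2` times the numerator, and negative at `0`, so it has a zero in between. -/
lemma exists_confMap_eq_of_lt {a w : ℝ} (ha : 0 < a) (hw0 : 0 < w) (hw1 : w < Real.pi / 2) {x : ℝ}
    (hx : x < endα a w) : ∃ r : ℝ, 0 < r ∧ r < w ∧ confDen a w r ≠ 0 ∧ confMap a w r = x := by
  have hden : ∀ r : ℝ, 0 ≤ r → r < w → 0 < theta1 (nome a) (w + r) * theta1 (nome a) (w - r) :=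
    fun r h0 h1 => mul_pos (theta1_pos ha (by linarith) (by linarith))
      (theta1_pos ha (by linarith) (by linarith))
  have hden' : ∀ r : ℝ, 0 ≤ r → r < w → confDen a w r ≠ 0 := fun r h0 h1 => by
    rw [confDen_ofReal ha]; exact_mod_cast (hden r h0 h1).ne'
  have e0 := clearedEq_eq ha (x := x) (hden' 0 le_rfl hw0) (confMap_zero_eq ha hw0 hw1)
  have h0 : clearedEq a w x 0 < 0 := by
    rw [e0]
    exact mul_neg_of_neg_of_pos (by linarith) (hden 0 le_rfl hw0)
  obtain ⟨r, hr, h⟩ := intermediate_value_Ioo hw0.le (continuous_clearedEq ha w x).continuousOn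
    ⟨h0, clearedEq_self ha hw0 hw1 x⟩
  have := hden' r hr.1.le hr.2
  exact ⟨r, hr.1, hr.2, this, confMap_eq_of_clearedEq ha this h⟩

lemma confDen_neg_of_gt {a w : ℝ} (ha : 0 < a) (hw0 : 0 < w) {r : ℝ}
    (h0 : w < r) (h1 : r ≤ Real.pi / 2) :
    theta1 (nome a) (w + r) * theta1 (nome a) (w - r) < 0 := by
  refine mul_neg_of_pos_of_neg (theta1_pos ha (by linarith) (by linarith)) ?_
  rw [← neg_sub r w, theta1_neg]
  exact neg_neg_of_pos (theta1_pos ha (by linarith) (by linarith))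

lemma confDen_ne_zero_of_gt {a w : ℝ} (ha : 0 < a) (hw0 : 0 < w) {r : ℝ}
    (h0 : w < r) (h1 : r ≤ Real.pi / 2) : confDen a w r ≠ 0 := by
  rw [confDen_ofReal ha]
  exact_mod_cast (confDen_neg_of_gt ha hw0 h0 h1).ne

lemma exists_confMap_eq_of_gt {a w : ℝ} (ha : 0 < a) (hw0 : 0 < w) (hw1 : w < Real.pi / 2) {x : ℝ}
    (hx : endβ a w < x) :
    ∃ r : ℝ, w < r ∧ r < Real.pi / 2 ∧ confDen a w r ≠ 0 ∧ confMap a w r = x := by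
  have e0 := clearedEq_eq ha (x := x) (confDen_ne_zero_of_gt ha hw0 hw1 le_rfl)
    (confMap_pi_div_two_eq ha hw0 hw1)
  have h0 : clearedEq a w x (Real.pi / 2) < 0 := by
    rw [e0]
    exact mul_neg_of_pos_of_neg (by linarith) (confDen_neg_of_gt ha hw0 hw1 le_rfl)
  obtain ⟨r, hr, h⟩ := intermediate_value_Ioo' hw1.le (continuous_clearedEq ha w x).continuousOn
    ⟨h0, clearedEq_self ha hw0 hw1 x⟩
  have := confDen_ne_zero_of_gt ha hw0 hr.1 hr.2.le
  exact ⟨r, hr.1, hr.2, this, confMap_eq_of_clearedEq ha this h⟩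

/-- At `w` the numerator equals the Wronskian product and the denominator has minus that product as
derivative, so the simple pole has residue `π/2`. This residue is what determines the total mass. -/
lemma tendsto_confMap_mul {a w : ℝ} (ha : 0 < a) (hw0 : 0 < w) (hw1 : w < Real.pi / 2) :
    Tendsto (fun r : ℝ => (confMap a w r).re * (r - w)) (𝓝[>] w) (𝓝 (Real.pi / 2)) := by
  have hW := mapWronsk_ne_zero ha hw0 hw1
  have hd : HasDerivAt (fun u : ℂ => confDen a w u) (-mapWronsk a w) w := by
    have e2 := (((differentiable_thB ha w).hasDerivAt.const_mul (thA a w)).sub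
      ((differentiable_thA ha w).hasDerivAt.const_mul (thB a w)))
    rw [wronskian_eq ha] at e2
    refine e2.congr_of_eventuallyEq (Eventually.of_forall fun u => ?_)
    exact (mapDen_eq_confDen ha w u).symm
  rw [hasDerivAt_iff_tendsto_slope] at hd
  have hr : Tendsto (fun r : ℝ => (r : ℂ)) (𝓝[>] w) (𝓝[≠] (w : ℂ)) := by
    refine tendsto_nhdsWithin_iff.2 ⟨(Complex.continuous_ofReal.tendsto w).mono_left
      nhdsWithin_le_nhds, ?_⟩
    filter_upwards [self_mem_nhdsWithin] with r hr
    simpa using (ne_of_gt hr : r ≠ w)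
  have hn : Tendsto (fun r : ℝ => confNum a w r) (𝓝[>] w) (𝓝 (mapWronsk a w)) := by
    rw [← confNum_self ha]
    have hA := (differentiable_thA ha).continuous
    have hB := (differentiable_thB ha).continuous
    have : Continuous fun r : ℝ => confNum a w r := by unfold confNum mapNum; fun_prop
    exact (this.tendsto w).mono_left nhdsWithin_le_nhds
  have key := ((hn.div (hd.comp hr) (neg_ne_zero.2 hW)).const_mul (-(Real.pi / 2 : ℂ)))
  have e : (-(Real.pi / 2 : ℂ)) * (mapWronsk a w / -mapWronsk a w) = (Real.pi / 2 : ℝ) := by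
    push_cast; field_simp
  rw [e] at key
  have key2 := (Complex.continuous_re.tendsto _).comp key
  rw [ofReal_re] at key2
  refine key2.congr' ?_
  filter_upwards [self_mem_nhdsWithin] with r hr
  have hz : confDen a w w = 0 := by
    rw [confDen, sub_self, th1_eq_prod ha 0]; simp
  have : ((r : ℂ) - w) ≠ 0 := by
    rw [← ofReal_sub]; exact_mod_cast (sub_pos.2 hr).ne'
  simp only [Function.comp, Pi.div_apply, slope, vsub_eq_sub, hz, sub_zero, smul_eq_mul]
  rw [← re_mul_ofReal, confMap_eq_div ha]
  congr 1
  push_cast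
  field_simp

/-! ### Measures with bounded density -/

/-- The bound extends from open to half-open intervals by a limit; Lebesgue outer measure is the
largest outer measure dominated by the lengths of half-open intervals, so the bound holds for all
sets. -/
lemma IsAdmissible.le_smul_volume {γ : ℝ} {ν : Measure ℝ} (hν : IsAdmissible γ ν) (hγ : 0 < γ) :
    ν ≤ ENNReal.ofReal (1 / (2 * γ)) • (volume : Measure ℝ) := by
  set c := ENNReal.ofReal (1 / (2 * γ)) with hc
  have hγ2 : 0 < 1 / (2 * γ) := by positivity
  have hc0 : c ≠ 0 := by simpa [hc] using hγ
  have hIoo : ∀ x y : ℝ, ν (Set.Ioo x y) ≤ c * ENNReal.ofReal (y - x) := by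
    intro x y
    rcases lt_or_ge x y with h | h
    · refine (hν.le_of_lt x y h).trans_eq ?_
      rw [hc, ← ENNReal.ofReal_mul hγ2.le]
      congr 1
      ring
    · simp [Set.Ioo_eq_empty (not_lt.2 h)]
  have hIoc : ∀ x y : ℝ, ν (Set.Ioc x y) ≤ c * ENNReal.ofReal (y - x) := by
    intro x y
    have ht : Tendsto (fun z : ℝ => c * ENNReal.ofReal (z - x)) (𝓝[>] y)
        (𝓝 (c * ENNReal.ofReal (y - x))) := by
      refine ENNReal.Tendsto.const_mul ?_ (Or.inr ENNReal.ofReal_ne_top)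
      refine ENNReal.tendsto_ofReal (Tendsto.mono_left ?_ nhdsWithin_le_nhds)
      exact (continuous_id.sub continuous_const).tendsto y
    refine ge_of_tendsto ht ?_
    filter_upwards [self_mem_nhdsWithin] with z hz
    exact (measure_mono (t := Set.Ioo x z) fun u hu => ⟨hu.1, lt_of_le_of_lt hu.2 hz⟩).trans
      (hIoo x z)
  have hbot : (botSet : Set ℝ) = ∅ :=
    Set.eq_empty_of_forall_notMem fun x hx => not_isBot x hx
  rw [← Measure.toOuterMeasure_le, Measure.smul_toOuterMeasure, Real.volume_eq_stieltjes_id,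
    StieltjesFunction.measure]
  change ν.toOuterMeasure ≤ c • StieltjesFunction.id.outer
  rw [StieltjesFunction.outer, OuterMeasure.smul_ofFunction ENNReal.ofReal_ne_top,
    OuterMeasure.le_ofFunction]
  intro s
  rw [Pi.smul_apply, smul_eq_mul, StieltjesFunction.length_eq, hbot, Set.sdiff_empty,
    ENNReal.mul_iInf_of_ne hc0 ENNReal.ofReal_ne_top]
  refine le_iInf fun x => ?_
  rw [ENNReal.mul_iInf_of_ne hc0 ENNReal.ofReal_ne_top]
  refine le_iInf fun y => ?_
  rw [ENNReal.mul_iInf_of_ne hc0 ENNReal.ofReal_ne_top]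
  refine le_iInf fun h => ?_
  exact (measure_mono h).trans (hIoc x y)

lemma lintegral_log_sub_le {ν : Measure ℝ} {c : ENNReal} (hν : ν ≤ c • (volume : Measure ℝ))
    (x : ℝ) : ∫⁻ y, ‖(Set.Ioo (-1 : ℝ) 1).indicator Real.log (x - y)‖ₑ ∂ν ≤
      c * ∫⁻ y, ‖(Set.Ioo (-1 : ℝ) 1).indicator Real.log y‖ₑ := by
  refine (lintegral_mono' hν le_rfl).trans_eq ?_
  rw [lintegral_smul_measure, smul_eq_mul,
    lintegral_sub_left_eq_self (fun y => ‖(Set.Ioo (-1 : ℝ) 1).indicator Real.log y‖ₑ) x]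

lemma integrable_indicator_log :
    Integrable ((Set.Ioo (-1 : ℝ) 1).indicator Real.log) := by
  rw [integrable_indicator_iff measurableSet_Ioo]
  have h := intervalIntegral.intervalIntegrable_log' (a := -1) (b := 1)
  rw [intervalIntegrable_iff_integrableOn_Ioc_of_le (by norm_num)] at h
  exact h.mono_set Set.Ioo_subset_Ioc_self

lemma abs_log_le (t : ℝ) :
    |Real.log t| ≤ |t| + |(Set.Ioo (-1 : ℝ) 1).indicator Real.log t| := by
  by_cases ht : t ∈ Set.Ioo (-1 : ℝ) 1
  · rw [Set.indicator_of_mem ht]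
    linarith [abs_nonneg t]
  · rw [Set.indicator_of_notMem ht, abs_zero, add_zero, ← Real.log_abs]
    have h1 : 1 ≤ |t| := by
      by_contra h
      exact ht (abs_lt.1 (not_le.1 h))
    rw [abs_of_nonneg (Real.log_nonneg h1)]
    linarith [Real.log_le_sub_one_of_pos (by linarith : 0 < |t|)]

/-- By `abs_log_le` the logarithm is at most linear growth plus a singular part near `0`, and the
bounded density of `ν` controls the integral of the latter uniformly in the first variable. The map
`f` is the identity for energies and an end-point function when Fubini is applied to the layers. -/
lemma integrable_log_sub_prod {Ω : Type*} [MeasurableSpace Ω] {μ : Measure Ω} [IsFiniteMeasure μ]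
    {f : Ω → ℝ} (hf : Measurable f) (hfi : Integrable f μ) {ν : Measure ℝ} [IsFiniteMeasure ν]
    {c : ENNReal} (hc : c ≠ ⊤) (hν : ν ≤ c • (volume : Measure ℝ))
    (hm : Integrable (fun y : ℝ => y) ν) :
    Integrable (fun p : Ω × ℝ => Real.log (f p.1 - p.2)) (μ.prod ν) := by
  have hmeas : Measurable (fun p : Ω × ℝ => f p.1 - p.2) := by fun_prop
  have hind : Measurable ((Set.Ioo (-1 : ℝ) 1).indicator Real.log) :=
    Real.measurable_log.indicator measurableSet_Ioo
  have h1 : Integrable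
      (fun p : Ω × ℝ => (Set.Ioo (-1 : ℝ) 1).indicator Real.log (f p.1 - p.2)) (μ.prod ν) := by
    refine ⟨(hind.comp hmeas).aestronglyMeasurable, ?_⟩
    have hae : AEMeasurable (fun p : Ω × ℝ =>
        ‖(Set.Ioo (-1 : ℝ) 1).indicator Real.log (f p.1 - p.2)‖ₑ) (μ.prod ν) :=
      (hind.comp hmeas).enorm.aemeasurable
    rw [HasFiniteIntegral, lintegral_prod _ hae]
    refine (lintegral_mono fun ω => lintegral_log_sub_le hν (f ω)).trans_lt ?_
    rw [lintegral_const]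
    exact ENNReal.mul_lt_top (ENNReal.mul_lt_top hc.lt_top integrable_indicator_log.2)
      (measure_lt_top _ _)
  refine (((hfi.comp_fst ν).sub (hm.comp_snd μ)).abs.add h1.abs).mono'
    (Real.measurable_log.comp hmeas).aestronglyMeasurable (.of_forall fun p => ?_)
  exact abs_log_le _

/-! ### Positivity of the logarithmic energy -/

/-- The kernel whose integral over `s > 0` is `log |t|`. -/
def frullaniKernel (s t : ℝ) : ℝ := (2 * s)⁻¹ * (Real.exp (-s) - Real.exp (-(s * t ^ 2)))

lemma frullaniKernel_eq (s t : ℝ) : frullaniKernel s t =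
    2⁻¹ * (s⁻¹ * (Real.exp (-(1 * s)) - Real.exp (-(t ^ 2 * s)))) := by
  rw [frullaniKernel, mul_inv, one_mul, mul_comm s (t ^ 2)]
  ring

lemma abs_exp_neg_sub_exp_neg_le {p q s : ℝ} (hs : 0 < s) :
    |Real.exp (-(p * s)) - Real.exp (-(q * s))| ≤
      s * (|q - p| * Real.exp (-(min p q * s))) := by
  wlog h : p ≤ q generalizing p q
  · rw [abs_sub_comm, abs_sub_comm q p, min_comm]
    exact this (le_of_not_ge h)
  rw [min_eq_left h, abs_of_nonneg (sub_nonneg.2 h), abs_of_nonneg]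
  · have h1 := Real.add_one_le_exp (-((q - p) * s))
    have h2 : Real.exp (-(q * s)) = Real.exp (-(p * s)) * Real.exp (-((q - p) * s)) := by
      rw [← Real.exp_add]
      congr 1
      ring
    rw [h2]
    nlinarith [Real.exp_pos (-(p * s))]
  · rw [sub_nonneg, Real.exp_le_exp]
    nlinarith

lemma integrableOn_frullaniKernel {t : ℝ} (ht : t ≠ 0) :
    IntegrableOn (fun s => frullaniKernel s t) (Set.Ioi 0) := by
  have hm : 0 < min 1 (t ^ 2) := lt_min one_pos (by positivity)
  have hintg : IntegrableOn (fun s => |t ^ 2 - 1| * Real.exp (-(min 1 (t ^ 2) * s))) (Set.Ioi 0) := by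
    have h := (exp_neg_integrableOn_Ioi 0 hm).const_mul (|t ^ 2 - 1|)
    simp only [neg_mul] at h
    exact h
  refine Integrable.mono' (g := fun s => |t ^ 2 - 1| * Real.exp (-(min 1 (t ^ 2) * s))) hintg ?_ ?_
  · refine Measurable.aestronglyMeasurable ?_
    unfold frullaniKernel
    fun_prop
  · filter_upwards [ae_restrict_mem measurableSet_Ioi] with s hs
    have hs : 0 < s := hs
    rw [frullaniKernel_eq, Real.norm_eq_abs, abs_mul, abs_mul, abs_of_pos (inv_pos.2 hs),
      abs_of_pos (by norm_num : (0 : ℝ) < 2⁻¹)]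
    have h := abs_exp_neg_sub_exp_neg_le (p := 1) (q := t ^ 2) hs
    have h2 : s⁻¹ * |Real.exp (-(1 * s)) - Real.exp (-(t ^ 2 * s))| ≤
        |t ^ 2 - 1| * Real.exp (-(min 1 (t ^ 2) * s)) := by
      rw [inv_mul_le_iff₀ hs]
      exact h
    have h0 : 0 ≤ |t ^ 2 - 1| * Real.exp (-(min 1 (t ^ 2) * s)) := by positivity
    linarith

lemma integral_frullaniKernel {t : ℝ} (ht : t ≠ 0) :
    ∫ s in Set.Ioi 0, frullaniKernel s t = Real.log t := by
  have h := Frullani.integral_Ioi_eq (f := fun s : ℝ => Real.exp (-s)) (a := 1) (b := t ^ 2)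
    (L := 1) (R := 0) ?_ one_pos (by positivity) ?_ ?_ ?_
  · simp_rw [frullaniKernel_eq]
    rw [integral_const_mul]
    simp only [smul_eq_mul] at h
    rw [h, div_one, Real.log_pow]
    push_cast
    ring
  · exact (by fun_prop : Continuous fun s : ℝ => Real.exp (-s)).locallyIntegrable.locallyIntegrableOn _
  · have h0 : Tendsto (fun s : ℝ => Real.exp (-s)) (𝓝 0) (𝓝 (Real.exp (-0))) :=
      (by fun_prop : Continuous fun s : ℝ => Real.exp (-s)).tendsto 0
    rw [neg_zero, Real.exp_zero] at h0
    exact h0.mono_left nhdsWithin_le_nhds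
  · exact Real.tendsto_exp_neg_atTop_nhds_zero
  · have h := (integrableOn_frullaniKernel ht).const_mul 2
    refine h.congr (.of_forall fun s => ?_)
    simp only [frullaniKernel_eq, smul_eq_mul]
    ring

/-- For fixed `t` the kernel does not change sign in `s`, so its L¹ norm is the absolute value of
its integral; this gives the integrability for Fubini in the energy. -/
lemma integral_norm_frullaniKernel {t : ℝ} (ht : t ≠ 0) :
    ∫ s in Set.Ioi 0, ‖frullaniKernel s t‖ = |Real.log t| := by
  rcases le_total 1 (t ^ 2) with h | h
  · have h1 : ∀ s ∈ Set.Ioi (0 : ℝ), ‖frullaniKernel s t‖ = frullaniKernel s t := by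
      intro s hs
      have hs : 0 < s := hs
      rw [Real.norm_eq_abs, abs_of_nonneg]
      refine mul_nonneg (by positivity) (sub_nonneg.2 (Real.exp_le_exp.2 ?_))
      nlinarith
    rw [setIntegral_congr_fun measurableSet_Ioi h1, integral_frullaniKernel ht, ← Real.log_abs,
      abs_of_nonneg (Real.log_nonneg ?_)]
    rwa [← one_le_sq_iff_one_le_abs]
  · have h1 : ∀ s ∈ Set.Ioi (0 : ℝ), ‖frullaniKernel s t‖ = -frullaniKernel s t := by
      intro s hs
      have hs : 0 < s := hs
      rw [Real.norm_eq_abs, abs_of_nonpos]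
      refine mul_nonpos_of_nonneg_of_nonpos (by positivity) (sub_nonpos.2 (Real.exp_le_exp.2 ?_))
      nlinarith
    rw [setIntegral_congr_fun measurableSet_Ioi h1, integral_neg, integral_frullaniKernel ht,
      ← Real.log_abs, abs_of_nonpos (Real.log_nonpos (abs_nonneg t) ?_)]
    rwa [← sq_le_one_iff_abs_le_one]

lemma ae_prod_sub_ne_zero (μ ν : Measure ℝ) [SFinite μ] [SFinite ν] [NullSingletonClass ν] :
    ∀ᵐ p ∂(μ.prod ν), p.1 - p.2 ≠ 0 := by
  have hms : MeasurableSet {p : ℝ × ℝ | p.1 - p.2 ≠ 0} :=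
    (measurable_fst.sub measurable_snd) (measurableSet_singleton (0 : ℝ)).compl
  rw [Measure.ae_prod_iff_ae_ae hms]
  refine .of_forall fun x => ?_
  have : ∀ᵐ y ∂ν, y ≠ x := by simp [ae_iff]
  filter_upwards [this] with y hy
  exact sub_ne_zero.2 (Ne.symm hy)

lemma measurable_frullaniKernel :
    Measurable (fun z : (ℝ × ℝ) × ℝ => frullaniKernel z.2 (z.1.1 - z.1.2)) := by
  unfold frullaniKernel
  fun_prop

lemma integrable_frullaniKernel {μ ν : Measure ℝ} [IsFiniteMeasure μ] [IsFiniteMeasure ν]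
    [NullSingletonClass ν] (h : Integrable (fun p : ℝ × ℝ => Real.log (p.1 - p.2)) (μ.prod ν)) :
    Integrable (fun z : (ℝ × ℝ) × ℝ => frullaniKernel z.2 (z.1.1 - z.1.2))
      ((μ.prod ν).prod (volume.restrict (Set.Ioi 0))) := by
  rw [integrable_prod_iff measurable_frullaniKernel.aestronglyMeasurable]
  refine ⟨?_, ?_⟩
  · filter_upwards [ae_prod_sub_ne_zero μ ν] with p hp
    exact integrableOn_frullaniKernel hp
  · refine h.abs.congr ?_
    filter_upwards [ae_prod_sub_ne_zero μ ν] with p hp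
    exact (integral_norm_frullaniKernel hp).symm

/-- The energy of a pair of measures for the Gaussian kernel. -/
def gaussEnergy (s : ℝ) (μ ν : Measure ℝ) : ℝ :=
  ∫ p, Real.exp (-(s * (p.1 - p.2) ^ 2)) ∂(μ.prod ν)

lemma integral_frullaniKernel_prod {μ ν : Measure ℝ} [IsProbabilityMeasure μ]
    [IsProbabilityMeasure ν] {s : ℝ} (hs : 0 < s) :
    ∫ p : ℝ × ℝ, frullaniKernel s (p.1 - p.2) ∂(μ.prod ν) =
      (2 * s)⁻¹ * (Real.exp (-s) - gaussEnergy s μ ν) := by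
  have h1 : Integrable (fun p : ℝ × ℝ => Real.exp (-(s * (p.1 - p.2) ^ 2))) (μ.prod ν) := by
    refine Integrable.of_bound (C := 1) (Measurable.aestronglyMeasurable (by fun_prop))
      (.of_forall fun p => ?_)
    rw [Real.norm_eq_abs, Real.abs_exp, Real.exp_le_one_iff, neg_nonpos]
    positivity
  unfold frullaniKernel
  rw [integral_const_mul, integral_sub (integrable_const _) h1]
  simp [gaussEnergy]

lemma integrableOn_gaussEnergy {μ ν : Measure ℝ} [IsProbabilityMeasure μ]
    [IsProbabilityMeasure ν] [NullSingletonClass ν]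
    (h : Integrable (fun p : ℝ × ℝ => Real.log (p.1 - p.2)) (μ.prod ν)) :
    IntegrableOn (fun s => (2 * s)⁻¹ * (Real.exp (-s) - gaussEnergy s μ ν)) (Set.Ioi 0) := by
  refine (integrable_frullaniKernel h).integral_prod_right.congr ?_
  filter_upwards [ae_restrict_mem measurableSet_Ioi] with s hs
  exact integral_frullaniKernel_prod hs

lemma integral_log_sub_prod {μ ν : Measure ℝ} [IsProbabilityMeasure μ]
    [IsProbabilityMeasure ν] [NullSingletonClass ν]
    (h : Integrable (fun p : ℝ × ℝ => Real.log (p.1 - p.2)) (μ.prod ν)) :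
    ∫ p, Real.log (p.1 - p.2) ∂(μ.prod ν) =
      ∫ s in Set.Ioi 0, (2 * s)⁻¹ * (Real.exp (-s) - gaussEnergy s μ ν) := by
  have h1 : ∫ p, Real.log (p.1 - p.2) ∂(μ.prod ν) =
      ∫ p : ℝ × ℝ, (∫ s in Set.Ioi 0, frullaniKernel s (p.1 - p.2)) ∂(μ.prod ν) := by
    refine integral_congr_ae ?_
    filter_upwards [ae_prod_sub_ne_zero μ ν] with p hp
    exact (integral_frullaniKernel hp).symm
  rw [h1, integral_integral_swap (integrable_frullaniKernel h)]
  exact setIntegral_congr_fun measurableSet_Ioi fun s hs => integral_frullaniKernel_prod hs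

lemma integral_sub_sub_add {X E : Type*} [MeasurableSpace X] {μ : Measure X}
    [NormedAddCommGroup E] [NormedSpace ℝ E] {f g h k : X → E} (hf : Integrable f μ)
    (hg : Integrable g μ) (hh : Integrable h μ) (hk : Integrable k μ) :
    ∫ x, (f x - g x - h x + k x) ∂μ = ∫ x, f x ∂μ - ∫ x, g x ∂μ - ∫ x, h x ∂μ + ∫ x, k x ∂μ := by
  rw [← integral_sub' hf hg, ← integral_sub' (hf.sub hg) hh,
    ← integral_add' ((hf.sub hg).sub hh) hk]
  rfl

-- The kernel `exp (-s x²)` is the characteristic function of the centred Gaussian of variance `2s`,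
-- hence the choice of variance.
open ProbabilityTheory in
lemma ofReal_gaussEnergy (μ ν : Measure ℝ) [IsProbabilityMeasure μ] [IsProbabilityMeasure ν]
    {s : ℝ} (hs : 0 < s) : (gaussEnergy s μ ν : ℂ) =
      ∫ τ, charFun μ τ * (starRingEnd ℂ) (charFun ν τ) ∂(gaussianReal 0 (2 * s).toNNReal) := by
  set N := gaussianReal 0 (2 * s).toNNReal with hN
  have h1 : ∀ p : ℝ × ℝ, ((Real.exp (-(s * (p.1 - p.2) ^ 2)) : ℝ) : ℂ) =
      ∫ τ, Complex.exp ((p.1 - p.2 : ℝ) * τ * I) ∂N := by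
    intro p
    rw [← charFun_apply_real, hN, charFun_gaussianReal, Real.coe_toNNReal _ (by linarith)]
    push_cast
    congr 1
    ring
  have hintg : Integrable (fun z : (ℝ × ℝ) × ℝ => Complex.exp ((z.1.1 - z.1.2 : ℝ) * z.2 * I))
      ((μ.prod ν).prod N) := by
    refine Integrable.of_bound (C := 1) (Measurable.aestronglyMeasurable (by fun_prop))
      (.of_forall fun z => ?_)
    rw [← ofReal_mul, norm_exp_ofReal_mul_I]
  rw [gaussEnergy, ← integral_complex_ofReal, integral_congr_ae (.of_forall h1),
    integral_integral_swap hintg]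
  refine integral_congr_ae (.of_forall fun τ => ?_)
  simp only
  rw [← charFun_neg, charFun_apply_real, charFun_apply_real, ← integral_prod_mul]
  refine integral_congr_ae (.of_forall fun p => ?_)
  simp only
  rw [← Complex.exp_add]
  congr 1
  push_cast
  ring

open ProbabilityTheory in
lemma gaussEnergy_defect (μ ν : Measure ℝ) [IsProbabilityMeasure μ] [IsProbabilityMeasure ν]
    {s : ℝ} (hs : 0 < s) :
    gaussEnergy s μ μ - gaussEnergy s μ ν - gaussEnergy s ν μ + gaussEnergy s ν ν =
      ∫ τ, ‖charFun μ τ - charFun ν τ‖ ^ 2 ∂(gaussianReal 0 (2 * s).toNNReal) := by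
  set N := gaussianReal 0 (2 * s).toNNReal with hN
  have hintg : ∀ (μ ν : Measure ℝ) [IsProbabilityMeasure μ] [IsProbabilityMeasure ν],
      Integrable (fun τ => charFun μ τ * (starRingEnd ℂ) (charFun ν τ)) N := by
    intro μ ν _ _
    refine Integrable.of_bound (C := 1) (Measurable.aestronglyMeasurable ?_) (.of_forall fun τ => ?_)
    · exact measurable_charFun.mul (continuous_conj.measurable.comp measurable_charFun)
    · rw [norm_mul, RCLike.norm_conj]
      exact mul_le_one₀ (norm_charFun_le_one τ) (norm_nonneg _) (norm_charFun_le_one τ)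
  apply Complex.ofReal_injective
  have h1 : ∀ τ, ((‖charFun μ τ - charFun ν τ‖ ^ 2 : ℝ) : ℂ) =
      charFun μ τ * (starRingEnd ℂ) (charFun μ τ) - charFun μ τ * (starRingEnd ℂ) (charFun ν τ) -
        charFun ν τ * (starRingEnd ℂ) (charFun μ τ) +
        charFun ν τ * (starRingEnd ℂ) (charFun ν τ) := by
    intro τ
    rw [ofReal_pow, ← Complex.mul_conj', map_sub]
    ring
  rw [← integral_complex_ofReal, integral_congr_ae (.of_forall h1),
    integral_sub_sub_add (hintg μ μ) (hintg μ ν) (hintg ν μ) (hintg ν ν)]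
  push_cast
  rw [ofReal_gaussEnergy μ μ hs, ofReal_gaussEnergy μ ν hs, ofReal_gaussEnergy ν μ hs,
    ofReal_gaussEnergy ν ν hs]

-- A single `s` suffices: the Gaussian has full support and characteristic functions are continuous,
-- so equality almost everywhere is equality everywhere.
open ProbabilityTheory in
lemma eq_of_gaussEnergy_defect_eq_zero (μ ν : Measure ℝ) [IsProbabilityMeasure μ]
    [IsProbabilityMeasure ν] {s : ℝ} (hs : 0 < s)
    (h : gaussEnergy s μ μ - gaussEnergy s μ ν - gaussEnergy s ν μ + gaussEnergy s ν ν = 0) :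
    μ = ν := by
  have hv : (2 * s).toNNReal ≠ 0 := by simpa using hs
  rw [gaussEnergy_defect μ ν hs, integral_eq_zero_iff_of_nonneg (fun τ => by positivity)] at h
  · have h2 : (fun τ => ‖charFun μ τ - charFun ν τ‖ ^ 2) =ᵐ[volume] 0 :=
      (gaussianReal_absolutelyContinuous' 0 hv).ae_le h
    have h3 := (Continuous.ae_eq_iff_eq volume ((continuous_charFun.sub continuous_charFun).norm.pow 2)
      continuous_zero).1 h2
    refine Measure.ext_of_charFun (funext fun τ => ?_)
    have h4 := congrFun h3 τ
    simpa [sub_eq_zero] using h4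
  · refine Integrable.of_bound (C := 2 ^ 2) (Measurable.aestronglyMeasurable ?_)
      (.of_forall fun τ => ?_)
    · exact (measurable_charFun.sub measurable_charFun).norm.pow_const 2
    · rw [norm_pow, norm_norm]
      gcongr
      exact (norm_sub_le _ _).trans
        (by linarith [norm_charFun_le_one (μ := μ) τ, norm_charFun_le_one (μ := ν) τ])

section LogEnergy

variable {μ ν : Measure ℝ} [IsProbabilityMeasure μ] [IsProbabilityMeasure ν] [NullSingletonClass μ]
  [NullSingletonClass ν]

/-- The bilinear logarithmic energy. -/
def logEnergy (μ ν : Measure ℝ) : ℝ := ∫ p, Real.log (p.1 - p.2) ∂(μ.prod ν)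

/-- In the signed combination the terms `e^{-s}` of Frullani's formula cancel, and what remains is
an integral over `s > 0` of nonnegative Gaussian defects. -/
lemma logEnergy_defect
    (h11 : Integrable (fun p : ℝ × ℝ => Real.log (p.1 - p.2)) (μ.prod μ))
    (h12 : Integrable (fun p : ℝ × ℝ => Real.log (p.1 - p.2)) (μ.prod ν))
    (h21 : Integrable (fun p : ℝ × ℝ => Real.log (p.1 - p.2)) (ν.prod μ))
    (h22 : Integrable (fun p : ℝ × ℝ => Real.log (p.1 - p.2)) (ν.prod ν)) :
    0 ≤ -logEnergy μ μ + logEnergy μ ν + logEnergy ν μ - logEnergy ν ν ∧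
      (-logEnergy μ μ + logEnergy μ ν + logEnergy ν μ - logEnergy ν ν = 0 → μ = ν) := by
  set G : ℝ → ℝ := fun s => (2 * s)⁻¹ *
    (gaussEnergy s μ μ - gaussEnergy s μ ν - gaussEnergy s ν μ + gaussEnergy s ν ν) with hG
  have i11 := integrableOn_gaussEnergy h11
  have i12 := integrableOn_gaussEnergy h12
  have i21 := integrableOn_gaussEnergy h21
  have i22 := integrableOn_gaussEnergy h22
  have hintg : IntegrableOn G (Set.Ioi 0) := by
    refine (((i11.neg.add i12).add i21).sub i22).congr (.of_forall fun s => ?_)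
    simp only [hG, Pi.sub_apply, Pi.add_apply, Pi.neg_apply]
    ring
  have key : -logEnergy μ μ + logEnergy μ ν + logEnergy ν μ - logEnergy ν ν =
      ∫ s in Set.Ioi 0, G s := by
    unfold logEnergy
    rw [integral_log_sub_prod h11, integral_log_sub_prod h12, integral_log_sub_prod h21,
      integral_log_sub_prod h22]
    have hG' : ∀ s, G s = -((2 * s)⁻¹ * (Real.exp (-s) - gaussEnergy s μ μ) -
        (2 * s)⁻¹ * (Real.exp (-s) - gaussEnergy s μ ν) -
        (2 * s)⁻¹ * (Real.exp (-s) - gaussEnergy s ν μ) +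
        (2 * s)⁻¹ * (Real.exp (-s) - gaussEnergy s ν ν)) := by
      intro s
      simp only [hG]
      ring
    rw [integral_congr_ae (.of_forall hG'), integral_neg, integral_sub_sub_add i11 i12 i21 i22]
    ring
  have hpos : ∀ s ∈ Set.Ioi (0 : ℝ), 0 ≤ G s := by
    intro s hs
    have hs : 0 < s := hs
    simp only [hG]
    rw [gaussEnergy_defect μ ν hs]
    positivity
  rw [key]
  refine ⟨setIntegral_nonneg measurableSet_Ioi hpos, fun h0 => ?_⟩
  rw [setIntegral_eq_zero_iff_of_nonneg_ae ((ae_restrict_iff' measurableSet_Ioi).2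
    (.of_forall hpos)) hintg] at h0
  have : NeBot (ae (volume.restrict (Set.Ioi (0 : ℝ)))) := by
    rw [ae_restrict_neBot]
    simp
  obtain ⟨s, hs0, hs⟩ := (h0.and (ae_restrict_mem measurableSet_Ioi)).exists
  have hs : 0 < s := hs
  refine eq_of_gaussEnergy_defect_eq_zero μ ν hs ?_
  have : (2 * s)⁻¹ ≠ 0 := by positivity
  exact (mul_eq_zero.1 hs0).resolve_left this

end LogEnergy

/-! ### The variational criterion for the constrained minimizer -/

lemma integrable_id_of_potential {ζ : ℝ} (hζ : |ζ| < 1) {ν : Measure ℝ}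
    (h : Integrable (potential ζ) ν) : Integrable (fun x : ℝ => x) ν := by
  refine (h.const_mul (1 - |ζ|)⁻¹).mono' measurable_id.aestronglyMeasurable
    (.of_forall fun x => ?_)
  have h1 : 0 < 1 - |ζ| := by linarith
  rw [Real.norm_eq_abs, le_inv_mul_iff₀ h1, potential]
  have h2 : ζ * x ≤ |ζ| * |x| := by
    rw [← abs_mul]
    exact le_abs_self _
  linarith

lemma integrable_potential_of_id {ζ : ℝ} {ν : Measure ℝ}
    (h : Integrable (fun x : ℝ => x) ν) : Integrable (potential ζ) ν :=
  h.abs.sub (h.const_mul ζ)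

/-- The logarithmic potential of a measure. -/
def logPot (ν : Measure ℝ) (x : ℝ) : ℝ := ∫ y, Real.log (x - y) ∂ν

/-- The effective potential of a measure in the external field. -/
def effPot (ζ : ℝ) (ν : Measure ℝ) (x : ℝ) : ℝ := potential ζ x - 2 * logPot ν x

/-- The diagonal may be restored because `Real.log 0 = 0`, so the integrand vanishes there. -/
lemma energy_eq {ζ : ℝ} {ν : Measure ℝ} (h : Integrable (potential ζ) ν) :
    energy ζ ν = ((-logEnergy ν ν + ∫ x, potential ζ x ∂ν : ℝ) : EReal) := by
  rw [energy, if_pos h, logEnergy, ← integral_neg]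
  congr 2
  have h1 : ∀ p : ℝ × ℝ, Real.log (1 / |p.1 - p.2|) = -Real.log (p.1 - p.2) := by
    intro p
    rw [one_div, Real.log_inv, Real.log_abs]
  simp_rw [h1]
  refine setIntegral_eq_integral_of_forall_compl_eq_zero fun p hp => ?_
  have : p.1 = p.2 := by simpa using hp
  simp [this]

lemma nullSingletonClass_of_le {ν : Measure ℝ} {c : ENNReal}
    (hν : ν ≤ c • (volume : Measure ℝ)) : NullSingletonClass ν :=
  ⟨fun x => le_antisymm ((hν {x}).trans (by simp)) zero_le⟩

lemma integrable_log_prod_of_le {μ ν : Measure ℝ} [IsFiniteMeasure μ] [IsFiniteMeasure ν]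
    {c : ENNReal} (hc : c ≠ ⊤) (hν : ν ≤ c • (volume : Measure ℝ))
    (hm : Integrable (fun x : ℝ => x) μ) (hn : Integrable (fun x : ℝ => x) ν) :
    Integrable (fun p : ℝ × ℝ => Real.log (p.1 - p.2)) (μ.prod ν) :=
  integrable_log_sub_prod measurable_id hm hc hν hn

lemma logEnergy_comm (μ ν : Measure ℝ) [SFinite μ] [SFinite ν] :
    logEnergy μ ν = logEnergy ν μ := by
  unfold logEnergy
  rw [← integral_prod_swap]
  refine integral_congr_ae (.of_forall fun p => ?_)
  simp only [Prod.fst_swap, Prod.snd_swap]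
  rw [← Real.log_abs, abs_sub_comm, Real.log_abs]

/-- The bathtub principle: on `S` the effective potential is at most `l` and `ν₀` already carries
the largest mass allowed, while off `S` it is at least `l`, with equality where `ν₀` lives. -/
lemma le_integral_effPot {ζ l : ℝ} {c : ENNReal} {ν₀ ν : Measure ℝ}
    [IsProbabilityMeasure ν₀] [IsProbabilityMeasure ν] (hν : ν ≤ c • (volume : Measure ℝ))
    (h0 : Integrable (effPot ζ ν₀) ν₀) (h1 : Integrable (effPot ζ ν₀) ν)
    {S : Set ℝ} (hS : MeasurableSet S) (hsat : ν₀.restrict S = c • volume.restrict S)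
    (hle : ∀ x ∈ S, effPot ζ ν₀ x ≤ l) (hge : ∀ x ∉ S, l ≤ effPot ζ ν₀ x)
    (heq : ∀ᵐ x ∂ν₀, x ∉ S → effPot ζ ν₀ x = l) :
    ∫ x, effPot ζ ν₀ x ∂ν₀ ≤ ∫ x, effPot ζ ν₀ x ∂ν := by
  set f : ℝ → ℝ := fun x => effPot ζ ν₀ x - l with hf
  have e0 : ∫ x, f x ∂ν₀ = ∫ x, effPot ζ ν₀ x ∂ν₀ - l := by
    rw [hf, integral_sub h0 (integrable_const _)]
    simp
  have e1 : ∫ x, f x ∂ν = ∫ x, effPot ζ ν₀ x ∂ν - l := by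
    rw [hf, integral_sub h1 (integrable_const _)]
    simp
  have i0 : Integrable f ν₀ := h0.sub (integrable_const _)
  have i1 : Integrable f ν := h1.sub (integrable_const _)
  have s0 : ∫ x, f x ∂ν₀ = ∫ x in S, f x ∂ν₀ := by
    rw [← integral_add_compl hS i0]
    have : ∫ x in Sᶜ, f x ∂ν₀ = 0 := by
      refine setIntegral_eq_zero_of_ae_eq_zero ?_
      filter_upwards [heq] with x hx hxS
      simp [hf, hx hxS]
    rw [this, add_zero]
  have s1 : ∫ x in S, f x ∂ν ≤ ∫ x, f x ∂ν := by
    rw [← integral_add_compl hS i1]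
    have : 0 ≤ ∫ x in Sᶜ, f x ∂ν :=
      setIntegral_nonneg hS.compl fun x hx => sub_nonneg.2 (hge x hx)
    linarith
  have s2 : ∫ x in S, f x ∂ν₀ ≤ ∫ x in S, f x ∂ν := by
    have hr : ν.restrict S ≤ ν₀.restrict S := by
      rw [hsat, ← Measure.restrict_smul]
      exact Measure.restrict_mono le_rfl hν
    have h := integral_mono_measure (f := fun x => -f x) hr
      ((ae_restrict_iff' hS).2 (.of_forall fun x hx => by
        have := hle x hx
        simp only [Pi.zero_apply, hf]
        linarith)) i0.restrict.neg
    rw [integral_neg, integral_neg] at h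
    linarith
  linarith

theorem isEquilibriumMeasure_of_effPot {γ ζ l : ℝ} (hγ : 0 < γ) (hζ : |ζ| < 1) {ν₀ : Measure ℝ}
    (hν₀ : IsAdmissible γ ν₀) (hm₀ : Integrable (fun x : ℝ => x) ν₀)
    {S : Set ℝ} (hS : MeasurableSet S)
    (hsat : ν₀.restrict S = ENNReal.ofReal (1 / (2 * γ)) • volume.restrict S)
    (hle : ∀ x ∈ S, effPot ζ ν₀ x ≤ l) (hge : ∀ x ∉ S, l ≤ effPot ζ ν₀ x)
    (heq : ∀ᵐ x ∂ν₀, x ∉ S → effPot ζ ν₀ x = l) :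
    IsEquilibriumMeasure γ ζ ν₀ ∧ ∀ ν, IsEquilibriumMeasure γ ζ ν → ν = ν₀ := by
  have hc : ENNReal.ofReal (1 / (2 * γ)) ≠ ⊤ := ENNReal.ofReal_ne_top
  have hP₀ := hν₀.isProbabilityMeasure
  have hle₀ := hν₀.le_smul_volume hγ
  have hn₀ := nullSingletonClass_of_le hle₀
  have hV₀ : Integrable (potential ζ) ν₀ := integrable_potential_of_id hm₀
  have key : ∀ ν, IsAdmissible γ ν → Integrable (potential ζ) ν →
      energy ζ ν₀ ≤ energy ζ ν ∧ (energy ζ ν ≤ energy ζ ν₀ → ν = ν₀) := by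
    intro ν hν hV
    have hP := hν.isProbabilityMeasure
    have hleν := hν.le_smul_volume hγ
    have hn := nullSingletonClass_of_le hleν
    have hm := integrable_id_of_potential hζ hV
    have i11 := integrable_log_prod_of_le hc hleν hm hm
    have i12 := integrable_log_prod_of_le hc hle₀ hm hm₀
    have i21 := integrable_log_prod_of_le hc hleν hm₀ hm
    have i22 := integrable_log_prod_of_le hc hle₀ hm₀ hm₀
    have hD := logEnergy_defect i11 i12 i21 i22
    have j12 : logEnergy ν ν₀ = ∫ x, logPot ν₀ x ∂ν := integral_prod _ i12
    have j22 : logEnergy ν₀ ν₀ = ∫ x, logPot ν₀ x ∂ν₀ := integral_prod _ i22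
    have u1 : Integrable (logPot ν₀) ν := i12.integral_prod_left
    have u2 : Integrable (logPot ν₀) ν₀ := i22.integral_prod_left
    have f1 : ∫ x, effPot ζ ν₀ x ∂ν = ∫ x, potential ζ x ∂ν - 2 * ∫ x, logPot ν₀ x ∂ν := by
      unfold effPot
      rw [integral_sub hV (u1.const_mul 2), integral_const_mul]
    have f2 : ∫ x, effPot ζ ν₀ x ∂ν₀ = ∫ x, potential ζ x ∂ν₀ - 2 * ∫ x, logPot ν₀ x ∂ν₀ := by
      unfold effPot
      rw [integral_sub hV₀ (u2.const_mul 2), integral_const_mul]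
    have hF := le_integral_effPot hleν (hV₀.sub (u2.const_mul 2)) (hV.sub (u1.const_mul 2)) hS
      hsat hle hge heq
    have hcomm := logEnergy_comm ν₀ ν
    rw [energy_eq hV, energy_eq hV₀, EReal.coe_le_coe_iff, EReal.coe_le_coe_iff]
    -- The energy excess of `ν` over `ν₀` is the linear term `∫ F dν - ∫ F dν₀`, with `F` the
    -- effective potential of `ν₀`, plus the quadratic defect `hD`; both are nonnegative, and the
    -- defect vanishes only for `ν = ν₀`.
    exact ⟨by linarith [hD.1], fun h => hD.2 (le_antisymm (by linarith) hD.1)⟩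
  refine ⟨⟨hν₀, fun ν hν => ?_⟩, fun ν hν => ?_⟩
  · by_cases hV : Integrable (potential ζ) ν
    · exact (key ν hν hV).1
    · simp [energy, hV]
  · have hE := hν.energy_le ν₀ hν₀
    have hV : Integrable (potential ζ) ν := by
      by_contra hV
      rw [energy, if_neg hV, energy_eq hV₀, top_le_iff] at hE
      exact EReal.coe_ne_top _ hE
    exact (key ν hν.isAdmissible hV).2 hE

/-! ### Superpositions of uniform measures on a nested family of intervals -/

/-- A nested family of intervals `(L s, R s)`, `s ∈ [0, b]`, with monotone continuous ends. -/
structure NestedIntervals (b : ℝ) (L R : ℝ → ℝ) : Prop where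
  pos : 0 < b
  measL : Measurable L
  measR : Measurable R
  contL : ContinuousOn L (Set.Icc 0 b)
  contR : ContinuousOn R (Set.Icc 0 b)
  monoL : StrictMonoOn L (Set.Icc 0 b)
  antiR : StrictAntiOn R (Set.Icc 0 b)
  lt : L b < R b

/-- The length of the set of `s ∈ [0, b]` with `x ∈ (L s, R s)`. -/
def layerLen (b : ℝ) (L R : ℝ → ℝ) (x : ℝ) : ℝ :=
  ∫ s in (0 : ℝ)..b, (Set.Ioo (L s) (R s)).indicator (fun _ => (1 : ℝ)) x

namespace NestedIntervals

variable {b : ℝ} {L R : ℝ → ℝ}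

lemma zero_mem (h : NestedIntervals b L R) : (0 : ℝ) ∈ Set.Icc 0 b := ⟨le_rfl, h.pos.le⟩

lemma right_mem (h : NestedIntervals b L R) : b ∈ Set.Icc 0 b := ⟨h.pos.le, le_rfl⟩

lemma left_le (h : NestedIntervals b L R) {s : ℝ} (hs : s ∈ Set.Icc 0 b) : L 0 ≤ L s :=
  h.monoL.monotoneOn h.zero_mem hs hs.1

lemma le_left (h : NestedIntervals b L R) {s : ℝ} (hs : s ∈ Set.Icc 0 b) : L s ≤ L b :=
  h.monoL.monotoneOn hs h.right_mem hs.2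

lemma right_le (h : NestedIntervals b L R) {s : ℝ} (hs : s ∈ Set.Icc 0 b) : R s ≤ R 0 :=
  h.antiR.antitoneOn h.zero_mem hs hs.1

lemma le_right (h : NestedIntervals b L R) {s : ℝ} (hs : s ∈ Set.Icc 0 b) : R b ≤ R s :=
  h.antiR.antitoneOn hs h.right_mem hs.2

lemma left_lt_right (h : NestedIntervals b L R) {s : ℝ} (hs : s ∈ Set.Icc 0 b) : L s < R s :=
  ((h.le_left hs).trans_lt h.lt).trans_le (h.le_right hs)

lemma measurableSet (h : NestedIntervals b L R) :
    MeasurableSet {p : ℝ × ℝ | p.2 ∈ Set.Ioo (L p.1) (R p.1)} := by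
  have hL := h.measL
  have hR := h.measR
  exact (measurableSet_lt (hL.comp measurable_fst) measurable_snd).inter
    (measurableSet_lt measurable_snd (hR.comp measurable_fst))

lemma measurable_indicator (h : NestedIntervals b L R) (x : ℝ) :
    Measurable fun s => (Set.Ioo (L s) (R s)).indicator (fun _ => (1 : ℝ)) x := by
  have h1 : MeasurableSet {s | x ∈ Set.Ioo (L s) (R s)} :=
    (measurable_id.prodMk measurable_const : Measurable fun s : ℝ => (s, x)) h.measurableSet
  exact (measurable_const (a := (1 : ℝ))).indicator h1

/-- Dominated convergence: strict monotonicity makes `x` an end of at most two of the intervals, so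
for almost every `s` the indicator is continuous at `x`. -/
lemma continuous_layerLen (h : NestedIntervals b L R) : Continuous (layerLen b L R) := by
  rw [continuous_iff_continuousAt]
  intro x
  refine intervalIntegral.continuousAt_of_dominated_interval (bound := fun _ => 1)
    (.of_forall fun y => (h.measurable_indicator y).aestronglyMeasurable) (.of_forall fun y => ?_)
    intervalIntegrable_const ?_
  · refine .of_forall fun s _ => ?_
    by_cases hy : y ∈ Set.Ioo (L s) (R s) <;> simp [hy]
  · filter_upwards [ae_ne_of_injOn h.monoL.injOn x, ae_ne_of_injOn h.antiR.injOn x] with s h1 h2 hs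
    rw [Set.uIoc_of_le h.pos.le] at hs
    have hs' : s ∈ Set.Icc 0 b := ⟨hs.1.le, hs.2⟩
    have h3 : x ∉ frontier (Set.Ioo (L s) (R s)) := by
      rw [frontier_Ioo (h.left_lt_right hs')]
      simp [(h1 hs').symm, (h2 hs').symm]
    exact continuousOn_const.continuousAt_indicator h3

lemma layerLen_nonneg (h : NestedIntervals b L R) (x : ℝ) : 0 ≤ layerLen b L R x :=
  intervalIntegral.integral_nonneg h.pos.le fun _ _ => Set.indicator_nonneg (fun _ _ => zero_le_one) _

/-- This identifies `layerLen` on a band with the inverse function of the end-point map. -/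
lemma layerLen_eq_of_mem (h : NestedIntervals b L R) {x t : ℝ} (ht : t ∈ Set.Icc 0 b)
    (hx : ∀ s ∈ Set.Ioo 0 b, x ∈ Set.Ioo (L s) (R s) ↔ s < t) : layerLen b L R x = t := by
  have h1 : layerLen b L R x =
      ∫ s in (0 : ℝ)..b, (Set.Iio t).indicator (fun _ => (1 : ℝ)) s := by
    refine intervalIntegral.integral_congr_ae ?_
    have : ∀ᵐ s ∂(volume : Measure ℝ), s ≠ b := by simp [ae_iff]
    filter_upwards [this] with s hs hs'
    rw [Set.uIoc_of_le h.pos.le] at hs'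
    have := hx s ⟨hs'.1, lt_of_le_of_ne hs'.2 hs⟩
    simp only [Set.indicator, this, Set.mem_Iio]
  rw [h1, intervalIntegral.integral_of_le h.pos.le, integral_indicator measurableSet_Iio]
  simp only [integral_const, MeasurableSet.univ, measureReal_restrict_apply, Set.univ_inter,
    smul_eq_mul, mul_one]
  rw [measureReal_restrict_apply measurableSet_Iio]
  have h2 : Set.Iio t ∩ Set.Ioc 0 b = Set.Ioo 0 t := by
    ext s
    simp only [Set.mem_inter_iff, Set.mem_Iio, Set.mem_Ioc, Set.mem_Ioo]
    exact ⟨fun ⟨h1, h2, _⟩ => ⟨h2, h1⟩, fun ⟨h1, h2⟩ => ⟨h2, h1, h2.le.trans ht.2⟩⟩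
  rw [h2, Real.volume_real_Ioo_of_le ht.1, sub_zero]

lemma layerLen_of_mem_inner (h : NestedIntervals b L R) {x : ℝ} (hx : x ∈ Set.Icc (L b) (R b)) :
    layerLen b L R x = b := by
  refine h.layerLen_eq_of_mem h.right_mem fun s hs => ?_
  have hs' : s ∈ Set.Icc 0 b := ⟨hs.1.le, hs.2.le⟩
  exact ⟨fun _ => hs.2, fun _ => ⟨(h.monoL hs' h.right_mem hs.2).trans_le hx.1,
    hx.2.trans_lt (h.antiR hs' h.right_mem hs.2)⟩⟩

lemma layerLen_of_notMem (h : NestedIntervals b L R) {x : ℝ} (hx : x ∉ Set.Ioo (L 0) (R 0)) :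
    layerLen b L R x = 0 := by
  refine h.layerLen_eq_of_mem h.zero_mem fun s hs => ?_
  have hs' : s ∈ Set.Icc 0 b := ⟨hs.1.le, hs.2.le⟩
  refine ⟨fun hm => absurd ⟨(h.left_le hs').trans_lt hm.1, hm.2.trans_le (h.right_le hs')⟩ hx,
    fun hm => absurd hm (not_lt.2 hs.1.le)⟩

lemma layerLen_of_mem_left (h : NestedIntervals b L R) {x : ℝ} (hx : x ∈ Set.Ioo (L 0) (L b)) :
    layerLen b L R x ∈ Set.Ioo 0 b := by
  obtain ⟨t, ht, rfl⟩ := intermediate_value_Ioo h.pos.le h.contL hx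
  have ht' : t ∈ Set.Icc 0 b := ⟨ht.1.le, ht.2.le⟩
  rwa [h.layerLen_eq_of_mem ht' fun s hs => ?_]
  have hs' : s ∈ Set.Icc 0 b := ⟨hs.1.le, hs.2.le⟩
  rw [← h.monoL.lt_iff_lt hs' ht']
  exact ⟨fun hm => hm.1, fun hm => ⟨hm, (hx.2.trans h.lt).trans_le (h.le_right hs')⟩⟩

lemma layerLen_of_mem_right (h : NestedIntervals b L R) {x : ℝ} (hx : x ∈ Set.Ioo (R b) (R 0)) :
    layerLen b L R x ∈ Set.Ioo 0 b := by
  obtain ⟨t, ht, rfl⟩ := intermediate_value_Ioo' h.pos.le h.contR hx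
  have ht' : t ∈ Set.Icc 0 b := ⟨ht.1.le, ht.2.le⟩
  rwa [h.layerLen_eq_of_mem ht' fun s hs => ?_]
  have hs' : s ∈ Set.Icc 0 b := ⟨hs.1.le, hs.2.le⟩
  rw [← h.antiR.lt_iff_gt ht' hs']
  exact ⟨fun hm => hm.2, fun hm => ⟨(h.le_left hs').trans_lt (h.lt.trans hx.1), hm⟩⟩

lemma layerLen_le (h : NestedIntervals b L R) (x : ℝ) : layerLen b L R x ≤ b := by
  by_cases hx : x ∈ Set.Ioo (L 0) (R 0)
  · rcases lt_or_ge x (L b) with h1 | h1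
    · exact (h.layerLen_of_mem_left ⟨hx.1, h1⟩).2.le
    · rcases le_or_gt x (R b) with h2 | h2
      · exact (h.layerLen_of_mem_inner ⟨h1, h2⟩).le
      · exact (h.layerLen_of_mem_right ⟨h2, hx.2⟩).2.le
  · rw [h.layerLen_of_notMem hx]
    exact h.pos.le

lemma layerLen_pos_iff (h : NestedIntervals b L R) {x : ℝ} :
    0 < layerLen b L R x ↔ x ∈ Set.Ioo (L 0) (R 0) := by
  refine ⟨fun h0 => ?_, fun hx => ?_⟩
  · by_contra hx
    rw [h.layerLen_of_notMem hx] at h0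
    exact lt_irrefl _ h0
  · rcases lt_or_ge x (L b) with h1 | h1
    · exact (h.layerLen_of_mem_left ⟨hx.1, h1⟩).1
    · rcases le_or_gt x (R b) with h2 | h2
      · rw [h.layerLen_of_mem_inner ⟨h1, h2⟩]
        exact h.pos
      · exact (h.layerLen_of_mem_right ⟨h2, hx.2⟩).1

/-- Fubini for the indicator of `{(s, x) : L s < x < R s}`. All integrals against the layered
measure are reduced to integrals over intervals by it. -/
lemma integral_layerLen_mul (h : NestedIntervals b L R) {f : ℝ → ℝ}
    (hf : IntegrableOn f (Set.Icc (L 0) (R 0))) :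
    ∫ x, layerLen b L R x * f x = ∫ s in (0 : ℝ)..b, ∫ y in (L s)..(R s), f y := by
  set F : ℝ → ℝ := (Set.Icc (L 0) (R 0)).indicator f with hF
  have hFi : Integrable F := (integrable_indicator_iff measurableSet_Icc).2 hf
  set A : Set (ℝ × ℝ) := {p | p.2 ∈ Set.Ioo (L p.1) (R p.1)} with hA
  set μ : Measure ℝ := volume.restrict (Set.Ioc 0 b) with hμ
  have hg : Integrable (A.indicator fun p : ℝ × ℝ => F p.2) (μ.prod volume) :=
    (hFi.comp_snd μ).indicator h.measurableSet
  have hsub : ∀ s ∈ Set.Ioc 0 b, Set.Ioo (L s) (R s) ⊆ Set.Icc (L 0) (R 0) := by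
    intro s hs y hy
    have hs' : s ∈ Set.Icc 0 b := ⟨hs.1.le, hs.2⟩
    exact ⟨(h.left_le hs').trans hy.1.le, hy.2.le.trans (h.right_le hs')⟩
  have e1 : ∀ x, layerLen b L R x * f x = ∫ s, A.indicator (fun p : ℝ × ℝ => F p.2) (s, x) ∂μ := by
    intro x
    rw [layerLen, intervalIntegral.integral_of_le h.pos.le, ← integral_mul_const]
    refine setIntegral_congr_fun measurableSet_Ioc fun s hs => ?_
    by_cases hx : x ∈ Set.Ioo (L s) (R s)
    · have hm : (s, x) ∈ A := hx
      have hFx : F x = f x := Set.indicator_of_mem (hsub s hs hx) f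
      simp only [Set.indicator_of_mem hx, Set.indicator_of_mem hm, hFx, one_mul]
    · have hm : (s, x) ∉ A := hx
      simp only [Set.indicator_of_notMem hx, Set.indicator_of_notMem hm, zero_mul]
  have e2 : ∀ s ∈ Set.Ioc 0 b, ∫ y in (L s)..(R s), f y =
      ∫ x, A.indicator (fun p : ℝ × ℝ => F p.2) (s, x) := by
    intro s hs
    rw [intervalIntegral.integral_of_le (h.left_lt_right ⟨hs.1.le, hs.2⟩).le,
      integral_Ioc_eq_integral_Ioo, ← integral_indicator measurableSet_Ioo]
    refine integral_congr_ae (.of_forall fun x => ?_)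
    by_cases hx : x ∈ Set.Ioo (L s) (R s)
    · have hm : (s, x) ∈ A := hx
      have hFx : F x = f x := Set.indicator_of_mem (hsub s hs hx) f
      simp only [Set.indicator_of_mem hx, Set.indicator_of_mem hm, hFx]
    · have hm : (s, x) ∉ A := hx
      simp only [Set.indicator_of_notMem hx, Set.indicator_of_notMem hm]
  rw [integral_congr_ae (.of_forall e1), intervalIntegral.integral_of_le h.pos.le,
    setIntegral_congr_fun measurableSet_Ioc e2]
  exact (integral_integral_swap (f := fun s x => A.indicator (fun p : ℝ × ℝ => F p.2) (s, x)) hg).symm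

end NestedIntervals

/-- The superposition of the uniform measures on `(L s, R s)`, with weight `k ds`. -/
def layerMeasure (k b : ℝ) (L R : ℝ → ℝ) : Measure ℝ :=
  volume.withDensity fun x => ENNReal.ofReal (k * layerLen b L R x)

namespace NestedIntervals

variable {k b : ℝ} {L R : ℝ → ℝ}

lemma measurable_density (h : NestedIntervals b L R) :
    Measurable fun x => ENNReal.ofReal (k * layerLen b L R x) :=
  (continuous_const.mul h.continuous_layerLen).measurable.ennreal_ofReal

lemma ae_mem (h : NestedIntervals b L R) :
    ∀ᵐ x ∂(layerMeasure k b L R), x ∈ Set.Ioo (L 0) (R 0) := by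
  rw [layerMeasure, ae_withDensity_iff h.measurable_density]
  refine .of_forall fun x hx => ?_
  by_contra hm
  exact hx (by simp [h.layerLen_of_notMem hm])

lemma integral_layerMeasure (h : NestedIntervals b L R) (hk : 0 < k) {f : ℝ → ℝ}
    (hf : IntegrableOn f (Set.Icc (L 0) (R 0))) :
    ∫ x, f x ∂(layerMeasure k b L R) = k * ∫ s in (0 : ℝ)..b, ∫ y in (L s)..(R s), f y := by
  rw [layerMeasure, integral_withDensity_eq_integral_toReal_smul h.measurable_density
    (.of_forall fun x => ENNReal.ofReal_lt_top), ← h.integral_layerLen_mul hf,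
    ← integral_const_mul]
  refine integral_congr_ae (.of_forall fun x => ?_)
  simp only
  rw [ENNReal.toReal_ofReal (mul_nonneg hk.le (h.layerLen_nonneg x)), smul_eq_mul, mul_assoc]

lemma isProbabilityMeasure (h : NestedIntervals b L R) (hk : 0 < k)
    (hmass : k * ∫ s in (0 : ℝ)..b, (R s - L s) = 1) :
    IsProbabilityMeasure (layerMeasure k b L R) := by
  have h1 := h.integral_layerMeasure hk (f := fun _ => (1 : ℝ))
    (integrableOn_const (by simp) (by simp))
  simp only [intervalIntegral.integral_const, smul_eq_mul, mul_one, hmass, integral_const] at h1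
  exact isProbabilityMeasure_iff_real.2 h1

lemma integrable_id_layerMeasure (h : NestedIntervals b L R)
    [IsProbabilityMeasure (layerMeasure k b L R)] :
    Integrable (fun x : ℝ => x) (layerMeasure k b L R) := by
  refine Integrable.of_bound (C := max |L 0| |R 0|) measurable_id.aestronglyMeasurable ?_
  filter_upwards [h.ae_mem] with x hx
  exact abs_le_max_abs_abs hx.1.le hx.2.le

lemma layerMeasure_Ioo_le (h : NestedIntervals b L R) (hk : 0 < k) {x y : ℝ} :
    layerMeasure k b L R (Set.Ioo x y) ≤ ENNReal.ofReal (k * b * (y - x)) := by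
  have hkb : 0 < k * b := mul_pos hk h.pos
  rw [layerMeasure, withDensity_apply _ measurableSet_Ioo]
  refine (lintegral_mono (g := fun _ => ENNReal.ofReal (k * b)) fun z => ?_).trans_eq ?_
  · exact ENNReal.ofReal_le_ofReal (mul_le_mul_of_nonneg_left (h.layerLen_le z) hk.le)
  · rw [setLIntegral_const, Real.volume_Ioo, ← ENNReal.ofReal_mul hkb.le]

lemma layerMeasure_restrict (h : NestedIntervals b L R) :
    (layerMeasure k b L R).restrict (Set.Icc (L b) (R b)) =
      ENNReal.ofReal (k * b) • volume.restrict (Set.Icc (L b) (R b)) := by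
  rw [layerMeasure, restrict_withDensity measurableSet_Icc, ← withDensity_const]
  refine withDensity_congr_ae ?_
  filter_upwards [ae_restrict_mem measurableSet_Icc] with x hx
  rw [h.layerLen_of_mem_inner hx]

lemma support_layerMeasure (h : NestedIntervals b L R) (hk : 0 < k) :
    (layerMeasure k b L R).support = Set.Icc (L 0) (R 0) := by
  have hlt : L 0 < R 0 := h.left_lt_right h.zero_mem
  refine Set.Subset.antisymm (Measure.support_subset_of_isClosed isClosed_Icc ?_) ?_
  · filter_upwards [h.ae_mem] with x hx using ⟨hx.1.le, hx.2.le⟩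
  · rw [← closure_Ioo hlt.ne]
    refine Measure.isClosed_support.closure_subset_iff.2 fun x hx => ?_
    rw [Measure.mem_support_iff_forall]
    intro U hU
    by_contra h0
    have h0 : layerMeasure k b L R U = 0 := by simpa using h0
    rw [layerMeasure, withDensity_apply_eq_zero h.measurable_density] at h0
    have hU' : U ∩ Set.Ioo (L 0) (R 0) ∈ 𝓝 x := inter_mem hU (isOpen_Ioo.mem_nhds hx)
    refine (Measure.measure_pos_of_mem_nhds volume hU').ne' (measure_mono_null ?_ h0)
    rintro y ⟨hyU, hy⟩
    refine ⟨?_, hyU⟩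
    simpa using mul_pos hk (h.layerLen_pos_iff.2 hy)

lemma intervalIntegral_log_sub (x l r : ℝ) :
    ∫ y in l..r, Real.log (x - y) =
      (x - l) * Real.log (x - l) - (x - r) * Real.log (x - r) - (x - l) + (x - r) := by
  rw [intervalIntegral.integral_comp_sub_left (fun t => Real.log t), integral_log]

lemma integrableOn_log_sub (x l r : ℝ) : IntegrableOn (fun y => Real.log (x - y)) (Set.Icc l r) := by
  rcases le_or_gt l r with hlr | hlr
  · have h1 := (intervalIntegral.intervalIntegrable_log' (a := x - l) (b := x - r)).comp_sub_left x
    simp only [sub_sub_cancel] at h1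
    rwa [intervalIntegrable_iff_integrableOn_Icc_of_le hlr] at h1
  · simp [Set.Icc_eq_empty (not_le.2 hlr)]

lemma integrable_log_sub_rect {f : ℝ → ℝ} (hm : Measurable f)
    (hf : ContinuousOn f (Set.Icc 0 b)) (x₀ x : ℝ) :
    Integrable (fun p : ℝ × ℝ => Real.log (p.2 - f p.1))
      ((volume.restrict (Set.Ioc 0 b)).prod (volume.restrict (Set.Ioc x₀ x))) := by
  have h1 : Integrable f (volume.restrict (Set.Ioc 0 b)) :=
    hf.integrableOn_Icc.mono_set Set.Ioc_subset_Icc_self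
  have h2 : Integrable (fun y : ℝ => y) (volume.restrict (Set.Ioc x₀ x)) :=
    (continuous_id.integrableOn_Icc (a := x₀) (b := x)).mono_set Set.Ioc_subset_Icc_self
  have h3 : volume.restrict (Set.Ioc x₀ x) ≤ (1 : ENNReal) • (volume : Measure ℝ) := by
    rw [one_smul]
    exact Measure.restrict_le_self
  refine (integrable_log_sub_prod hm h1 ENNReal.one_ne_top h3 h2).congr (.of_forall fun p => ?_)
  simp only
  rw [← Real.log_abs, abs_sub_comm, Real.log_abs]

lemma logPot_layerMeasure (h : NestedIntervals b L R) (hk : 0 < k) (x : ℝ) :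
    logPot (layerMeasure k b L R) x = k * ∫ s in (0 : ℝ)..b, ∫ y in (L s)..(R s), Real.log (x - y) :=
  h.integral_layerMeasure hk (integrableOn_log_sub x _ _)

lemma intervalIntegrable_integral_log (h : NestedIntervals b L R) (x : ℝ) :
    IntervalIntegrable (fun s => ∫ y in (L s)..(R s), Real.log (x - y)) volume 0 b := by
  refine ContinuousOn.intervalIntegrable ?_
  rw [Set.uIcc_of_le h.pos.le]
  simp_rw [intervalIntegral_log_sub]
  have hL := h.contL
  have hR := h.contR
  have c1 : ContinuousOn (fun s => (x - L s) * Real.log (x - L s)) (Set.Icc 0 b) :=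
    Real.continuous_mul_log.comp_continuousOn (continuousOn_const.sub hL)
  have c2 : ContinuousOn (fun s => (x - R s) * Real.log (x - R s)) (Set.Icc 0 b) :=
    Real.continuous_mul_log.comp_continuousOn (continuousOn_const.sub hR)
  fun_prop

/-- The integrated form of the derivative of the potential of a uniform measure: both sides are
explicit through the primitive `t log t - t`. After Fubini it yields increments of the potential
without differentiating under the integral. -/
lemma integral_log_sub_sub (x₀ x l r : ℝ) :
    (∫ y in l..r, Real.log (x - y)) - ∫ y in l..r, Real.log (x₀ - y) =
      ∫ y in x₀..x, (Real.log (y - l) - Real.log (y - r)) := by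
  have hi : ∀ u v c : ℝ, IntervalIntegrable (fun y => Real.log (y - c)) volume u v := by
    intro u v c
    have h1 := (intervalIntegral.intervalIntegrable_log' (a := u - c) (b := v - c)).comp_sub_right c
    simpa using h1
  rw [intervalIntegral.integral_sub (hi _ _ _) (hi _ _ _),
    intervalIntegral.integral_comp_sub_right (fun t => Real.log t),
    intervalIntegral.integral_comp_sub_right (fun t => Real.log t),
    intervalIntegral_log_sub, intervalIntegral_log_sub, integral_log, integral_log]
  ring

lemma logPot_sub (h : NestedIntervals b L R) (hk : 0 < k) {x₀ x : ℝ} (hx : x₀ ≤ x) :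
    logPot (layerMeasure k b L R) x - logPot (layerMeasure k b L R) x₀ =
      k * ∫ y in x₀..x, ∫ s in (0 : ℝ)..b, (Real.log (y - L s) - Real.log (y - R s)) := by
  rw [h.logPot_layerMeasure hk, h.logPot_layerMeasure hk, ← mul_sub,
    ← intervalIntegral.integral_sub (h.intervalIntegrable_integral_log x)
      (h.intervalIntegrable_integral_log x₀)]
  simp_rw [integral_log_sub_sub x₀ x, intervalIntegral.integral_of_le h.pos.le,
    intervalIntegral.integral_of_le hx]
  congr 1
  exact integral_integral_swap (f := fun s y => Real.log (y - L s) - Real.log (y - R s))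
    ((integrable_log_sub_rect h.measL h.contL x₀ x).sub
      (integrable_log_sub_rect h.measR h.contR x₀ x))

lemma intervalIntegrable_field (h : NestedIntervals b L R) (x₀ x : ℝ) :
    IntervalIntegrable
      (fun y => ∫ s in (0 : ℝ)..b, (Real.log (y - L s) - Real.log (y - R s))) volume x₀ x := by
  have key : ∀ u v : ℝ, IntegrableOn
      (fun y => ∫ s in (0 : ℝ)..b, (Real.log (y - L s) - Real.log (y - R s))) (Set.Ioc u v) := by
    intro u v
    simp_rw [intervalIntegral.integral_of_le h.pos.le]
    exact ((integrable_log_sub_rect h.measL h.contL u v).sub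
      (integrable_log_sub_rect h.measR h.contR u v)).integral_prod_right
  exact ⟨key _ _, key _ _⟩

/-- Far to the right of the intervals the field is comparable to the total mass. -/
lemma mass_bounds (h : NestedIntervals b L R) {y : ℝ} (hy : R 0 < y) :
    (y - R 0) * (∫ s in (0 : ℝ)..b, (Real.log (y - L s) - Real.log (y - R s))) ≤
        ∫ s in (0 : ℝ)..b, (R s - L s) ∧
      ∫ s in (0 : ℝ)..b, (R s - L s) ≤
        (y - L 0) * ∫ s in (0 : ℝ)..b, (Real.log (y - L s) - Real.log (y - R s)) := by
  have hL := h.contL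
  have hR := h.contR
  have hposR : ∀ s ∈ Set.Icc 0 b, y - R 0 ≤ y - R s := fun s hs => by linarith [h.right_le hs]
  have hposL : ∀ s ∈ Set.Icc 0 b, y - R s < y - L s := fun s hs => by linarith [h.left_lt_right hs]
  have c1 : ContinuousOn (fun s => Real.log (y - L s) - Real.log (y - R s)) (Set.uIcc 0 b) := by
    rw [Set.uIcc_of_le h.pos.le]
    refine ContinuousOn.sub (ContinuousOn.log (by fun_prop) fun s hs => ?_)
      (ContinuousOn.log (by fun_prop) fun s hs => ?_)
    · linarith [hposR s hs, hposL s hs]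
    · linarith [hposR s hs]
  have c2 : ContinuousOn (fun s => R s - L s) (Set.uIcc 0 b) := by
    rw [Set.uIcc_of_le h.pos.le]
    fun_prop
  have hb : ∀ s ∈ Set.Icc 0 b, (y - R 0) * (Real.log (y - L s) - Real.log (y - R s)) ≤ R s - L s ∧
      R s - L s ≤ (y - L 0) * (Real.log (y - L s) - Real.log (y - R s)) := by
    intro s hs
    have p0 : 0 < y - R 0 := by linarith
    have p1 : 0 < y - R s := p0.trans_le (hposR s hs)
    have p2 : 0 < y - L s := p1.trans (hposL s hs)
    have u1 := Real.log_le_sub_one_of_pos (div_pos p2 p1)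
    have u2 := Real.log_le_sub_one_of_pos (div_pos p1 p2)
    rw [Real.log_div p2.ne' p1.ne'] at u1
    rw [Real.log_div p1.ne' p2.ne'] at u2
    have hnn : 0 ≤ Real.log (y - L s) - Real.log (y - R s) :=
      sub_nonneg.2 (Real.log_le_log p1 (hposL s hs).le)
    have v1 : (y - R s) * (Real.log (y - L s) - Real.log (y - R s)) ≤ R s - L s := by
      have := mul_le_mul_of_nonneg_left u1 p1.le
      have e : (y - R s) * ((y - L s) / (y - R s) - 1) = R s - L s := by field_simp; ring
      linarith
    have v2 : R s - L s ≤ (y - L s) * (Real.log (y - L s) - Real.log (y - R s)) := by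
      have := mul_le_mul_of_nonneg_left u2 p2.le
      have e : (y - L s) * ((y - R s) / (y - L s) - 1) = L s - R s := by field_simp; ring
      nlinarith
    exact ⟨(mul_le_mul_of_nonneg_right (hposR s hs) hnn).trans v1,
      v2.trans (mul_le_mul_of_nonneg_right (by linarith [h.left_le hs]) hnn)⟩
  rw [← intervalIntegral.integral_const_mul, ← intervalIntegral.integral_const_mul]
  exact ⟨intervalIntegral.integral_mono_on h.pos.le (c1.intervalIntegrable.const_mul _)
      c2.intervalIntegrable fun s hs => (hb s hs).1,
    intervalIntegral.integral_mono_on h.pos.le c2.intervalIntegrable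
      (c1.intervalIntegrable.const_mul _) fun s hs => (hb s hs).2⟩

end NestedIntervals

/-! ### The equilibrium measure -/

lemma measurable_confMap {a : ℝ} (ha : 0 < a) (w : ℝ) : Measurable (confMap a w) := by
  have hA := (differentiable_thA ha).continuous.measurable
  have hB := (differentiable_thB ha).continuous.measurable
  unfold confMap mapHom mapNum mapDen
  fun_prop

lemma nestedIntervals {a w : ℝ} (ha : 0 < a) (hw0 : 0 < w) (hw1 : w < Real.pi / 2) :
    NestedIntervals (Real.pi * a / 2) (xL a w) (xR a w) where
  pos := by have := mul_pos Real.pi_pos ha; linarith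
  measL := Complex.measurable_re.comp ((measurable_confMap ha w).comp
    (by fun_prop : Measurable fun s : ℝ => (s : ℂ) * I))
  measR := Complex.measurable_re.comp ((measurable_confMap ha w).comp
    (by fun_prop : Measurable fun s : ℝ => (Real.pi : ℂ) / 2 + (s : ℂ) * I))
  contL := continuousOn_xL ha hw0 hw1
  contR := continuousOn_xR ha hw0 hw1
  monoL := strictMonoOn_xL ha hw0 hw1
  antiR := strictAntiOn_xR ha hw0 hw1
  lt := by
    rw [xL_top ha hw0 hw1, xR_top ha hw0 hw1]
    exact (endpoint_order ha hw0 hw1).2.1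

/-- The field at a distant point `x` is asymptotic to the total length over `x`; at `x = confMap r`
with `r ↓ w` it is exactly `π (r - w)`, while `x (r - w) → π/2`. Hence the value, and hence the
normalization `2/π²` of the measure. -/
lemma integral_xR_sub_xL {a w : ℝ} (ha : 0 < a) (hw0 : 0 < w) (hw1 : w < Real.pi / 2) :
    ∫ s in (0 : ℝ)..(Real.pi * a / 2), (xR a w s - xL a w s) = Real.pi ^ 2 / 2 := by
  have hN := nestedIntervals ha hw0 hw1
  set M := ∫ s in (0 : ℝ)..(Real.pi * a / 2), (xR a w s - xL a w s) with hM
  have ht := tendsto_confMap_mul ha hw0 hw1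
  have h0 : Tendsto (fun r : ℝ => r - w) (𝓝[>] w) (𝓝 0) := by
    have : Tendsto (fun r : ℝ => r - w) (𝓝 w) (𝓝 (w - w)) :=
      (continuous_id.sub continuous_const).tendsto w
    rw [sub_self] at this
    exact this.mono_left nhdsWithin_le_nhds
  have hlim : ∀ c : ℝ, Tendsto (fun r : ℝ => Real.pi * ((confMap a w r).re * (r - w) - c * (r - w)))
      (𝓝[>] w) (𝓝 (Real.pi ^ 2 / 2)) := by
    intro c
    have := (ht.sub (h0.const_mul c)).const_mul Real.pi
    convert this using 2
    ring
  have hinf : ∀ᶠ r : ℝ in 𝓝[>] w, endβ a w < (confMap a w r).re := by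
    have h1 : Tendsto (fun r : ℝ => (confMap a w r).re * (r - w) - endβ a w * (r - w)) (𝓝[>] w)
        (𝓝 (Real.pi / 2)) := by
      simpa using ht.sub (h0.const_mul (endβ a w))
    filter_upwards [h1.eventually (lt_mem_nhds (half_pos Real.pi_pos)), self_mem_nhdsWithin]
      with r hr hr'
    have hr' : w < r := hr'
    rw [← sub_mul] at hr
    have := (pos_iff_pos_of_mul_pos hr).2 (by linarith)
    linarith
  have hbd : ∀ᶠ r : ℝ in 𝓝[>] w,
      Real.pi * ((confMap a w r).re * (r - w) - endβ a w * (r - w)) ≤ M ∧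
      M ≤ Real.pi * ((confMap a w r).re * (r - w) - endα a w * (r - w)) := by
    filter_upwards [hinf, self_mem_nhdsWithin, Ioo_mem_nhdsGT hw1] with r hr hr1 hr2
    have hr1 : w < r := hr1
    have hb := hN.mass_bounds (y := (confMap a w r).re) (by rwa [xR_zero ha hw0 hw1])
    have hp : potDeriv a w (confMap a w r).re = Real.pi * (r - w) := by
      have := potDeriv_eq ha hw0 hw1 (confDen_ne_zero_of_gt ha hw0 hr1 hr2.2.le)
        (ofReal_re_confMap a w r).symm (by simpa using (hw0.trans hr1).le) (by simpa using hr2.2.le)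
      simpa using this
    rw [potDeriv] at hp
    rw [hp, xR_zero ha hw0 hw1, xL_zero ha hw0 hw1] at hb
    exact ⟨by linarith [hb.1], by linarith [hb.2]⟩
  exact le_antisymm (ge_of_tendsto (hlim _) (hbd.mono fun r hr => hr.2))
    (le_of_tendsto (hlim _) (hbd.mono fun r hr => hr.1))

/-- The constrained equilibrium measure. -/
def eqMeasure (a w : ℝ) : Measure ℝ :=
  layerMeasure (2 / Real.pi ^ 2) (Real.pi * a / 2) (xL a w) (xR a w)

lemma isProbabilityMeasure_eqMeasure {a w : ℝ} (ha : 0 < a) (hw0 : 0 < w) (hw1 : w < Real.pi / 2) :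
    IsProbabilityMeasure (eqMeasure a w) := by
  refine (nestedIntervals ha hw0 hw1).isProbabilityMeasure (by positivity) ?_
  rw [integral_xR_sub_xL ha hw0 hw1]
  field_simp

lemma weight_mul_height (a : ℝ) : 2 / Real.pi ^ 2 * (Real.pi * a / 2) = a / Real.pi := by
  have := Real.pi_ne_zero
  field_simp

lemma isAdmissible_eqMeasure {a w γ : ℝ} (ha : 0 < a) (hw0 : 0 < w) (hw1 : w < Real.pi / 2)
    (haγ : a / Real.pi = 1 / (2 * γ)) : IsAdmissible γ (eqMeasure a w) where
  isProbabilityMeasure := isProbabilityMeasure_eqMeasure ha hw0 hw1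
  le_of_lt x y _ := by
    refine ((nestedIntervals ha hw0 hw1).layerMeasure_Ioo_le (by positivity)).trans_eq ?_
    rw [weight_mul_height, haγ]
    congr 1
    ring

lemma areEndpoints_eqMeasure {a w γ : ℝ} (ha : 0 < a) (hw0 : 0 < w) (hw1 : w < Real.pi / 2)
    (haγ : a / Real.pi = 1 / (2 * γ)) :
    AreEndpoints γ (eqMeasure a w) (endα a w) (endα' a w) (endβ' a w) (endβ a w) := by
  have hN := nestedIntervals ha hw0 hw1
  have hk : 0 < 2 / Real.pi ^ 2 := by positivity
  have hord := endpoint_order ha hw0 hw1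
  refine ⟨hord.1, endα'_neg ha hw0 hw1, endβ'_pos ha hw0 hw1, hord.2.2, ?_, ?_⟩
  · rw [eqMeasure, hN.support_layerMeasure hk, xL_zero ha hw0 hw1, xR_zero ha hw0 hw1]
  · refine ⟨fun x => 2 / Real.pi ^ 2 * layerLen (Real.pi * a / 2) (xL a w) (xR a w) x,
      continuous_const.mul hN.continuous_layerLen, rfl, fun x hx => ?_, fun x hx => ?_⟩
    · rw [← xL_top ha hw0 hw1, ← xR_top ha hw0 hw1] at hx
      simp only [hN.layerLen_of_mem_inner hx, weight_mul_height, haγ]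
    · have hm : layerLen (Real.pi * a / 2) (xL a w) (xR a w) x ∈ Set.Ioo 0 (Real.pi * a / 2) := by
        rw [← xL_zero ha hw0 hw1, ← xR_zero ha hw0 hw1, ← xL_top ha hw0 hw1,
          ← xR_top ha hw0 hw1] at hx
        rcases hx with hx | hx
        · exact hN.layerLen_of_mem_left hx
        · exact hN.layerLen_of_mem_right hx
      refine ⟨mul_pos hk hm.1, ?_⟩
      rw [← haγ, ← weight_mul_height]
      exact mul_lt_mul_of_pos_left hm.2 hk

/-! ### The Euler–Lagrange conditions -/

lemma logPot_eqMeasure_sub {a w : ℝ} (ha : 0 < a) (hw0 : 0 < w) (hw1 : w < Real.pi / 2) {x₀ x : ℝ}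
    (hx : x₀ ≤ x) : logPot (eqMeasure a w) x - logPot (eqMeasure a w) x₀ =
      2 / Real.pi ^ 2 * ∫ y in x₀..x, potDeriv a w y :=
  (nestedIntervals ha hw0 hw1).logPot_sub (by positivity) hx

lemma intervalIntegrable_potDeriv {a w : ℝ} (ha : 0 < a) (hw0 : 0 < w) (hw1 : w < Real.pi / 2)
    (x₀ x : ℝ) : IntervalIntegrable (potDeriv a w) volume x₀ x :=
  (nestedIntervals ha hw0 hw1).intervalIntegrable_field x₀ x

lemma potDeriv_of_mem_left {a w : ℝ} (ha : 0 < a) (hw0 : 0 < w) (hw1 : w < Real.pi / 2) {x : ℝ}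
    (hx : x ∈ Set.Icc (endα a w) (endα' a w)) : potDeriv a w x = -(Real.pi * w) := by
  have hN := nestedIntervals ha hw0 hw1
  rw [← xL_zero ha hw0 hw1, ← xL_top ha hw0 hw1] at hx
  obtain ⟨s, hs, rfl⟩ := intermediate_value_Icc hN.pos.le hN.contL hx
  rw [potDeriv_eq ha hw0 hw1 (confDen_left ha hw0 hw1 (abs_lt_of_mem_Icc ha hs))
    (ofReal_xL a w s).symm (by simp) (by simp; positivity)]
  simp

lemma potDeriv_of_mem_right {a w : ℝ} (ha : 0 < a) (hw0 : 0 < w) (hw1 : w < Real.pi / 2) {x : ℝ}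
    (hx : x ∈ Set.Icc (endβ' a w) (endβ a w)) :
    potDeriv a w x = Real.pi * (Real.pi / 2 - w) := by
  have hN := nestedIntervals ha hw0 hw1
  rw [← xR_zero ha hw0 hw1, ← xR_top ha hw0 hw1] at hx
  obtain ⟨s, hs, rfl⟩ := intermediate_value_Icc' hN.pos.le hN.contR hx
  have hre : ((Real.pi : ℂ) / 2 + s * I).re = Real.pi / 2 := by simp
  rw [potDeriv_eq ha hw0 hw1 (confDen_right ha hw0 hw1 (abs_lt_of_mem_Icc ha hs))
    (ofReal_xR a w s).symm (by rw [hre]; positivity) (by rw [hre]), hre]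

lemma potDeriv_xS {a w : ℝ} (ha : 0 < a) (hw0 : 0 < w) (hw1 : w < Real.pi / 2) {r : ℝ}
    (hr : r ∈ Set.Icc 0 (Real.pi / 2)) : potDeriv a w (xS a w r) = Real.pi * (r - w) := by
  have hre : ((r : ℂ) + Real.pi * a / 2 * I).re = r := by
    simp
  rw [potDeriv_eq ha hw0 hw1 (confDen_upper ha w r) (ofReal_xS a w r).symm (by rw [hre]; exact hr.1)
    (by rw [hre]; exact hr.2), hre]

lemma exists_xS_eq {a w : ℝ} (ha : 0 < a) (hw0 : 0 < w) (hw1 : w < Real.pi / 2) {x : ℝ}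
    (hx : x ∈ Set.Icc (endα' a w) (endβ' a w)) : ∃ r ∈ Set.Icc 0 (Real.pi / 2), xS a w r = x := by
  rw [← xS_zero ha hw0 hw1, ← xS_pi_div_two ha hw0 hw1] at hx
  exact intermediate_value_Icc (by positivity) (continuous_xS ha w).continuousOn hx

/-- Every real `x` has a preimage on the boundary of the rectangle, where the real part lies in `[0,
π/2]`. The bounds are the values taken on the two bands. -/
lemma potDeriv_mem {a w : ℝ} (ha : 0 < a) (hw0 : 0 < w) (hw1 : w < Real.pi / 2) (x : ℝ) :
    potDeriv a w x ∈ Set.Icc (-(Real.pi * w)) (Real.pi * (Real.pi / 2 - w)) := by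
  have hp := Real.pi_pos
  have key : ∀ r, 0 ≤ r → r ≤ Real.pi / 2 → Real.pi * (r - w) ∈
      Set.Icc (-(Real.pi * w)) (Real.pi * (Real.pi / 2 - w)) := fun r h0 h1 =>
    ⟨by nlinarith, by nlinarith⟩
  rcases lt_or_ge x (endα a w) with h1 | h1
  · obtain ⟨r, hr0, hr1, hD, hr⟩ := exists_confMap_eq_of_lt ha hw0 hw1 h1
    have := potDeriv_eq ha hw0 hw1 hD hr (by simpa using hr0.le) (by simp; linarith)
    rw [this, ofReal_re]
    exact key r hr0.le (by linarith)
  rcases le_or_gt x (endα' a w) with h2 | h2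
  · rw [potDeriv_of_mem_left ha hw0 hw1 ⟨h1, h2⟩]
    simpa using key 0 le_rfl (by positivity)
  rcases le_or_gt x (endβ' a w) with h3 | h3
  · obtain ⟨r, hr, rfl⟩ := exists_xS_eq ha hw0 hw1 ⟨h2.le, h3⟩
    rw [potDeriv_xS ha hw0 hw1 hr]
    exact key r hr.1 hr.2
  rcases le_or_gt x (endβ a w) with h4 | h4
  · rw [potDeriv_of_mem_right ha hw0 hw1 ⟨h3.le, h4⟩]
    exact key _ (by positivity) le_rfl
  · obtain ⟨r, hr0, hr1, hD, hr⟩ := exists_confMap_eq_of_gt ha hw0 hw1 h4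
    have := potDeriv_eq ha hw0 hw1 hD hr (by simp; linarith) (by simpa using hr1.le)
    rw [this, ofReal_re]
    exact key r (by linarith) hr1.le

/-- A device to integrate the inverse of `xS` by Fubini rather than by change of variables: the
artificial right ends decrease strictly but stay beyond `β'`, so on the saturated region the layer
length is that inverse. -/
lemma nestedIntervals_xS {a w : ℝ} (ha : 0 < a) (hw0 : 0 < w) (hw1 : w < Real.pi / 2) :
    NestedIntervals (Real.pi / 2) (xS a w) (fun s => endβ' a w + 1 + (Real.pi / 2 - s)) where
  pos := by positivity
  measL := (continuous_xS ha w).measurable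
  measR := by fun_prop
  contL := (continuous_xS ha w).continuousOn
  contR := by fun_prop
  monoL := strictMonoOn_xS ha hw0 hw1
  antiR := fun s _ t _ hst => by
    simp only
    linarith
  lt := by
    rw [xS_pi_div_two ha hw0 hw1]
    simp

lemma potDeriv_eq_layerLen {a w : ℝ} (ha : 0 < a) (hw0 : 0 < w) (hw1 : w < Real.pi / 2) {x : ℝ}
    (hx : x ∈ Set.Icc (endα' a w) (endβ' a w)) : potDeriv a w x = Real.pi *
      (layerLen (Real.pi / 2) (xS a w) (fun s => endβ' a w + 1 + (Real.pi / 2 - s)) x - w) := by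
  obtain ⟨r, hr, rfl⟩ := exists_xS_eq ha hw0 hw1 hx
  rw [potDeriv_xS ha hw0 hw1 hr,
    (nestedIntervals_xS ha hw0 hw1).layerLen_eq_of_mem hr fun s hs => ?_]
  rw [← (strictMonoOn_xS ha hw0 hw1).lt_iff_lt ⟨hs.1.le, hs.2.le⟩ hr]
  exact ⟨fun h => h.1, fun h => ⟨h, by linarith [hx.2, hs.2]⟩⟩

lemma integral_potDeriv_saturated {a w : ℝ} (ha : 0 < a) (hw0 : 0 < w) (hw1 : w < Real.pi / 2) :
    ∫ y in (endα' a w)..(endβ' a w), potDeriv a w y =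
      Real.pi * (Real.pi / 2 * endβ' a w - w * (endβ' a w - endα' a w)) := by
  have hN := nestedIntervals_xS ha hw0 hw1
  have hle := (endpoint_order ha hw0 hw1).2.1.le
  set β := endβ' a w with hβ
  set lay := layerLen (Real.pi / 2) (xS a w) (fun s => β + 1 + (Real.pi / 2 - s)) with hlay
  have h1 : ∫ y in (endα' a w)..β, potDeriv a w y =
      ∫ y in (endα' a w)..β, Real.pi * (lay y - w) := by
    refine intervalIntegral.integral_congr fun y hy => ?_
    rw [Set.uIcc_of_le hle] at hy
    exact potDeriv_eq_layerLen ha hw0 hw1 hy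
  have hcont : Continuous lay := hN.continuous_layerLen
  have h2 : ∫ y in (endα' a w)..β, lay y = Real.pi / 2 * β := by
    have hfi : IntegrableOn ((Set.Iic β).indicator fun _ => (1 : ℝ))
        (Set.Icc (xS a w 0) (β + 1 + (Real.pi / 2 - 0))) :=
      (integrableOn_const (by simp) (by simp)).indicator measurableSet_Iic
    have e := hN.integral_layerLen_mul hfi
    have e1 : ∀ x, lay x * (Set.Iic β).indicator (fun _ => (1 : ℝ)) x =
        (Set.Ioc (endα' a w) β).indicator lay x := by
      intro x
      by_cases hx : x ≤ β
      · rw [Set.indicator_of_mem (Set.mem_Iic.2 hx), mul_one]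
        by_cases hx' : endα' a w < x
        · rw [Set.indicator_of_mem (Set.mem_Ioc.2 ⟨hx', hx⟩)]
        · rw [Set.indicator_of_notMem fun h => hx' h.1]
          refine hN.layerLen_of_notMem fun h => hx' ?_
          rw [← xS_zero ha hw0 hw1]
          exact h.1
      · rw [Set.indicator_of_notMem (by simpa using hx), mul_zero,
          Set.indicator_of_notMem fun h => hx h.2]
    have e2 : ∀ s ∈ Set.uIcc 0 (Real.pi / 2),
        ∫ y in (xS a w s)..(β + 1 + (Real.pi / 2 - s)), (Set.Iic β).indicator (fun _ => (1 : ℝ)) y =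
          β - xS a w s := by
      intro s hs
      rw [Set.uIcc_of_le hN.pos.le] at hs
      have hs1 : xS a w s ≤ β := by
        rw [hβ, ← xS_pi_div_two ha hw0 hw1]
        exact hN.le_left hs
      rw [intervalIntegral.integral_of_le (hN.left_lt_right hs).le,
        setIntegral_indicator measurableSet_Iic]
      have : Set.Ioc (xS a w s) (β + 1 + (Real.pi / 2 - s)) ∩ Set.Iic β =
          Set.Ioc (xS a w s) β := by
        ext y
        simp only [Set.mem_inter_iff, Set.mem_Ioc, Set.mem_Iic]
        exact ⟨fun h => ⟨h.1.1, h.2⟩, fun h => ⟨⟨h.1, by linarith [h.2, hs.2]⟩, h.2⟩⟩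
      rw [this, setIntegral_const, smul_eq_mul, mul_one, Real.volume_real_Ioc_of_le hs1]
    -- Truncation at `β'` reduces the integral to that of `β' - xS s` over `[0, π/2]`, and `xS` has
    -- mean zero.
    rw [intervalIntegral.integral_congr e2, integral_congr_ae (.of_forall e1),
      integral_indicator measurableSet_Ioc,
      intervalIntegral.integral_sub intervalIntegrable_const
        ((continuous_xS ha w).intervalIntegrable _ _), integral_xS ha,
      intervalIntegral.integral_const] at e
    rw [intervalIntegral.integral_of_le hle, e]
    simp
  rw [h1, intervalIntegral.integral_const_mul,
    intervalIntegral.integral_sub (hcont.intervalIntegrable _ _) intervalIntegrable_const, h2,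
    intervalIntegral.integral_const, smul_eq_mul]
  ring

section EulerLagrange

variable {a w ζ : ℝ}

lemma effPot_sub (ha : 0 < a) (hw0 : 0 < w) (hw1 : w < Real.pi / 2) {x₀ x : ℝ} (hx : x₀ ≤ x) :
    effPot ζ (eqMeasure a w) x - effPot ζ (eqMeasure a w) x₀ =
      potential ζ x - potential ζ x₀ - 4 / Real.pi ^ 2 * ∫ y in x₀..x, potDeriv a w y := by
  have := logPot_eqMeasure_sub ha hw0 hw1 hx
  unfold effPot
  linear_combination -2 * this

/-- On the negative axis the external potential has slope `-(1+ζ)`, and `4/π²` times the lower bound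
`-πw` of `potDeriv` is the same number. The positive axis is treated alike with the upper bound and
slope `1-ζ`. -/
lemma effPot_antitone (ha : 0 < a) (hw0 : 0 < w) (hw1 : w < Real.pi / 2)
    (hζ : 4 * w = Real.pi * (1 + ζ)) {x₀ x : ℝ} (hx : x₀ ≤ x) (h0 : x ≤ 0) :
    effPot ζ (eqMeasure a w) x ≤ effPot ζ (eqMeasure a w) x₀ := by
  have hp := Real.pi_pos
  have h1 := effPot_sub (ζ := ζ) ha hw0 hw1 hx
  have h2 : ∫ _ in x₀..x, -(Real.pi * w) ≤ ∫ y in x₀..x, potDeriv a w y :=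
    intervalIntegral.integral_mono_on hx intervalIntegrable_const
      (intervalIntegrable_potDeriv ha hw0 hw1 _ _) fun y _ => (potDeriv_mem ha hw0 hw1 y).1
  rw [intervalIntegral.integral_const, smul_eq_mul] at h2
  have h3 := mul_le_mul_of_nonneg_left h2 (by positivity : 0 ≤ 4 / Real.pi ^ 2)
  have h4 : 4 / Real.pi ^ 2 * ((x - x₀) * -(Real.pi * w)) = -((x - x₀) * (1 + ζ)) := by
    rw [show 4 / Real.pi ^ 2 * ((x - x₀) * -(Real.pi * w)) =
      -((x - x₀) * (4 * w)) * Real.pi / Real.pi ^ 2 by ring, hζ]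
    field_simp
  rw [potential, potential, abs_of_nonpos h0, abs_of_nonpos (hx.trans h0)] at h1
  linarith

lemma effPot_monotone (ha : 0 < a) (hw0 : 0 < w) (hw1 : w < Real.pi / 2)
    (hζ : 4 * w = Real.pi * (1 + ζ)) {x₀ x : ℝ} (hx : x₀ ≤ x) (h0 : 0 ≤ x₀) :
    effPot ζ (eqMeasure a w) x₀ ≤ effPot ζ (eqMeasure a w) x := by
  have hp := Real.pi_pos
  have h1 := effPot_sub (ζ := ζ) ha hw0 hw1 hx
  have h2 : ∫ y in x₀..x, potDeriv a w y ≤ ∫ _ in x₀..x, Real.pi * (Real.pi / 2 - w) :=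
    intervalIntegral.integral_mono_on hx (intervalIntegrable_potDeriv ha hw0 hw1 _ _)
      intervalIntegrable_const fun y _ => (potDeriv_mem ha hw0 hw1 y).2
  rw [intervalIntegral.integral_const, smul_eq_mul] at h2
  have h3 := mul_le_mul_of_nonneg_left h2 (by positivity : 0 ≤ 4 / Real.pi ^ 2)
  have h4 : 4 / Real.pi ^ 2 * ((x - x₀) * (Real.pi * (Real.pi / 2 - w))) =
      (x - x₀) * (1 - ζ) := by
    rw [show 4 / Real.pi ^ 2 * ((x - x₀) * (Real.pi * (Real.pi / 2 - w))) =
      (x - x₀) * (2 * Real.pi - 4 * w) * Real.pi / Real.pi ^ 2 by ring, hζ]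
    field_simp
    ring
  rw [potential, potential, abs_of_nonneg h0, abs_of_nonneg (h0.trans hx)] at h1
  linarith

lemma effPot_eq_left (ha : 0 < a) (hw0 : 0 < w) (hw1 : w < Real.pi / 2)
    (hζ : 4 * w = Real.pi * (1 + ζ)) {x : ℝ} (hx : x ∈ Set.Icc (endα a w) (endα' a w)) :
    effPot ζ (eqMeasure a w) x = effPot ζ (eqMeasure a w) (endα' a w) := by
  have hp := Real.pi_pos
  have hα := endα'_neg ha hw0 hw1
  have h1 := effPot_sub (ζ := ζ) ha hw0 hw1 hx.2
  have h2 : ∫ y in x..(endα' a w), potDeriv a w y = ∫ _ in x..(endα' a w), -(Real.pi * w) := by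
    refine intervalIntegral.integral_congr fun y hy => ?_
    rw [Set.uIcc_of_le hx.2] at hy
    exact potDeriv_of_mem_left ha hw0 hw1 ⟨hx.1.trans hy.1, hy.2⟩
  have h4 : 4 / Real.pi ^ 2 * ((endα' a w - x) * -(Real.pi * w)) =
      -((endα' a w - x) * (1 + ζ)) := by
    rw [show 4 / Real.pi ^ 2 * ((endα' a w - x) * -(Real.pi * w)) =
      -((endα' a w - x) * (4 * w)) * Real.pi / Real.pi ^ 2 by ring, hζ]
    field_simp
  rw [h2, intervalIntegral.integral_const, smul_eq_mul, h4, potential, potential,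
    abs_of_neg hα, abs_of_nonpos (hx.2.trans hα.le)] at h1
  linarith

lemma effPot_eq_right (ha : 0 < a) (hw0 : 0 < w) (hw1 : w < Real.pi / 2)
    (hζ : 4 * w = Real.pi * (1 + ζ)) {x : ℝ} (hx : x ∈ Set.Icc (endβ' a w) (endβ a w)) :
    effPot ζ (eqMeasure a w) x = effPot ζ (eqMeasure a w) (endβ' a w) := by
  have hp := Real.pi_pos
  have hβ := endβ'_pos ha hw0 hw1
  have h1 := effPot_sub (ζ := ζ) ha hw0 hw1 hx.1
  have h2 : ∫ y in (endβ' a w)..x, potDeriv a w y =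
      ∫ _ in (endβ' a w)..x, Real.pi * (Real.pi / 2 - w) := by
    refine intervalIntegral.integral_congr fun y hy => ?_
    rw [Set.uIcc_of_le hx.1] at hy
    exact potDeriv_of_mem_right ha hw0 hw1 ⟨hy.1, hy.2.trans hx.2⟩
  have h4 : 4 / Real.pi ^ 2 * ((x - endβ' a w) * (Real.pi * (Real.pi / 2 - w))) =
      (x - endβ' a w) * (1 - ζ) := by
    rw [show 4 / Real.pi ^ 2 * ((x - endβ' a w) * (Real.pi * (Real.pi / 2 - w))) =
      (x - endβ' a w) * (2 * Real.pi - 4 * w) * Real.pi / Real.pi ^ 2 by ring, hζ]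
    field_simp
    ring
  rw [h2, intervalIntegral.integral_const, smul_eq_mul, h4, potential, potential,
    abs_of_pos hβ, abs_of_nonneg (hβ.le.trans hx.1)] at h1
  linarith

/-- The equality of the constants on the two bands does not follow from the slopes; it is a global
condition, and holds because `xS` has mean zero. -/
lemma effPot_endβ'_eq (ha : 0 < a) (hw0 : 0 < w) (hw1 : w < Real.pi / 2)
    (hζ : 4 * w = Real.pi * (1 + ζ)) :
    effPot ζ (eqMeasure a w) (endβ' a w) = effPot ζ (eqMeasure a w) (endα' a w) := by
  have hp := Real.pi_pos
  have hα := endα'_neg ha hw0 hw1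
  have hβ := endβ'_pos ha hw0 hw1
  have h1 := effPot_sub (ζ := ζ) ha hw0 hw1 (hα.trans hβ).le
  have h4 : 4 / Real.pi ^ 2 *
      (Real.pi * (Real.pi / 2 * endβ' a w - w * (endβ' a w - endα' a w))) =
      2 * endβ' a w - (1 + ζ) * (endβ' a w - endα' a w) := by
    rw [show 4 / Real.pi ^ 2 *
      (Real.pi * (Real.pi / 2 * endβ' a w - w * (endβ' a w - endα' a w))) =
      (2 * Real.pi * endβ' a w - 4 * w * (endβ' a w - endα' a w)) * Real.pi / Real.pi ^ 2 by ring,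
      hζ]
    field_simp
  rw [integral_potDeriv_saturated ha hw0 hw1, h4, potential, potential, abs_of_neg hα,
    abs_of_pos hβ] at h1
  linarith

end EulerLagrange

theorem isEquilibriumMeasure_eqMeasure {a w γ ζ : ℝ} (ha : 0 < a) (hw0 : 0 < w)
    (hw1 : w < Real.pi / 2) (hγ : 0 < γ) (haγ : a / Real.pi = 1 / (2 * γ)) (hζ1 : |ζ| < 1)
    (hζ : 4 * w = Real.pi * (1 + ζ)) :
    IsEquilibriumMeasure γ ζ (eqMeasure a w) ∧
      ∀ ν, IsEquilibriumMeasure γ ζ ν → ν = eqMeasure a w := by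
  have hN := nestedIntervals ha hw0 hw1
  have hP := isProbabilityMeasure_eqMeasure ha hw0 hw1
  have hα := endα'_neg ha hw0 hw1
  have hβ := endβ'_pos ha hw0 hw1
  have heqβ := effPot_endβ'_eq ha hw0 hw1 hζ
  refine isEquilibriumMeasure_of_effPot (l := effPot ζ (eqMeasure a w) (endα' a w))
    (S := Set.Icc (endα' a w) (endβ' a w)) hγ hζ1 (isAdmissible_eqMeasure ha hw0 hw1 haγ)
    ?_ measurableSet_Icc ?_ ?_ ?_ ?_
  · have : IsProbabilityMeasure
        (layerMeasure (2 / Real.pi ^ 2) (Real.pi * a / 2) (xL a w) (xR a w)) := hP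
    exact hN.integrable_id_layerMeasure
  · rw [← haγ, ← weight_mul_height, ← xL_top ha hw0 hw1, ← xR_top ha hw0 hw1]
    exact hN.layerMeasure_restrict
  · intro x hx
    rcases le_total x 0 with h | h
    · exact effPot_antitone ha hw0 hw1 hζ hx.1 h
    · rw [← heqβ]
      exact effPot_monotone ha hw0 hw1 hζ hx.2 h
  · intro x hx
    rcases lt_or_ge x (endα' a w) with h | h
    · exact effPot_antitone ha hw0 hw1 hζ h.le hα.le
    · have h' : endβ' a w ≤ x := le_of_not_ge fun h2 => hx ⟨h, h2⟩
      rw [← heqβ]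
      exact effPot_monotone ha hw0 hw1 hζ h' hβ.le
  · have hae : ∀ᵐ x ∂(eqMeasure a w), x ∈ Set.Ioo (xL a w 0) (xR a w 0) := hN.ae_mem
    rw [xL_zero ha hw0 hw1, xR_zero ha hw0 hw1] at hae
    filter_upwards [hae] with x hx hxS
    rcases lt_or_ge x (endα' a w) with h | h
    · exact effPot_eq_left ha hw0 hw1 hζ ⟨hx.1.le, h.le⟩
    · have h' : endβ' a w ≤ x := le_of_not_ge fun h2 => hxS ⟨h, h2⟩
      rw [← heqβ]
      exact effPot_eq_right ha hw0 hw1 hζ ⟨h', hx.2.le⟩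

/-! ### Uniqueness of the end-points -/

/-- Continuous densities equal almost everywhere are equal everywhere, but only after
`ENNReal.ofReal`: a real density may take arbitrary nonpositive values where the measure vanishes.
-/
lemma ofReal_density_unique {ν : Measure ℝ} [SigmaFinite ν] {ρ₁ ρ₂ : ℝ → ℝ} (h₁ : Continuous ρ₁)
    (h₂ : Continuous ρ₂) (e₁ : ν = volume.withDensity fun x => ENNReal.ofReal (ρ₁ x))
    (e₂ : ν = volume.withDensity fun x => ENNReal.ofReal (ρ₂ x)) (x : ℝ) :
    ENNReal.ofReal (ρ₁ x) = ENNReal.ofReal (ρ₂ x) := by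
  have c₁ : Continuous fun x => ENNReal.ofReal (ρ₁ x) := ENNReal.continuous_ofReal.comp h₁
  have c₂ : Continuous fun x => ENNReal.ofReal (ρ₂ x) := ENNReal.continuous_ofReal.comp h₂
  have hae := (withDensity_eq_iff_of_sigmaFinite (μ := (volume : Measure ℝ)) c₁.aemeasurable
    c₂.aemeasurable).1 (e₁.symm.trans e₂)
  exact congrFun ((Continuous.ae_eq_iff_eq volume c₁ c₂).1 hae) x

/-- A band point of one description cannot be saturated in the other, since the density there is
strictly below `1/(2γ)`; so an end of the second saturated interval cannot fall inside a band of the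
first. -/
lemma AreEndpoints.inner_le {γ : ℝ} (hγ : 0 < γ) {ν : Measure ℝ} [SigmaFinite ν]
    {α α' β' β α₂' β₂' : ℝ} (h : AreEndpoints γ ν α α' β' β)
    (h₂ : AreEndpoints γ ν α α₂' β₂' β) : α' ≤ α₂' ∧ β₂' ≤ β' := by
  obtain ⟨ρ, hc, hν, hsat, hband⟩ := h.density
  obtain ⟨ρ₂, hc₂, hν₂, hsat₂, hband₂⟩ := h₂.density
  have hu := ofReal_density_unique hc hc₂ hν hν₂
  have hγ2 : 0 < 1 / (2 * γ) := by positivity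
  have hne : ∀ x ∈ Set.Ioo α α' ∪ Set.Ioo β' β, x ∉ Set.Icc α₂' β₂' := by
    intro x hx hx₂
    have h3 := hband x hx
    have h4 := hu x
    rw [hsat₂ x hx₂, ENNReal.ofReal_eq_ofReal_iff h3.1.le hγ2.le] at h4
    exact h3.2.ne h4
  constructor
  · by_contra hlt
    exact hne α₂' (Or.inl ⟨h₂.lt₁, not_le.1 hlt⟩) ⟨le_rfl, (h₂.lt₂.trans h₂.lt₃).le⟩
  · by_contra hlt
    exact hne β₂' (Or.inr ⟨not_le.1 hlt, h₂.lt₄⟩) ⟨(h₂.lt₂.trans h₂.lt₃).le, le_rfl⟩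

lemma AreEndpoints.unique {γ : ℝ} (hγ : 0 < γ) {ν : Measure ℝ} [SigmaFinite ν]
    {α α' β' β α₂ α₂' β₂' β₂ : ℝ} (h : AreEndpoints γ ν α α' β' β)
    (h₂ : AreEndpoints γ ν α₂ α₂' β₂' β₂) : α = α₂ ∧ α' = α₂' ∧ β' = β₂' ∧ β = β₂ := by
  have hlt : α ≤ β := by linarith [h.lt₁, h.lt₂, h.lt₃, h.lt₄]
  have hs := h.support_eq.symm.trans h₂.support_eq
  obtain ⟨rfl, rfl⟩ := (Set.Icc_eq_Icc_iff hlt).1 hs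
  have h3 := h.inner_le hγ h₂
  have h4 := h₂.inner_le hγ h
  exact ⟨rfl, le_antisymm h3.1 h4.1, le_antisymm h4.2 h3.2, rfl⟩

end SixVertexAF
end

theorem proposition2p1 (γ t ζ ω q : ℝ) (ht : |t| < γ)
    (hζ : ζ = t / γ) (hω : ω = Real.pi * (1 + ζ) / 2)
    (hq : q = Real.exp (-(Real.pi ^ 2 / (2 * γ)))) :
    (∃! ν₀ : MeasureTheory.Measure ℝ, SixVertexAF.IsEquilibriumMeasure γ ζ ν₀) ∧
    ∀ ν₀ : MeasureTheory.Measure ℝ, SixVertexAF.IsEquilibriumMeasure γ ζ ν₀ →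
      (∃ α α' β' β : ℝ, SixVertexAF.AreEndpoints γ ν₀ α α' β' β) ∧
      ∀ α α' β' β : ℝ, SixVertexAF.AreEndpoints γ ν₀ α α' β' β →
        -- the end-points
        (α = -Real.pi *
            (deriv (SixVertexAF.theta1 q) (ω / 2) / SixVertexAF.theta1 q (ω / 2)) ∧
          α' = -Real.pi *
            (deriv (SixVertexAF.theta4 q) (ω / 2) / SixVertexAF.theta4 q (ω / 2)) ∧
          β' = -Real.pi *
            (deriv (SixVertexAF.theta3 q) (ω / 2) / SixVertexAF.theta3 q (ω / 2)) ∧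
          β = -Real.pi *
            (deriv (SixVertexAF.theta2 q) (ω / 2) / SixVertexAF.theta2 q (ω / 2))) ∧
        -- the differences
        (α' - α = Real.pi * SixVertexAF.theta4 q 0 ^ 2 *
            (SixVertexAF.theta2 q (ω / 2) * SixVertexAF.theta3 q (ω / 2) /
              (SixVertexAF.theta1 q (ω / 2) * SixVertexAF.theta4 q (ω / 2))) ∧
          β' - α' = Real.pi * SixVertexAF.theta2 q 0 ^ 2 *
            (SixVertexAF.theta1 q (ω / 2) * SixVertexAF.theta2 q (ω / 2) /
              (SixVertexAF.theta3 q (ω / 2) * SixVertexAF.theta4 q (ω / 2))) ∧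
          β - β' = Real.pi * SixVertexAF.theta4 q 0 ^ 2 *
            (SixVertexAF.theta1 q (ω / 2) * SixVertexAF.theta4 q (ω / 2) /
              (SixVertexAF.theta2 q (ω / 2) * SixVertexAF.theta3 q (ω / 2))) ∧
          β - α = Real.pi * SixVertexAF.theta2 q 0 ^ 2 *
            (SixVertexAF.theta3 q (ω / 2) * SixVertexAF.theta4 q (ω / 2) /
              (SixVertexAF.theta1 q (ω / 2) * SixVertexAF.theta2 q (ω / 2))) ∧
          β - α' = Real.pi * SixVertexAF.theta3 q 0 ^ 2 *
            (SixVertexAF.theta1 q (ω / 2) * SixVertexAF.theta3 q (ω / 2) /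
              (SixVertexAF.theta2 q (ω / 2) * SixVertexAF.theta4 q (ω / 2))) ∧
          β' - α = Real.pi * SixVertexAF.theta3 q 0 ^ 2 *
            (SixVertexAF.theta2 q (ω / 2) * SixVertexAF.theta4 q (ω / 2) /
              (SixVertexAF.theta1 q (ω / 2) * SixVertexAF.theta3 q (ω / 2)))) ∧
        -- the centroid
        (α + α' + β' + β) / 4 = -(Real.pi / 2) *
          (deriv (SixVertexAF.theta2 q) (Real.pi * ζ / 2) /
            SixVertexAF.theta2 q (Real.pi * ζ / 2)) := by
  have hγ : 0 < γ := (abs_nonneg t).trans_lt ht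
  have hp := Real.pi_pos
  have hζ1 : |ζ| < 1 := by
    rw [hζ, abs_div, abs_of_pos hγ, div_lt_one hγ]
    exact ht
  have hζ2 := abs_lt.1 hζ1
  -- This value makes the nome equal to `q` and at the same time the maximal density `a/π` equal to
  -- `1/(2γ)`.
  set a : ℝ := Real.pi / (2 * γ) with ha_def
  have ha : 0 < a := by positivity
  have haγ : a / Real.pi = 1 / (2 * γ) := by
    rw [ha_def]
    field_simp
  have hqa : q = SixVertexAF.nome a := by
    rw [hq, SixVertexAF.nome, ha_def]
    congr 1
    ring
  have hw0 : 0 < ω / 2 := by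
    rw [hω]
    have := mul_pos hp (by linarith [hζ2.1] : 0 < 1 + ζ)
    linarith
  have hw1 : ω / 2 < Real.pi / 2 := by
    rw [hω]
    have := mul_pos hp (by linarith [hζ2.2] : 0 < 1 - ζ)
    linarith
  have hwζ : 4 * (ω / 2) = Real.pi * (1 + ζ) := by
    rw [hω]
    ring
  have hcen : Real.pi * ζ / 2 = 2 * (ω / 2) - Real.pi / 2 := by
    rw [hω]
    ring
  obtain ⟨heq, huniq⟩ :=
    SixVertexAF.isEquilibriumMeasure_eqMeasure ha hw0 hw1 hγ haγ hζ1 hwζ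
  have hends := SixVertexAF.areEndpoints_eqMeasure ha hw0 hw1 haγ
  refine ⟨⟨_, heq, huniq⟩, fun ν₀ hν₀ => ?_⟩
  obtain rfl := huniq ν₀ hν₀
  refine ⟨⟨_, _, _, _, hends⟩, fun α α' β' β h => ?_⟩
  have hprob := SixVertexAF.isProbabilityMeasure_eqMeasure ha hw0 hw1
  obtain ⟨rfl, rfl, rfl, rfl⟩ := h.unique hγ hends
  rw [hcen, hqa]
  exact ⟨⟨rfl, rfl, rfl, rfl⟩, SixVertexAF.endpoint_differences ha hw0 hw1,
    SixVertexAF.endpoint_centroid ha hw0 hw1⟩
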